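/- Let $d\ge 1$ and let $\mathcal N$ be the space of simple counting measures $\mu$ on $\mathbb R^d\times(0,\infty)$ (at most one atom $(t,s)$ above each position $t$; $s$ is the score, written $\mu(t)$, with $\mu(t)=0$ if there is none) that are finite on $B\times(\varepsilon,\infty)$ for every bounded $B$ and $\varepsilon>0$; $\mathcal N$ carries the vague topology generated by $\mu\mapsto\int f\,d\mu$, $f$ bounded continuous with support in such a set, and the $\sigma$-algebra generated by the maps $\mu\mapsto\mu(B)$, $B$ Borel. Let $\mathcal N_{01}\subset\mathcal N$ consist of those $\mu$ that are finite on $\mathbb R^d\times(\varepsilon,\infty)$ for all $\varepsilon>0$. For $\mu\in\mathcal N_{01}$, $M(\mu)$ is the maximal score and $A^{\rm fm}(\mu)$ the lexicographically smallest position at which it is attained; $[\mu]$ is the class of $\mu$ modulo shifts $\varphi_y$, $\varphi_y(t,s)=(t-y,s)$, and $\tilde{\mathcal N}_{01}$ is the space of these classes with the quotient $\sigma$-algebra; $T_{v,u}$ moves each atom $(t,s)$ to $(t/v,s/u)$, and $T_{1,u}[\mu]=[T_{1,u}\mu]$. Moving maxima model. Let $m$ be a probability measure on $(0,\infty)$ with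 regularly varying tail of index $\alpha>0$, i.e. $m(uy,\infty)/m(u,\infty)\to y^{-\alpha}$ as $u\to\infty$ for all $y>0$. Let $P=\sum_i\delta_{(t_i,\zeta_i)}$ be a stationary unit rate Poisson process on $\mathbb R^d$, independently marked with mark distribution $m$, and $P'=\sum_i\delta_{t_i}$. Let $\Phi$ be a measurable rule that assigns to each locally finite $S\subset\mathbb R^d$ and $t\in S$ a finite set $\Phi(t,S)\subset S$ containing $t$, with $\Phi(t-x,S-x)=\Phi(t,S)-x$. Let $w:\mathbb R^d\to[0,\infty)$ be measurable and bounded with $w(0)>0$. Put $X=\{(t,\psi(t)):t\in P'\}$, where $\psi(t)=\max_{x\in\Phi(t,P')}w(x-t)P(x)$. Let $\tilde P'=P'+\delta_0$, $\tilde\Phi(t)=\Phi(t,\tilde P')$, assume that $\mathbb E[\#\tilde\Phi(0)]<\infty$, and let $W=\{(t,w(-t)):t\in\tilde P',\ 0\in\tilde\Phi(t)\}$, with atoms of score $0$ deleted. Tail configuration. A tail configuration of $X$ (with scaling function $r\equiv1$) is a random element $Y$ of $\mathcal N$ that almost surely has a point at the origin with score greater than $1$ and such that, with $\tilde X$ the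 Palm version of $X$ and $\xi=\tilde X(0)$, $\mathbb P(T_{1,u}\tilde X\in\cdot\mid\xi>u)\to\mathbb P(Y\in\cdot)$ weakly as $u\to\infty$. Its spectral tail configuration is $\Theta=T_{1,\eta}Y$ with $\eta=Y(0)$. The extremal index is $\vartheta=\mathbb P(A^{\rm fm}(\Theta)=0)$, and the typical cluster $Q$ has the distribution $$\mathbb P(Q\in\cdot)=\vartheta^{-1}\,\mathbb E\Big[\mathbf 1\{T_{1,M(\Theta)}\Theta\in\cdot\}\,\frac{M(\Theta)^\alpha}{\sum_{(t,s)\in\Theta}s^\alpha}\Big].$$ Proposition. $X$ has a tail configuration. For every tail configuration $Y$ of $X$: the tail index of $X$ is $\alpha$, i.e. $\mathbb P(\eta>y)=y^{-\alpha}$ for $y\ge1$; $\Theta\in\mathcal N_{01}$ almost surely; $0<\mathbb E[M(W)^\alpha]$ and $\mathbb E[\sum_{(t,s)\in W}s^\alpha]<\infty$; for all measurable $B\subset\tilde{\mathcal N}_{01}$, $$\mathbb P([Q]\in B)=\frac{1}{\mathbb E[M(W)^\alpha]}\,\mathbb E\big[\mathbf 1\{T_{1,M(W)}[W]\in B\}\,M(W)^\alpha\big],$$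 and the same holds if $Q$ is instead given the distribution $\mathbb P(\Theta\in\cdot\mid A^{\rm fm}(\Theta)=0)$; moreover $$\vartheta=\frac{\mathbb E\big[\max_{(t,s)\in W}s^\alpha\big]}{\mathbb E\big[\sum_{(t,s)\in W}s^\alpha\big]}.$$ -/

import Mathlib

open MeasureTheory ProbabilityTheory Filter Topology
open scoped ENNReal

noncomputable section

namespace MovingMaxima

/-- Positions: points of `ℝ^d` with the Euclidean norm. -/
abbrev Pos (d : ℕ) : Type := EuclideanSpace ℝ (Fin d)

/-- The space of simple counting measures on `ℝ^d × (0,∞)` that are finite on all sets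
`B × (ε,∞)` with `B` bounded and `ε > 0`. A simple counting measure is represented by the set of
its atoms `(t, s)` (position, score). -/
@[ext]
structure Conf (d : ℕ) : Type where
  atoms : Set (Pos d × ℝ)
  pos : ∀ p ∈ atoms, 0 < p.2
  simple : ∀ p ∈ atoms, ∀ q ∈ atoms, p.1 = q.1 → p = q
  locFinite : ∀ R ε : ℝ, 0 < ε → {p | p ∈ atoms ∧ ‖p.1‖ ≤ R ∧ ε < p.2}.Finite

/-- The `σ`-algebra generated by the maps `μ ↦ μ(B)`, `B` Borel. -/
instance instMeasurableSpaceConf (d : ℕ) : MeasurableSpace (Conf d) :=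
  ⨆ (B : Set (Pos d × ℝ)) (_ : MeasurableSet B),
    MeasurableSpace.comap (fun μ : Conf d => (μ.atoms ∩ B).encard) ⊤

/-- Test functions of the vague topology: bounded continuous functions supported in
`B × (ε,∞)` with `B` bounded and `ε > 0` (extended by zero to `ℝ^d × ℝ`). -/
structure IsVagueTest {d : ℕ} (f : Pos d × ℝ → ℝ) : Prop where
  cont : Continuous f
  bdd : ∃ C : ℝ, ∀ p, |f p| ≤ C
  supp : ∃ R ε : ℝ, 0 < ε ∧ ∀ p, f p ≠ 0 → ‖p.1‖ ≤ R ∧ ε < p.2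

/-- The vague topology on `Conf d`: the coarsest topology for which `μ ↦ μ(f) = ∑_{p ∈ μ} f p`
is continuous for every test function `f`. -/
instance instTopologicalSpaceConf (d : ℕ) : TopologicalSpace (Conf d) :=
  ⨅ (f : Pos d × ℝ → ℝ) (_ : IsVagueTest f),
    TopologicalSpace.induced (fun μ : Conf d => ∑' p : μ.atoms, f p.1) inferInstance

/-- Marked point processes take values here: configurations with finitely many points (whatever
their scores) above each bounded set of positions. -/
abbrev MarkedConf (d : ℕ) : Type :=
  {μ : Conf d // ∀ R : ℝ, {p | p ∈ μ.atoms ∧ ‖p.1‖ ≤ R}.Finite}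

/-- Configurations with finitely many scores above each level `ε > 0`. -/
abbrev TailConf (d : ℕ) : Type :=
  {μ : Conf d // ∀ ε : ℝ, 0 < ε → {p | p ∈ μ.atoms ∧ ε < p.2}.Finite}

/-- Simple locally finite point measures on `ℝ^d`, represented by their sets of atoms. -/
@[ext]
structure GroundConf (d : ℕ) : Type where
  pts : Set (Pos d)
  locFinite : ∀ R : ℝ, {t | t ∈ pts ∧ ‖t‖ ≤ R}.Finite

/-- The `σ`-algebra generated by the maps `S ↦ #(S ∩ B)`, `B` Borel. -/
instance instMeasurableSpaceGroundConf (d : ℕ) : MeasurableSpace (GroundConf d) :=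
  ⨆ (B : Set (Pos d)) (_ : MeasurableSet B),
    MeasurableSpace.comap (fun S : GroundConf d => (S.pts ∩ B).encard) ⊤

variable {d : ℕ}

/-! ### Shifts and scalings -/

/-- `φ_z μ`: every atom `(t, s)` of `μ` becomes `(t - z, s)`. -/
def shift (z : Pos d) (μ : Conf d) : Conf d where
  atoms := {p | (p.1 + z, p.2) ∈ μ.atoms}
  pos := fun p hp => μ.pos (p.1 + z, p.2) hp
  simple := fun p hp q hq h => by
    have := μ.simple _ hp _ hq (by simp [h])
    exact Prod.ext h (Prod.ext_iff.1 this).2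
  locFinite := fun R ε hε => by
    have hinj : Function.Injective (fun p : Pos d × ℝ => (p.1 + z, p.2)) := by
      rintro ⟨a, b⟩ ⟨a', b'⟩ h
      simpa using h
    refine ((μ.locFinite (R + ‖z‖) ε hε).preimage hinj.injOn).subset ?_
    rintro p ⟨hp, hR, hs⟩
    exact ⟨hp, (norm_add_le _ _).trans (by linarith), hs⟩

/-- The shift on marked configurations. -/
def shiftMarked (z : Pos d) (μ : MarkedConf d) : MarkedConf d :=
  ⟨shift z μ.1, fun R => by
    have hinj : Function.Injective (fun p : Pos d × ℝ => (p.1 + z, p.2)) := by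
      rintro ⟨a, b⟩ ⟨a', b'⟩ h
      simpa using h
    refine ((μ.2 (R + ‖z‖)).preimage hinj.injOn).subset ?_
    rintro p ⟨hp, hR⟩
    exact ⟨hp, (norm_add_le _ _).trans (by linarith)⟩⟩

/-- The shift of a point configuration in `ℝ^d`: every `t ∈ S` becomes `t - z`. -/
def shiftGround (z : Pos d) (S : GroundConf d) : GroundConf d where
  pts := {t | t + z ∈ S.pts}
  locFinite := fun R => by
    refine ((S.locFinite (R + ‖z‖)).preimage (add_left_injective z).injOn).subset ?_
    rintro t ⟨ht, hR⟩
    exact ⟨ht, (norm_add_le _ _).trans (by linarith)⟩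

/-- `T_{v,u} μ` for `u, v > 0`: every atom `(t, s)` of `μ` becomes `(t / v, s / u)`.
(For other `u, v` it is not used and set to be the null measure.) -/
def scale (v u : ℝ) (μ : Conf d) : Conf d where
  atoms := {p | 0 < v ∧ 0 < u ∧ (v • p.1, u * p.2) ∈ μ.atoms}
  pos := fun p hp => pos_of_mul_pos_right (μ.pos _ hp.2.2) hp.2.1.le
  simple := fun p hp q hq h => by
    have := μ.simple _ hp.2.2 _ hq.2.2 (by simp [h])
    exact Prod.ext h (mul_left_cancel₀ hp.2.1.ne' (Prod.ext_iff.1 this).2)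
  locFinite := fun R ε hε => by
    by_cases hvu : 0 < v ∧ 0 < u
    · obtain ⟨hv, hu⟩ := hvu
      have hinj : Function.Injective (fun p : Pos d × ℝ => (v • p.1, u * p.2)) := by
        rintro ⟨a, b⟩ ⟨a', b'⟩ h
        simpa [hv.ne', hu.ne'] using h
      refine ((μ.locFinite (v * R) (u * ε) (by positivity)).preimage hinj.injOn).subset ?_
      rintro p ⟨hp, hR, hs⟩
      refine ⟨hp.2.2, ?_, ?_⟩
      · simp only [norm_smul, Real.norm_eq_abs, abs_of_pos hv]
        gcongr
      · dsimp only
        gcongr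
    · refine Set.finite_empty.subset ?_
      rintro p ⟨hp, -⟩
      exact (hvu ⟨hp.1, hp.2.1⟩).elim

/-! ### Functionals of configurations -/

/-- `μ(t)`: the score of `μ` at the position `t`, equal to `0` if `μ` has no atom there. -/
def score (μ : Conf d) (t : Pos d) : ℝ := sSup {s | (t, s) ∈ μ.atoms}

/-- The maximal score `M(μ)`. -/
def maxScore (μ : Conf d) : ℝ := sSup (Prod.snd '' μ.atoms)

/-- `∑_{(t,s) ∈ μ} s^α`. -/
def scoreSum (α : ℝ) (μ : Conf d) : ℝ≥0∞ := ∑' p : μ.atoms, ENNReal.ofReal (p.1.2 ^ α)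

/-- `A^fm(μ) = t`: the position `t` is the lexicographically smallest among those at which the
maximal score of `μ` is attained. -/
def IsFirstMaximum (μ : Conf d) (t : Pos d) : Prop :=
  (t, maxScore μ) ∈ μ.atoms ∧
    ∀ t' : Pos d, (t', maxScore μ) ∈ μ.atoms → toLex (fun i => t i) ≤ toLex (fun i => t' i)

/-- The first maximum anchor is well defined on nonzero elements of `TailConf d`. -/
theorem existsUnique_isFirstMaximum (μ : TailConf d) (hμ : μ.1.atoms.Nonempty) :
    ∃! t, IsFirstMaximum μ.1 t := by
  obtain ⟨p, hp⟩ := hμ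
  have hp0 : 0 < p.2 := μ.1.pos p hp
  have hfin := μ.2 (p.2 / 2) (by linarith)
  obtain ⟨q, hq, hqmax⟩ := Set.exists_max_image _ Prod.snd hfin ⟨p, hp, by linarith⟩
  have hall : ∀ a ∈ μ.1.atoms, a.2 ≤ q.2 := by
    intro a ha
    by_cases h : p.2 / 2 < a.2
    · exact hqmax a ⟨ha, h⟩
    · have := hqmax p ⟨hp, by linarith⟩
      linarith
  have hM : maxScore μ.1 = q.2 := by
    refine IsGreatest.csSup_eq ⟨⟨q, hq.1, rfl⟩, ?_⟩
    rintro _ ⟨a, ha, rfl⟩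
    exact hall a ha
  have hfin2 : {t : Pos d | (t, maxScore μ.1) ∈ μ.1.atoms}.Finite := by
    refine (hfin.image Prod.fst).subset ?_
    intro t ht
    exact ⟨(t, maxScore μ.1), ⟨ht, by rw [hM]; exact hq.2⟩, rfl⟩
  obtain ⟨t, ht, htmin⟩ := Set.exists_min_image _ (fun t : Pos d => toLex (fun i => t i)) hfin2
    ⟨q.1, by simpa [hM] using hq.1⟩
  refine ⟨t, ⟨ht, htmin⟩, fun t' ht' => ?_⟩
  have h := le_antisymm (htmin t' ht'.1) (ht'.2 t ht)
  ext i
  exact (congrFun (toLex.injective h) i).symm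

/-! ### Classes of configurations modulo shifts -/

/-- Two configurations are equivalent if one is a shift of the other. -/
def shiftSetoid (d : ℕ) : Setoid (TailConf d) where
  r μ ν := ∃ y : Pos d, shift y μ.1 = ν.1
  iseqv :=
    { refl := fun μ => ⟨0, by ext p; simp [shift]⟩
      symm := by
        rintro μ ν ⟨y, h⟩
        refine ⟨-y, ?_⟩
        rw [← h]
        ext p
        simp [shift]
      trans := by
        rintro μ ν ρ ⟨y, h⟩ ⟨z, h'⟩
        refine ⟨z + y, ?_⟩
        rw [← h', ← h]
        ext p
        simp [shift, add_assoc] }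

/-- The quotient of `TailConf d` by shifts. It carries the quotient `σ`-algebra (Mathlib's instance
on quotients): a set of classes is measurable iff its preimage in `TailConf d` is. -/
abbrev ClusterClass (d : ℕ) : Type := Quotient (shiftSetoid d)

/-- The event `[μ] ∈ B`, for a set `B` of classes. -/
def ClassMem (μ : Conf d) (B : Set (ClusterClass d)) : Prop :=
  ∃ h : ∀ ε : ℝ, 0 < ε → {p | p ∈ μ.atoms ∧ ε < p.2}.Finite,
    (Quotient.mk (shiftSetoid d) ⟨μ, h⟩ : ClusterClass d) ∈ B

/-- The distribution of the class `[Q]`, when `L` is the distribution of `Q` and is concentrated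
on `TailConf d`. -/
def classLaw (L : Measure (Conf d)) : Measure (ClusterClass d) :=
  (L.comap (Subtype.val : TailConf d → Conf d)).map (Quotient.mk (shiftSetoid d))

/-! ### Palm versions and tail configurations

Random configurations enter through their distributions. -/

/-- The intensity: the mean number of points with position in the unit cube. -/
def intensity (L : Measure (MarkedConf d)) : ℝ≥0∞ :=
  ∫⁻ μ, (({p | p ∈ μ.1.atoms ∧ ∀ i, p.1 i ∈ Set.Icc (0 : ℝ) 1}.encard : ℕ∞) : ℝ≥0∞) ∂L

/-- `Lt` is the distribution of the Palm version of a stationary marked point process with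
distribution `L` (refined Campbell formula). -/
structure IsPalmVersion (L Lt : Measure (MarkedConf d)) : Prop where
  prob : IsProbabilityMeasure Lt
  campbell : ∀ h : Pos d × MarkedConf d → ℝ≥0∞, Measurable h →
    ∫⁻ μ, ∑' p : μ.1.atoms, h (p.1.1, shiftMarked p.1.1 μ) ∂L =
      intensity L * ∫⁻ t : Pos d, ∫⁻ μ, h (t, μ) ∂Lt

/-- `ν` is the distribution of a tail configuration `Y`, with respect to the scaling function `r`,
of a stationary marked point process `X` with distribution `L`: almost surely `Y` has a point at
the origin with score greater than `1`, and, `Xt` being the Palm version of `X` and `ξ` its score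
at the origin, the law of `T_{r(u),u} Xt` given `ξ > u` converges weakly to `ν` as `u → ∞`, for
the vague topology. (Vaguely continuous functions are measurable, so requiring measurability of
`h` is no restriction.) -/
structure IsTailConfiguration (r : ℝ → ℝ) (L : Measure (MarkedConf d)) (ν : Measure (Conf d)) :
    Prop where
  prob : IsProbabilityMeasure ν
  origin : ∀ᵐ μ ∂ν, 1 < score μ 0
  conv : ∃ Lt : Measure (MarkedConf d), IsPalmVersion L Lt ∧
    ∀ h : Conf d → ℝ, Continuous h → Measurable h → (∃ C : ℝ, ∀ μ, |h μ| ≤ C) →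
      Tendsto
        (fun u : ℝ => (∫ μ in {μ : MarkedConf d | u < score μ.1 0}, h (scale (r u) u μ.1) ∂Lt) /
          Lt.real {μ : MarkedConf d | u < score μ.1 0})
        atTop (𝓝 (∫ μ, h μ ∂ν))

/-- `α` is the tail index: the tail score `η = Y(0)` is Pareto(`α`) distributed. -/
def IsTailIndex (ν : Measure (Conf d)) (α : ℝ) : Prop :=
  0 < α ∧ ∀ y : ℝ, 1 ≤ y → ν {μ | y < score μ 0} = ENNReal.ofReal (y ^ (-α))

/-- The distribution of the spectral tail configuration `Θ = T_{η^β,η} Y`, where `η = Y(0)`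
and `β = 0` is the index of the scaling function `r ≡ 1`. -/
def spectralLaw (ν : Measure (Conf d)) : Measure (Conf d) :=
  ν.map (fun μ => scale 1 (score μ 0) μ)

/-- The extremal index `ϑ = P(A^fm(Θ) = 0)`, where `θ` is the distribution of `Θ`. -/
def extremalIndex (θ : Measure (Conf d)) : ℝ≥0∞ := θ {μ | IsFirstMaximum μ 0}

/-- The distribution of the typical cluster `Q` as `P(Θ ∈ · | A^fm(Θ) = 0)`. -/
def typicalClusterCond (θ : Measure (Conf d)) : Measure (Conf d) :=
  ProbabilityTheory.cond θ {μ | IsFirstMaximum μ 0}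

/-- The distribution of the normalized typical cluster `Q` as
`ϑ⁻¹ E[1{T_{1,M(Θ)} Θ ∈ ·} M(Θ)^α / ∑_{(t,s) ∈ Θ} s^α]`. -/
def typicalCluster (α : ℝ) (θ : Measure (Conf d)) : Measure (Conf d) :=
  (extremalIndex θ)⁻¹ •
    (θ.withDensity (fun μ => ENNReal.ofReal (maxScore μ ^ α) / scoreSum α μ)).map
      (fun μ => scale 1 (maxScore μ) μ)

/-! ### The moving maxima model -/

/-- The projection `μ'` of `μ` to the positions. -/
def proj (μ : MarkedConf d) : GroundConf d where
  pts := Prod.fst '' μ.1.atoms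
  locFinite := fun R => by
    refine ((μ.2 R).image Prod.fst).subset ?_
    rintro _ ⟨⟨p, hp, rfl⟩, hR⟩
    exact ⟨p, ⟨hp, hR⟩, rfl⟩

/-- `S + δ_0`. -/
def addOrigin (S : GroundConf d) : GroundConf d where
  pts := insert 0 S.pts
  locFinite := fun R => by
    refine ((S.locFinite R).insert 0).subset ?_
    rintro t ⟨rfl | ht, hR⟩
    · exact Set.mem_insert _ _
    · exact Set.mem_insert_of_mem _ ⟨ht, hR⟩

/-- `S` is a stationary Poisson process on `ℝ^d` with unit rate. -/
structure IsUnitPoisson {Ω : Type*} [MeasurableSpace Ω] (Pr : Measure Ω)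
    (S : Ω → GroundConf d) : Prop where
  measurable : Measurable S
  count : ∀ B : Set (Pos d), MeasurableSet B → volume B ≠ ∞ → ∀ k : ℕ,
    Pr {ω | ((S ω).pts ∩ B).encard = k} =
      ENNReal.ofReal (Real.exp (-(volume.real B)) * volume.real B ^ k / (k.factorial : ℝ))
  indep : ∀ (n : ℕ) (B : Fin n → Set (Pos d)), (∀ i, MeasurableSet (B i)) →
    Pairwise (fun i j => Disjoint (B i) (B j)) →
    iIndepFun (fun (i : Fin n) (ω : Ω) => ((S ω).pts ∩ B i).encard) Pr

/-- `P` is a unit rate stationary Poisson process on `ℝ^d`, independently marked with mark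
distribution `m`: `P = ∑_i δ_{(t_i, ζ_i)}` with the `t_i` distinct and forming a unit rate Poisson
process, and the `ζ_i` i.i.d. with distribution `m` and independent of the `t_i`. -/
structure IsMarkedPoisson {Ω : Type*} [MeasurableSpace Ω] (Pr : Measure Ω) (m : Measure ℝ)
    (P : Ω → MarkedConf d) : Prop where
  measurable : Measurable P
  poisson : IsUnitPoisson Pr (fun ω => proj (P ω))
  marks : ∃ (t : ℕ → Ω → Pos d) (ζ : ℕ → Ω → ℝ),
    (∀ i, Measurable (t i)) ∧ (∀ i, Measurable (ζ i)) ∧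
    (∀ᵐ ω ∂Pr, Function.Injective (fun i => t i ω) ∧
      (P ω).1.atoms = Set.range (fun i => (t i ω, ζ i ω))) ∧
    (∀ i, Pr.map (ζ i) = m) ∧ iIndepFun ζ Pr ∧
    IndepFun (fun ω i => t i ω) (fun ω i => ζ i ω) Pr

/-- `m` has a regularly varying right tail of index `α`. -/
def IsRegularlyVaryingTail (m : Measure ℝ) (α : ℝ) : Prop :=
  ∀ y : ℝ, 0 < y →
    Tendsto (fun u : ℝ => m.real (Set.Ioi (u * y)) / m.real (Set.Ioi u)) atTop (𝓝 (y ^ (-α)))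

/-- `Φ` is a measurable, shift-equivariant rule that assigns to every point `t` of a configuration
`S` a finite neighborhood `Φ(t, S) ⊆ S` which contains `t`. -/
structure IsNeighborhoodRule (Φ : Pos d → GroundConf d → GroundConf d) : Prop where
  measurable : Measurable (fun q : Pos d × GroundConf d => Φ q.1 q.2)
  finite : ∀ S : GroundConf d, ∀ t ∈ S.pts, (Φ t S).pts.Finite
  subset : ∀ S : GroundConf d, ∀ t ∈ S.pts, (Φ t S).pts ⊆ S.pts
  self_mem : ∀ S : GroundConf d, ∀ t ∈ S.pts, t ∈ (Φ t S).pts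
  equivariant : ∀ (S : GroundConf d) (x : Pos d), ∀ t ∈ S.pts,
    Φ (t - x) (shiftGround x S) = shiftGround x (Φ t S)

/-- The scoring function `ψ(t, μ) = max_{x ∈ Φ(t, μ')} w(x - t) μ(x)`. -/
def scoring (w : Pos d → ℝ) (Φ : Pos d → GroundConf d → GroundConf d) (t : Pos d)
    (μ : MarkedConf d) : ℝ :=
  sSup ((fun x => w (x - t) * score μ.1 x) '' (Φ t (proj μ)).pts)

/-- `Ψ(μ) = {(t, ψ(t, μ)) : t ∈ μ'}`, restricted to positive scores. -/
def scored (w : Pos d → ℝ) (Φ : Pos d → GroundConf d → GroundConf d) (μ : MarkedConf d) :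
    MarkedConf d :=
  have hfin : ∀ R : ℝ, {p : Pos d × ℝ |
      (p.1 ∈ (proj μ).pts ∧ p.2 = scoring w Φ p.1 μ ∧ 0 < p.2) ∧ ‖p.1‖ ≤ R}.Finite := fun R => by
    refine (((proj μ).locFinite R).image (fun t => (t, scoring w Φ t μ))).subset ?_
    rintro ⟨t, s⟩ ⟨⟨ht, hs, -⟩, hR⟩
    exact ⟨t, ⟨ht, hR⟩, Prod.ext rfl hs.symm⟩
  ⟨{ atoms := {p | p.1 ∈ (proj μ).pts ∧ p.2 = scoring w Φ p.1 μ ∧ 0 < p.2}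
     pos := fun _ hp => hp.2.2
     simple := fun _ hp _ hq h => Prod.ext h (by rw [hp.2.1, hq.2.1, h])
     locFinite := fun R _ _ => (hfin R).subset fun _ hp => ⟨hp.1, hp.2.1⟩ }, hfin⟩

/-- `{(t, w(-t)) : t ∈ S, 0 ∈ Φ(t, S)}`, restricted to positive scores. The random configuration
`W` is obtained for `S = P' + δ_0`. -/
def clusterW (w : Pos d → ℝ) (Φ : Pos d → GroundConf d → GroundConf d) (S : GroundConf d) :
    Conf d where
  atoms := {p | p.1 ∈ S.pts ∧ 0 ∈ (Φ p.1 S).pts ∧ p.2 = w (-p.1) ∧ 0 < p.2}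
  pos := fun _ hp => hp.2.2.2
  simple := fun _ hp _ hq h => Prod.ext h (by rw [hp.2.2.1, hq.2.2.1, h])
  locFinite := fun R ε _ => by
    refine ((S.locFinite R).image (fun t => (t, w (-t)))).subset ?_
    rintro ⟨t, s⟩ ⟨⟨ht, -, hs, -⟩, hR, -⟩
    exact ⟨t, ⟨ht, hR⟩, Prod.ext rfl hs.symm⟩

end MovingMaxima

end

open MovingMaxima

noncomputable section

namespace MovingMaxima

variable {d : ℕ}

/-! ### Counting kernels -/

/-! Adding the origin to a Poisson process gives its Palm version (Slivnyak-Mecke). Independent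
marking and the shift-equivariant scoring respect this, so the Palm version of `X` is obtained by
scoring `P' + δ_0` with i.i.d. marks. This is the content of `IsUnitPoisson.mecke_measure`,
`marked_campbell` and `isPalmVersion_palmLaw`.

Fix the positions. The score at the origin exceeds `u` iff `w(x) ζ_x > u` for one of the finitely
many neighbors `x` of `0`. By independence and regular variation two such marks are negligible
against one. If `x` is responsible, then relative to `P(ζ > u)` the event has weight `w(x)^α`, the
mark `ζ_x / u` tends to a Pareto variable divided by `w(x)`, and all other rescaled marks vanish
(`tendsto_big_jump`). In the limit only the points that have `x` as a neighbor survive, with scores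
proportional to the weights they give to `x`. As `w` is bounded and the mean number of neighbors of
the origin is finite, dominated convergence allows averaging over the positions
(`tendsto_setIntegral_palmLaw`). The limit, described by `IsJumpMeasure`, becomes a tail
configuration after normalization. It splits into a Pareto score at the origin and an independent
angular part, and the latter is the spectral tail configuration.

The angular part still looks at the cluster of `x` from the origin. The mass transport principle
exchanges the two points: the sum over neighbors `x` of `0` becomes a sum over points that have `0`
as a neighbor, that is, over the atoms of `W` (`IsUnitPoisson.lintegral_clusterAt`). Hence `Θ`
arises from `W` by choosing an atom `(t, s)` with weight `s^α` and moving it to `(0, 1)`, as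
recorded in `IsClusterMixture`. All formulas follow from this. On `A^fm(Θ) = 0` the chosen atom is
the first maximum of `W`, which leaves the weight `M(W)^α`. Without this restriction, `M^α / ∑ s^α`
is the same for every choice of atom, and summing the weights `s^α` again leaves `M(W)^α`. So both
definitions of the typical cluster give the same class.

Every tail configuration is the one constructed: the Palm version is unique since the intensity is
`1`, and weak limits are unique because void probabilities, which determine a law, are limits of
integrals of vaguely continuous functions (`conf_measure_ext`). -/

theorem isSFiniteKernel_of_cover {α β : Type*} [MeasurableSpace α] [MeasurableSpace β]
    (κ : Kernel α β) (K : ℕ → Set β) (hK : ∀ n, MeasurableSet (K n))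
    (hfin : ∀ a n, κ a (K n) < ∞) (hcov : ∀ a, κ a (⋃ n, K n)ᶜ = 0) : IsSFiniteKernel κ := by
  have hD : ∀ n, MeasurableSet (disjointed K n) := fun n => MeasurableSet.disjointed hK n
  have hDfin : ∀ a n, κ a (disjointed K n) < ∞ := fun a n =>
    (measure_mono (disjointed_subset K n)).trans_lt (hfin a n)
  have hs : ∀ n k : ℕ, MeasurableSet
      {a | κ a (disjointed K n) ∈ Set.Ico (k : ℝ≥0∞) (k + 1)} := fun n k =>
    (κ.measurable_coe (hD n)) measurableSet_Ico
  -- The masses of the `n`-th piece are finite but not bounded in `a`. The parameter space is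
  -- therefore split by the integer part `k` of this mass, so that each kernel of the family has
  -- total mass at most `k + 1`.
  let η : ℕ × ℕ → Kernel α β := fun p =>
    Kernel.piecewise (hs p.1 p.2) (κ.restrict (hD p.1)) 0
  have hη : ∀ p, IsFiniteKernel (η p) := fun p => by
    refine ⟨⟨p.2 + 1, by simp, fun a => ?_⟩⟩
    simp only [η, Kernel.piecewise_apply']
    split_ifs with h
    · rw [Kernel.restrict_apply, Measure.restrict_apply MeasurableSet.univ, Set.univ_inter]
      exact h.2.le
    · simp
  have hsum : κ = Kernel.sum η := by
    ext a B hB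
    rw [Kernel.sum_apply' _ _ hB, ENNReal.tsum_prod']
    have h1 : ∀ n, ∑' k, η (n, k) a B = κ a (B ∩ disjointed K n) := fun n => by
      have h2 : ((⌊(κ a (disjointed K n)).toReal⌋₊ : ℕ) : ℝ≥0∞) ≤ κ a (disjointed K n) ∧
          κ a (disjointed K n) < (⌊(κ a (disjointed K n)).toReal⌋₊ : ℝ≥0∞) + 1 := by
        have e := ENNReal.ofReal_toReal (hDfin a n).ne
        constructor
        · rw [← e, ← ENNReal.ofReal_natCast, ENNReal.toReal_ofReal ENNReal.toReal_nonneg]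
          exact ENNReal.ofReal_le_ofReal (Nat.floor_le ENNReal.toReal_nonneg)
        · conv_lhs => rw [← e]
          rw [← ENNReal.ofReal_natCast, ← ENNReal.ofReal_one,
            ← ENNReal.ofReal_add (by positivity) zero_le_one]
          exact (ENNReal.ofReal_lt_ofReal_iff (by positivity)).2 (Nat.lt_floor_add_one _)
      rw [tsum_eq_single ⌊(κ a (disjointed K n)).toReal⌋₊]
      · simp only [η, Kernel.piecewise_apply']
        rw [if_pos (by exact h2), Kernel.restrict_apply, Measure.restrict_apply hB]
      · intro k hk
        simp only [η, Kernel.piecewise_apply']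
        rw [if_neg]
        · simp
        · rintro ⟨h3, h4⟩
          apply hk
          have e1 := h3.trans_lt h2.2
          have e2 := h2.1.trans_lt h4
          norm_cast at e1 e2
          omega
    simp_rw [h1]
    rw [← measure_iUnion _ (fun n => hB.inter (hD n)), ← Set.inter_iUnion, iUnion_disjointed]
    · refine le_antisymm ?_ (measure_mono Set.inter_subset_left)
      calc κ a B ≤ κ a ((B ∩ ⋃ n, K n) ∪ (⋃ n, K n)ᶜ) := measure_mono fun x hx => by
            by_cases h : x ∈ ⋃ n, K n
            · exact Or.inl ⟨hx, h⟩
            · exact Or.inr h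
        _ ≤ _ := (measure_union_le _ _).trans (by rw [hcov a, add_zero])
    · intro i j hij
      exact (disjoint_disjointed K hij).mono Set.inter_subset_right Set.inter_subset_right
  rw [hsum]
  have : ∀ p, IsSFiniteKernel (η p) := fun p => inferInstance
  exact Kernel.isSFiniteKernel_sum

/-- The main tool for measurability: a sum over the points of a configuration is an integral against
an s-finite counting kernel, hence depends measurably on the configuration and on further
parameters. -/
theorem measurable_lintegral_kernel_comp {α β γ : Type*} [MeasurableSpace α] [MeasurableSpace β]
    [MeasurableSpace γ] (κ : Kernel α γ) [IsSFiniteKernel κ] {g : β → α} (hg : Measurable g)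
    {f : β → γ → ℝ≥0∞} (hf : Measurable (Function.uncurry f)) :
    Measurable fun b => ∫⁻ c, f b c ∂κ (g b) :=
  hf.lintegral_kernel_prod_right (κ := κ.comap g hg)

theorem lintegral_count_restrict {α : Type*} [MeasurableSpace α] [MeasurableSingletonClass α]
    {A : Set α} (hA : A.Countable) (f : α → ℝ≥0∞) :
    ∫⁻ x, f x ∂Measure.count.restrict A = ∑' x : A, f x := by
  rw [lintegral_countable f hA]
  simp

theorem lintegral_count_restrict_image {α β : Type*} [MeasurableSpace α]
    [MeasurableSingletonClass α] [MeasurableSpace β] [MeasurableSingletonClass β]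
    {A : Set α} (hA : A.Countable) {e : α → β} (he : Set.InjOn e A) (f : β → ℝ≥0∞) :
    ∫⁻ x, f x ∂Measure.count.restrict (e '' A) = ∫⁻ x, f (e x) ∂Measure.count.restrict A := by
  rw [lintegral_count_restrict hA, lintegral_count_restrict (hA.image e), tsum_image f he]

theorem lintegral_count_restrict_graph {α : Type*} [MeasurableSpace α]
    [MeasurableSingletonClass α] {A : Set α} (hA : A.Countable) (a : α → ℝ)
    (f : α × ℝ → ℝ≥0∞) :
    ∫⁻ p, f p ∂Measure.count.restrict {p : α × ℝ | p.1 ∈ A ∧ p.2 = a p.1 ∧ 0 < p.2} =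
      ∫⁻ t, (if 0 < a t then f (t, a t) else 0) ∂Measure.count.restrict A := by
  have h1 : {p : α × ℝ | p.1 ∈ A ∧ p.2 = a p.1 ∧ 0 < p.2} =
      (fun t => (t, a t)) '' (A ∩ {t | 0 < a t}) := by
    ext ⟨t, s⟩
    constructor
    · rintro ⟨h1, h2, h3⟩
      dsimp only at h1 h2 h3
      subst h2
      exact ⟨t, ⟨h1, h3⟩, rfl⟩
    · rintro ⟨t', ⟨h1, h2⟩, h3⟩
      simp only [Prod.mk.injEq] at h3
      obtain ⟨rfl, rfl⟩ := h3
      exact ⟨h1, rfl, h2⟩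
  have hB : (A ∩ {t | 0 < a t}).Countable := hA.mono Set.inter_subset_left
  rw [h1, lintegral_count_restrict_image hB (fun x _ y _ h => (Prod.ext_iff.1 h).1),
    lintegral_count_restrict hB, lintegral_count_restrict hA, tsum_subtype (A ∩ {t | 0 < a t})
      (fun t => f (t, a t)), tsum_subtype A (fun t => if 0 < a t then f (t, a t) else 0)]
  congr 1
  ext t
  by_cases h : t ∈ A <;> by_cases h' : 0 < a t <;> simp [h, h', Set.indicator]

theorem GroundConf.countable_pts (S : GroundConf d) : S.pts.Countable := by
  have : S.pts = ⋃ n : ℕ, {t | t ∈ S.pts ∧ ‖t‖ ≤ n} := by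
    ext t
    simp only [Set.mem_iUnion, Set.mem_ofPred_eq]
    exact ⟨fun h => (exists_nat_ge ‖t‖).imp fun n hn => ⟨h, hn⟩, fun ⟨_, h, _⟩ => h⟩
  rw [this]
  exact Set.countable_iUnion fun n => (S.locFinite n).countable

theorem Conf.countable_atoms (μ : Conf d) : μ.atoms.Countable := by
  have : μ.atoms = ⋃ n : ℕ, {p | p ∈ μ.atoms ∧ ‖p.1‖ ≤ n ∧ ((n : ℝ) + 1)⁻¹ < p.2} := by
    ext p
    simp only [Set.mem_iUnion, Set.mem_ofPred_eq]
    refine ⟨fun h => ?_, fun ⟨_, h, _⟩ => h⟩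
    obtain ⟨n, hn⟩ := exists_nat_ge (max ‖p.1‖ p.2⁻¹)
    refine ⟨n, h, (le_max_left _ _).trans hn, ?_⟩
    have hp := μ.pos p h
    rw [inv_lt_comm₀ (by positivity) hp]
    linarith [(le_max_right _ _).trans hn]
  rw [this]
  exact Set.countable_iUnion fun n => (μ.locFinite n _ (by positivity)).countable

theorem measurable_encard_pts {B : Set (Pos d)} (hB : MeasurableSet B) :
    Measurable fun S : GroundConf d => (S.pts ∩ B).encard := by
  intro s _
  refine MeasurableSpace.measurableSet_iSup.2 (MeasurableSpace.GenerateMeasurable.basic _ ⟨B, ?_⟩)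
  refine MeasurableSpace.measurableSet_iSup.2 (MeasurableSpace.GenerateMeasurable.basic _ ⟨hB, ?_⟩)
  exact ⟨s, trivial, rfl⟩

theorem measurable_encard_atoms {B : Set (Pos d × ℝ)} (hB : MeasurableSet B) :
    Measurable fun μ : Conf d => (μ.atoms ∩ B).encard := by
  intro s _
  refine MeasurableSpace.measurableSet_iSup.2 (MeasurableSpace.GenerateMeasurable.basic _ ⟨B, ?_⟩)
  refine MeasurableSpace.measurableSet_iSup.2 (MeasurableSpace.GenerateMeasurable.basic _ ⟨hB, ?_⟩)
  exact ⟨s, trivial, rfl⟩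

theorem count_restrict_apply {α : Type*} [MeasurableSpace α] [MeasurableSingletonClass α]
    {A B : Set α} (hA : A.Countable) (hB : MeasurableSet B) :
    (Measure.count.restrict A) B = ((A ∩ B).encard : ℝ≥0∞) := by
  rw [Measure.restrict_apply hB, Measure.count_apply (hB.inter hA.measurableSet), Set.inter_comm]

/-- The counting measure of a ground configuration. -/
def groundCount (d : ℕ) : Kernel (GroundConf d) (Pos d) where
  toFun S := Measure.count.restrict S.pts
  measurable' := by
    refine Measure.measurable_of_measurable_coe _ fun B hB => ?_
    simp_rw [fun S : GroundConf d => count_restrict_apply S.countable_pts hB]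
    exact (Measurable.of_discrete (f := fun n : ℕ∞ => (n : ℝ≥0∞))).comp (measurable_encard_pts hB)

/-- The counting measure of a configuration. -/
def confCount (d : ℕ) : Kernel (Conf d) (Pos d × ℝ) where
  toFun μ := Measure.count.restrict μ.atoms
  measurable' := by
    refine Measure.measurable_of_measurable_coe _ fun B hB => ?_
    simp_rw [fun μ : Conf d => count_restrict_apply μ.countable_atoms hB]
    exact (Measurable.of_discrete (f := fun n : ℕ∞ => (n : ℝ≥0∞))).comp
      (measurable_encard_atoms hB)

theorem groundCount_apply (S : GroundConf d) :
    groundCount d S = Measure.count.restrict S.pts := rfl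

theorem confCount_apply (μ : Conf d) : confCount d μ = Measure.count.restrict μ.atoms := rfl

theorem groundCount_apply' (S : GroundConf d) {B : Set (Pos d)} (hB : MeasurableSet B) :
    groundCount d S B = ((S.pts ∩ B).encard : ℝ≥0∞) := count_restrict_apply S.countable_pts hB

theorem confCount_apply' (μ : Conf d) {B : Set (Pos d × ℝ)} (hB : MeasurableSet B) :
    confCount d μ B = ((μ.atoms ∩ B).encard : ℝ≥0∞) := count_restrict_apply μ.countable_atoms hB

theorem lintegral_groundCount (S : GroundConf d) (f : Pos d → ℝ≥0∞) :
    ∫⁻ t, f t ∂groundCount d S = ∑' t : S.pts, f t :=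
  lintegral_count_restrict S.countable_pts f

theorem lintegral_confCount (μ : Conf d) (f : Pos d × ℝ → ℝ≥0∞) :
    ∫⁻ p, f p ∂confCount d μ = ∑' p : μ.atoms, f p :=
  lintegral_count_restrict μ.countable_atoms f

instance : IsSFiniteKernel (groundCount d) := by
  refine isSFiniteKernel_of_cover _ (fun n : ℕ => Metric.closedBall 0 n)
    (fun n => measurableSet_closedBall) (fun S n => ?_) (fun S => ?_)
  · rw [groundCount_apply' S measurableSet_closedBall]
    have := S.locFinite n
    rw [ENat.toENNReal_lt_top, Set.encard_lt_top_iff]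
    exact this.subset fun t ht => ⟨ht.1, by simpa using ht.2⟩
  · rw [Metric.iUnion_closedBall_nat]
    simp

instance : IsSFiniteKernel (confCount d) := by
  have hm : ∀ n : ℕ, MeasurableSet
      {p : Pos d × ℝ | ‖p.1‖ ≤ n ∧ (((n : ℝ) + 1)⁻¹ < p.2 ∨ p.2 ≤ 0)} := fun n => by
    have h1 : Measurable fun p : Pos d × ℝ => ‖p.1‖ := by fun_prop
    have h2 : Measurable fun p : Pos d × ℝ => p.2 := by fun_prop
    exact (measurableSet_le h1 measurable_const).inter
      ((measurableSet_lt measurable_const h2).union (measurableSet_le h2 measurable_const))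
  -- The half space of nonpositive scores carries no atoms; including it makes the sets exhaust the
  -- whole space.
  refine isSFiniteKernel_of_cover _
    (fun n : ℕ => {p | ‖p.1‖ ≤ n ∧ (((n : ℝ) + 1)⁻¹ < p.2 ∨ p.2 ≤ 0)})
    hm (fun μ n => ?_) (fun μ => ?_)
  · rw [confCount_apply' μ (hm n), ENat.toENNReal_lt_top, Set.encard_lt_top_iff]
    refine (μ.locFinite n ((n : ℝ) + 1)⁻¹ (by positivity)).subset ?_
    rintro p ⟨hp, h1, h2 | h2⟩
    · exact ⟨hp, h1, h2⟩
    · exact absurd (μ.pos p hp) h2.not_gt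
  · have : (⋃ n : ℕ, {p : Pos d × ℝ | ‖p.1‖ ≤ n ∧ (((n : ℝ) + 1)⁻¹ < p.2 ∨ p.2 ≤ 0)}) =
        Set.univ := by
      ext p
      simp only [Set.mem_iUnion, Set.mem_ofPred_eq, Set.mem_univ, iff_true]
      obtain ⟨n, hn⟩ := exists_nat_ge (max ‖p.1‖ p.2⁻¹)
      refine ⟨n, (le_max_left _ _).trans hn, ?_⟩
      rcases le_or_gt p.2 0 with h | h
      · exact Or.inr h
      · left
        rw [inv_lt_comm₀ (by positivity) h]
        linarith [(le_max_right _ _).trans hn]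
    rw [this]
    simp

/-- As `ℕ∞` is countable, every subset is the preimage of a countable, hence measurable, subset of
`ℝ≥0∞`. Thus counts may be treated as extended real numbers. -/
theorem measurable_of_encard_coe {β : Type*} [MeasurableSpace β] {f : β → ℕ∞}
    (h : Measurable fun b => (f b : ℝ≥0∞)) : Measurable f := by
  intro s _
  have : f ⁻¹' s = (fun b => (f b : ℝ≥0∞)) ⁻¹' ((fun n : ℕ∞ => (n : ℝ≥0∞)) '' s) := by
    ext b
    simp
  rw [this]
  exact h ((s.to_countable.image _).measurableSet)

theorem measurable_to_conf {β : Type*} [MeasurableSpace β] {f : β → Conf d}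
    (h : ∀ B, MeasurableSet B → Measurable fun b => confCount d (f b) B) : Measurable f := by
  rw [measurable_iff_comap_le]
  simp only [instMeasurableSpaceConf, MeasurableSpace.comap_iSup, MeasurableSpace.comap_comp]
  refine iSup₂_le fun B hB => Measurable.comap_le (m₂ := ⊤) ?_
  refine measurable_of_encard_coe ?_
  simpa only [confCount_apply' _ hB, Function.comp_apply] using h B hB

theorem measurable_to_groundConf {β : Type*} [MeasurableSpace β] {f : β → GroundConf d}
    (h : ∀ B, MeasurableSet B → Measurable fun b => groundCount d (f b) B) : Measurable f := by
  rw [measurable_iff_comap_le]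
  simp only [instMeasurableSpaceGroundConf, MeasurableSpace.comap_iSup, MeasurableSpace.comap_comp]
  refine iSup₂_le fun B hB => Measurable.comap_le (m₂ := ⊤) ?_
  refine measurable_of_encard_coe ?_
  simpa only [groundCount_apply' _ hB, Function.comp_apply] using h B hB

/-! ### Measurability of the operations on configurations -/

/-- Every operation on configurations is described by its effect on integrals against the counting
measure. Applied to indicators, such a formula gives the measurability of the operation. -/
theorem lintegral_confCount_shift (z : Pos d) (μ : Conf d) (f : Pos d × ℝ → ℝ≥0∞) :
    ∫⁻ p, f p ∂confCount d (shift z μ) = ∫⁻ p, f (p.1 - z, p.2) ∂confCount d μ := by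
  have h : (shift z μ).atoms = (fun p : Pos d × ℝ => (p.1 - z, p.2)) '' μ.atoms := by
    ext ⟨t, s⟩
    constructor
    · intro h
      exact ⟨(t + z, s), h, by simp⟩
    · rintro ⟨⟨t', s'⟩, h1, h2⟩
      simp only [Prod.mk.injEq] at h2
      obtain ⟨rfl, rfl⟩ := h2
      simpa [shift] using h1
  rw [confCount_apply, confCount_apply, h, lintegral_count_restrict_image μ.countable_atoms]
  rintro ⟨a, b⟩ _ ⟨a', b'⟩ _ h
  simpa using h

theorem scale_of_nonpos {u : ℝ} (hu : u ≤ 0) (μ : Conf d) : (scale 1 u μ).atoms = ∅ := by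
  ext p
  simp [scale, hu.not_gt]

theorem mem_scale {u : ℝ} (hu : 0 < u) (μ : Conf d) (p : Pos d × ℝ) :
    p ∈ (scale 1 u μ).atoms ↔ (p.1, u * p.2) ∈ μ.atoms := by
  simp [scale, hu]

theorem lintegral_confCount_scale {u : ℝ} (hu : 0 < u) (μ : Conf d) (f : Pos d × ℝ → ℝ≥0∞) :
    ∫⁻ p, f p ∂confCount d (scale 1 u μ) = ∫⁻ p, f (p.1, p.2 / u) ∂confCount d μ := by
  have h : (scale 1 u μ).atoms = (fun p : Pos d × ℝ => (p.1, p.2 / u)) '' μ.atoms := by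
    ext ⟨t, s⟩
    rw [mem_scale hu]
    constructor
    · intro h
      exact ⟨(t, u * s), h, by simp [hu.ne']⟩
    · rintro ⟨⟨t', s'⟩, h1, h2⟩
      simp only [Prod.mk.injEq] at h2
      obtain ⟨rfl, rfl⟩ := h2
      simpa [mul_div_cancel₀ _ hu.ne'] using h1
  rw [confCount_apply, confCount_apply, h, lintegral_count_restrict_image μ.countable_atoms]
  rintro ⟨a, b⟩ _ ⟨a', b'⟩ _ h
  simpa [hu.ne', div_left_inj'] using h

theorem lintegral_groundCount_shift (z : Pos d) (S : GroundConf d) (f : Pos d → ℝ≥0∞) :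
    ∫⁻ t, f t ∂groundCount d (shiftGround z S) = ∫⁻ t, f (t - z) ∂groundCount d S := by
  have h : (shiftGround z S).pts = (fun t : Pos d => t - z) '' S.pts := by
    ext t
    constructor
    · intro h
      exact ⟨t + z, h, by simp⟩
    · rintro ⟨t', h1, rfl⟩
      simpa [shiftGround] using h1
  rw [groundCount_apply, groundCount_apply, h, lintegral_count_restrict_image S.countable_pts]
  rintro a _ b _ h
  simpa using h

theorem lintegral_groundCount_addOrigin (S : GroundConf d) (f : Pos d → ℝ≥0∞) :
    ∫⁻ t, f t ∂groundCount d (addOrigin S) =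
      f 0 + ∫⁻ t, ({0}ᶜ : Set (Pos d)).indicator f t ∂groundCount d S := by
  have h : (addOrigin S).pts = insert 0 (S.pts ∩ {0}ᶜ) := by
    ext t
    by_cases ht : t = 0 <;> simp [addOrigin, ht]
  rw [groundCount_apply, groundCount_apply, h, lintegral_insert (by simp),
    lintegral_indicator (measurableSet_singleton _).compl,
    Measure.restrict_restrict (measurableSet_singleton _).compl, Set.inter_comm]
  simp

theorem lintegral_groundCount_proj (μ : MarkedConf d) (f : Pos d → ℝ≥0∞) :
    ∫⁻ t, f t ∂groundCount d (proj μ) = ∫⁻ p, f p.1 ∂confCount d μ.1 :=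
  lintegral_count_restrict_image μ.1.countable_atoms (fun _ hp _ hq h => μ.1.simple _ hp _ hq h) f

theorem measurable_shift : Measurable fun q : Pos d × Conf d => shift q.1 q.2 := by
  refine measurable_to_conf fun B hB => ?_
  simp_rw [← lintegral_indicator_one hB, lintegral_confCount_shift]
  refine measurable_lintegral_kernel_comp _ measurable_snd ?_
  exact (measurable_one.indicator hB).comp (f := fun x : (Pos d × Conf d) × (Pos d × ℝ) =>
    (x.2.1 - x.1.1, x.2.2)) (by fun_prop)

theorem measurable_scale : Measurable fun q : ℝ × Conf d => scale 1 q.1 q.2 := by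
  refine measurable_to_conf fun B hB => ?_
  have : (fun q : ℝ × Conf d => confCount d (scale 1 q.1 q.2) B) = fun q =>
      if 0 < q.1 then ∫⁻ p, B.indicator 1 (p.1, p.2 / q.1) ∂confCount d q.2 else 0 := by
    ext q
    split_ifs with h
    · rw [← lintegral_indicator_one hB, lintegral_confCount_scale h]
    · simp [confCount_apply, scale_of_nonpos (not_lt.1 h)]
  rw [this]
  refine Measurable.ite (measurableSet_lt measurable_const measurable_fst) ?_ measurable_const
  refine measurable_lintegral_kernel_comp _ measurable_snd ?_
  exact (measurable_one.indicator hB).comp (f := fun x : (ℝ × Conf d) × (Pos d × ℝ) =>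
    (x.2.1, x.2.2 / x.1.1)) (by fun_prop)

theorem measurable_shiftMarked :
    Measurable fun q : Pos d × MarkedConf d => shiftMarked q.1 q.2 :=
  Measurable.subtype_mk
    (measurable_shift.comp (measurable_fst.prodMk (measurable_subtype_coe.comp measurable_snd)))

theorem measurable_shiftGround :
    Measurable fun q : Pos d × GroundConf d => shiftGround q.1 q.2 := by
  refine measurable_to_groundConf fun B hB => ?_
  simp_rw [← lintegral_indicator_one hB, lintegral_groundCount_shift]
  refine measurable_lintegral_kernel_comp _ measurable_snd ?_
  exact (measurable_one.indicator hB).comp (f := fun x : (Pos d × GroundConf d) × Pos d =>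
    x.2 - x.1.1) (by fun_prop)

theorem measurable_addOrigin : Measurable (addOrigin : GroundConf d → GroundConf d) := by
  refine measurable_to_groundConf fun B hB => ?_
  simp_rw [← lintegral_indicator_one hB, lintegral_groundCount_addOrigin]
  refine measurable_const.add (measurable_lintegral_kernel_comp _ measurable_id ?_)
  exact ((measurable_one.indicator hB).indicator (measurableSet_singleton _).compl).comp
    measurable_snd

theorem measurable_proj : Measurable (proj : MarkedConf d → GroundConf d) := by
  refine measurable_to_groundConf fun B hB => ?_
  simp_rw [← lintegral_indicator_one hB, lintegral_groundCount_proj]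
  refine measurable_lintegral_kernel_comp _ measurable_subtype_coe ?_
  exact (measurable_one.indicator hB).comp (measurable_fst.comp measurable_snd)

theorem measurableSet_mem_pts : MeasurableSet {q : Pos d × GroundConf d | q.1 ∈ q.2.pts} := by
  have h : {q : Pos d × GroundConf d | q.1 ∈ q.2.pts} =
      {q | ∫⁻ t, (if t = q.1 then 1 else 0) ∂groundCount d q.2 = 0}ᶜ := by
    ext ⟨x, S⟩
    simp [lintegral_groundCount]
  rw [h]
  refine (measurableSet_eq_fun (measurable_lintegral_kernel_comp _ measurable_snd ?_)
    measurable_const).compl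
  exact Measurable.ite (measurableSet_eq_fun measurable_snd (measurable_fst.comp measurable_fst))
    measurable_const measurable_const

theorem score_of_mem {μ : Conf d} {p : Pos d × ℝ} (hp : p ∈ μ.atoms) : score μ p.1 = p.2 := by
  have : {s | (p.1, s) ∈ μ.atoms} = {p.2} := by
    ext s
    exact ⟨fun h => (Prod.ext_iff.1 (μ.simple _ h _ hp rfl)).2, fun h => by
      rw [Set.mem_singleton_iff.1 h]; exact hp⟩
  rw [score, this, csSup_singleton]

theorem score_of_notMem {μ : Conf d} {t : Pos d} (h : ∀ s, (t, s) ∉ μ.atoms) :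
    score μ t = 0 := by
  have : {s | (t, s) ∈ μ.atoms} = ∅ := by
    ext s
    simp [h]
  rw [score, this, Real.sSup_empty]

theorem score_nonneg (μ : Conf d) (t : Pos d) : 0 ≤ score μ t :=
  Real.sSup_nonneg fun _ hs => (μ.pos _ hs).le

/-- At most one atom lies above `t`, so the supremum defining the score is a sum with at most one
nonzero term, which is measurable in the configuration. -/
theorem ofReal_score (μ : Conf d) (t : Pos d) : ENNReal.ofReal (score μ t) =
    ∫⁻ p, (if p.1 = t then ENNReal.ofReal p.2 else 0) ∂confCount d μ := by
  rw [lintegral_confCount]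
  by_cases h : ∃ s, (t, s) ∈ μ.atoms
  · obtain ⟨s, hs⟩ := h
    rw [tsum_eq_single ⟨(t, s), hs⟩, score_of_mem hs]
    · simp
    · rintro ⟨p, hp⟩ hne
      rw [if_neg]
      intro h
      exact hne (Subtype.ext (μ.simple _ hp _ hs h))
  · push Not at h
    rw [score_of_notMem h, ENNReal.ofReal_zero, eq_comm, ENNReal.tsum_eq_zero]
    rintro ⟨p, hp⟩
    rw [if_neg]
    rintro rfl
    exact h _ hp

theorem measurable_score : Measurable fun q : Pos d × Conf d => score q.2 q.1 := by
  have : (fun q : Pos d × Conf d => score q.2 q.1) = fun q =>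
      (∫⁻ p, (if p.1 = q.1 then ENNReal.ofReal p.2 else 0) ∂confCount d q.2).toReal := by
    ext q
    rw [← ofReal_score, ENNReal.toReal_ofReal (score_nonneg _ _)]
  rw [this]
  refine (measurable_lintegral_kernel_comp _ measurable_snd ?_).ennreal_toReal
  exact Measurable.ite (measurableSet_eq_fun (by fun_prop) (by fun_prop)) (by fun_prop)
    measurable_const

/-- The second clause says that the family is bounded above; it is needed because `sSup` of an
unbounded set of reals is `0`. -/
theorem sSup_image_gt_iff {γ : Type*} {A : Set γ} {v : γ → ℝ} {a : ℝ} (ha : 0 ≤ a) :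
    a < sSup (v '' A) ↔ (∃ x ∈ A, a < v x) ∧ ∃ n : ℕ, ¬ ∃ x ∈ A, (n : ℝ) < v x := by
  constructor
  · intro h
    have hb : BddAbove (v '' A) := by
      by_contra hb
      rw [Real.sSup_of_not_bddAbove hb] at h
      exact absurd h ha.not_gt
    have hne : (v '' A).Nonempty := by
      by_contra hne
      rw [Set.not_nonempty_iff_eq_empty.1 hne, Real.sSup_empty] at h
      exact absurd h ha.not_gt
    obtain ⟨_, ⟨x, hx, rfl⟩, hax⟩ := exists_lt_of_lt_csSup hne h
    refine ⟨⟨x, hx, hax⟩, ?_⟩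
    obtain ⟨C, hC⟩ := hb
    obtain ⟨n, hn⟩ := exists_nat_ge C
    refine ⟨n, ?_⟩
    rintro ⟨y, hy, hny⟩
    exact absurd (hn.trans_lt hny) (hC ⟨y, hy, rfl⟩).not_gt
  · rintro ⟨⟨x, hx, hax⟩, n, hn⟩
    push Not at hn
    exact hax.trans_le (le_csSup ⟨n, by rintro _ ⟨y, hy, rfl⟩; exact hn y hy⟩ ⟨x, hx, rfl⟩)

theorem measurable_sSup_image {β γ : Type*} [MeasurableSpace β] [MeasurableSpace γ]
    [MeasurableSingletonClass γ] (κ : Kernel β γ) [IsSFiniteKernel κ] {A : β → Set γ}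
    (hA : ∀ b, (A b).Countable) (hκ : ∀ b, κ b = Measure.count.restrict (A b))
    {v : β → γ → ℝ} (hv : Measurable (Function.uncurry v)) (hv0 : ∀ b, ∀ x ∈ A b, 0 ≤ v b x) :
    Measurable fun b => sSup (v b '' A b) := by
  have hex : ∀ a : ℝ, MeasurableSet {b | ∃ x ∈ A b, a < v b x} := fun a => by
    have h : {b | ∃ x ∈ A b, a < v b x} =
        {b | ∫⁻ x, (if a < v b x then 1 else 0) ∂κ b = 0}ᶜ := by
      ext b
      simp [hκ, lintegral_count_restrict (hA b)]
    rw [h]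
    refine (measurableSet_eq_fun (Measurable.lintegral_kernel_prod_right ?_)
      measurable_const).compl
    exact Measurable.ite (measurableSet_lt measurable_const hv) measurable_const measurable_const
  refine measurable_of_Ioi fun a => ?_
  rcases lt_or_ge a 0 with ha | ha
  · have : (fun b => sSup (v b '' A b)) ⁻¹' Set.Ioi a = Set.univ := by
      ext b
      simp only [Set.mem_preimage, Set.mem_Ioi, Set.mem_univ, iff_true]
      exact ha.trans_le (Real.sSup_nonneg (by rintro _ ⟨x, hx, rfl⟩; exact hv0 b x hx))
    rw [this]
    exact MeasurableSet.univ
  · have : (fun b => sSup (v b '' A b)) ⁻¹' Set.Ioi a =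
        {b | ∃ x ∈ A b, a < v b x} ∩ ⋃ n : ℕ, {b | ∃ x ∈ A b, (n : ℝ) < v b x}ᶜ := by
      ext b
      simp only [Set.mem_preimage, Set.mem_Ioi, sSup_image_gt_iff ha, Set.mem_inter_iff,
        Set.mem_iUnion, Set.mem_compl_iff, Set.mem_ofPred_eq]
    rw [this]
    exact (hex a).inter (MeasurableSet.iUnion fun n => (hex n).compl)

theorem measurable_maxScore : Measurable (maxScore : Conf d → ℝ) :=
  measurable_sSup_image (confCount d) (fun μ => μ.countable_atoms) (fun _ => rfl)
    (v := fun _ p => p.2) (by fun_prop) (fun μ p hp => (μ.pos p hp).le)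

theorem measurable_scoreSum (α : ℝ) : Measurable (scoreSum α : Conf d → ℝ≥0∞) := by
  unfold scoreSum
  simp_rw [← lintegral_confCount _ (fun p : Pos d × ℝ => ENNReal.ofReal (p.2 ^ α))]
  exact measurable_lintegral_kernel_comp _ measurable_id (by fun_prop)

/-! ### Measurability of the scoring rule and of the cluster -/

section Rule

variable {w : Pos d → ℝ} {Φ : Pos d → GroundConf d → GroundConf d}

theorem measurable_scoring (hw : Measurable w) (hw_nonneg : ∀ x, 0 ≤ w x)
    (hΦ : IsNeighborhoodRule Φ) :
    Measurable fun q : Pos d × MarkedConf d => scoring w Φ q.1 q.2 := by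
  have hg : Measurable fun q : Pos d × MarkedConf d => Φ q.1 (proj q.2) :=
    hΦ.measurable.comp (measurable_fst.prodMk (measurable_proj.comp measurable_snd))
  refine measurable_sSup_image ((groundCount d).comap _ hg) (fun q => (Φ q.1 (proj q.2)).countable_pts)
    (fun _ => rfl) (v := fun q x => w (x - q.1) * score q.2.1 x) ?_
    (fun q x _ => mul_nonneg (hw_nonneg _) (score_nonneg _ _))
  refine (hw.comp (by fun_prop)).mul (measurable_score.comp
    (f := fun x : (Pos d × MarkedConf d) × Pos d => (x.2, x.1.2.1)) ?_)
  exact measurable_snd.prodMk (measurable_subtype_coe.comp (measurable_snd.comp measurable_fst))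

theorem lintegral_confCount_scored (μ : MarkedConf d) (f : Pos d × ℝ → ℝ≥0∞) :
    ∫⁻ p, f p ∂confCount d (scored w Φ μ).1 = ∫⁻ t, (if 0 < scoring w Φ t μ then
      f (t, scoring w Φ t μ) else 0) ∂groundCount d (proj μ) :=
  lintegral_count_restrict_graph (proj μ).countable_pts (fun t => scoring w Φ t μ) f

theorem measurable_scored (hw : Measurable w) (hw_nonneg : ∀ x, 0 ≤ w x)
    (hΦ : IsNeighborhoodRule Φ) : Measurable (scored w Φ : MarkedConf d → MarkedConf d) := by
  have hs : Measurable fun x : MarkedConf d × Pos d => scoring w Φ x.2 x.1 :=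
    (measurable_scoring hw hw_nonneg hΦ).comp measurable_swap
  have : Measurable fun μ : MarkedConf d => (scored w Φ μ).1 := by
    refine measurable_to_conf fun B hB => ?_
    simp_rw [← lintegral_indicator_one hB, lintegral_confCount_scored]
    refine measurable_lintegral_kernel_comp _ measurable_proj ?_
    exact Measurable.ite (measurableSet_lt measurable_const hs)
      ((measurable_one.indicator hB).comp (measurable_snd.prodMk hs)) measurable_const
  exact Measurable.subtype_mk this

open scoped Classical in
theorem lintegral_confCount_clusterW (S : GroundConf d) (f : Pos d × ℝ → ℝ≥0∞) :
    ∫⁻ p, f p ∂confCount d (clusterW w Φ S) = ∫⁻ t, (if 0 ∈ (Φ t S).pts ∧ 0 < w (-t) then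
      f (t, w (-t)) else 0) ∂groundCount d S := by
  have h : (clusterW w Φ S).atoms = {p : Pos d × ℝ | p.1 ∈ S.pts ∧
      p.2 = (if 0 ∈ (Φ p.1 S).pts then w (-p.1) else 0) ∧ 0 < p.2} := by
    ext p
    simp only [clusterW, Set.mem_ofPred_eq]
    split_ifs with h
    · simp [h]
    · simp only [h, false_and, and_false, false_iff, not_and, not_lt]
      intro _ h
      exact h.le
  rw [confCount_apply, h, lintegral_count_restrict_graph S.countable_pts
    (fun t => if 0 ∈ (Φ t S).pts then w (-t) else 0), groundCount_apply]
  congr 1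
  ext t
  by_cases h : 0 ∈ (Φ t S).pts <;> simp [h]

open scoped Classical in
theorem measurable_clusterW (hw : Measurable w) (hΦ : IsNeighborhoodRule Φ) :
    Measurable (clusterW w Φ) := by
  refine measurable_to_conf fun B hB => ?_
  simp_rw [← lintegral_indicator_one hB, lintegral_confCount_clusterW]
  refine measurable_lintegral_kernel_comp _ measurable_id ?_
  have hw' : Measurable fun x : GroundConf d × Pos d => w (-x.2) := hw.comp (by fun_prop)
  refine Measurable.ite (MeasurableSet.inter ?_ (measurableSet_lt measurable_const hw'))
    ((measurable_one.indicator hB).comp (measurable_snd.prodMk hw')) measurable_const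
  exact ((measurable_const (a := (0 : Pos d))).prodMk (hΦ.measurable.comp measurable_swap))
    measurableSet_mem_pts

end Rule

/-! ### Void events generate the `σ`-algebras of configurations -/

section Voids

variable {T E : Type*} (A : T → Set E) (K : ℕ → Set E)

/-- The events that no point of `A μ` lies in `O`, for open `O` contained in some `K n`. -/
def voidEvents [TopologicalSpace E] : Set (Set T) :=
  {s | ∃ O : Set E, IsOpen O ∧ (∃ n, O ⊆ K n) ∧ s = {μ | A μ ∩ O = ∅}}

variable {A K}

theorem isPiSystem_voidEvents [TopologicalSpace E] (hK : Monotone K) :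
    IsPiSystem (voidEvents A K) := by
  rintro _ ⟨O, hO, ⟨n, hn⟩, rfl⟩ _ ⟨O', hO', ⟨n', hn'⟩, rfl⟩ _
  refine ⟨O ∪ O', hO.union hO', ⟨max n n', Set.union_subset
    (hn.trans (hK (le_max_left _ _))) (hn'.trans (hK (le_max_right _ _)))⟩, ?_⟩
  ext μ
  simp [Set.inter_union_distrib_left]

variable [TopologicalSpace E] [SecondCountableTopology E] [T2Space E]

/-- In a Hausdorff space finitely many points are separated by disjoint basic open sets. Since the
basis is countable, the event of having at least `k` points is built from void events by countably
many operations. -/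
theorem le_encard_inter_iff {O : Set E} (S : Set E) (k : ℕ) :
    (k : ℕ∞) ≤ (S ∩ O).encard ↔ ∃ D : Fin k → TopologicalSpace.countableBasis E,
      Pairwise (fun i j => Disjoint (D i : Set E) (D j)) ∧ ∀ i, ¬ S ∩ (O ∩ D i) = ∅ := by
  constructor
  · intro h
    obtain ⟨t, htS, ht⟩ := Set.exists_subset_encard_eq h
    have hfin : t.Finite := Set.finite_of_encard_eq_coe ht
    obtain ⟨U, hU, hdisj⟩ := hfin.t2_separation
    have : Fintype t := hfin.fintype
    have hcard : Fintype.card t = k := by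
      rw [Set.encard_eq_coe_toFinset_card, Set.toFinset_card] at ht
      exact_mod_cast ht
    let e : Fin k ≃ t := (Fintype.equivFinOfCardEq hcard).symm
    have hb : ∀ i : Fin k, ∃ D ∈ TopologicalSpace.countableBasis E, (e i : E) ∈ D ∧ D ⊆ U (e i) :=
      fun i => (TopologicalSpace.isBasis_countableBasis E).exists_subset_of_mem_open
        (hU (e i)).1 (hU (e i)).2
    choose D hD hmem hsub using hb
    refine ⟨fun i => ⟨D i, hD i⟩, fun i j hij => ?_, fun i hi => ?_⟩
    · exact (hdisj (e i).2 (e j).2 (fun h => hij (e.injective (Subtype.ext h)))).mono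
        (hsub i) (hsub j)
    · have : (e i : E) ∈ S ∩ (O ∩ D i) :=
        ⟨(htS (e i).2).1, (htS (e i).2).2, hmem i⟩
      rw [hi] at this
      exact this
  · rintro ⟨D, hdisj, hne⟩
    have : ∀ i, ∃ x, x ∈ S ∩ (O ∩ D i) := fun i => Set.nonempty_iff_ne_empty.2 (hne i)
    choose x hx using this
    have hinj : Function.Injective x := fun i j hij => by
      by_contra hne
      exact Set.disjoint_left.1 (hdisj hne) (hx i).2.2 (hij ▸ (hx j).2.2)
    calc (k : ℕ∞) = (Set.range x).encard := by
          rw [← Set.image_univ, hinj.encard_image]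
          simp
      _ ≤ _ := Set.encard_le_encard (by rintro _ ⟨i, rfl⟩; exact ⟨(hx i).1, (hx i).2.1⟩)

theorem measurable_encard_of_voidEvents_of_isOpen {n : ℕ} {O : Set E} (hO : IsOpen O)
    (hOK : O ⊆ K n) :
    Measurable[MeasurableSpace.generateFrom (voidEvents A K)] fun μ => (A μ ∩ O).encard := by
  let _ : MeasurableSpace T := MeasurableSpace.generateFrom (voidEvents A K)
  have h : ∀ k : ℕ, MeasurableSet {μ | (k : ℕ∞) ≤ (A μ ∩ O).encard} := fun k => by
    simp_rw [le_encard_inter_iff]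
    have : {μ | ∃ D : Fin k → TopologicalSpace.countableBasis E,
        Pairwise (fun i j => Disjoint (D i : Set E) (D j)) ∧ ∀ i, ¬ A μ ∩ (O ∩ D i) = ∅} =
        ⋃ D ∈ {D : Fin k → TopologicalSpace.countableBasis E |
          Pairwise (fun i j => Disjoint (D i : Set E) (D j))},
          ⋂ i, {μ | A μ ∩ (O ∩ D i) = ∅}ᶜ := by
      ext μ
      simp
    rw [this]
    refine MeasurableSet.biUnion (Set.to_countable _) fun D _ =>
      MeasurableSet.iInter fun i => MeasurableSet.compl ?_
    exact MeasurableSpace.measurableSet_generateFrom ⟨_, hO.inter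
      (TopologicalSpace.isOpen_of_mem_countableBasis (D i).2),
      ⟨n, Set.inter_subset_left.trans hOK⟩, rfl⟩
  refine measurable_to_countable' fun x => ?_
  induction x using ENat.recTopCoe with
  | top =>
    have : (fun μ => (A μ ∩ O).encard) ⁻¹' {⊤} = ⋂ k : ℕ, {μ | (k : ℕ∞) ≤ (A μ ∩ O).encard} := by
      ext μ
      simp only [Set.mem_preimage, Set.mem_singleton_iff, Set.mem_iInter, Set.mem_ofPred_eq]
      rw [ENat.eq_top_iff_forall_ge]
    rw [this]
    exact MeasurableSet.iInter h
  | coe k =>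
    have : (fun μ => (A μ ∩ O).encard) ⁻¹' {(k : ℕ∞)} =
        {μ | (k : ℕ∞) ≤ (A μ ∩ O).encard} \ {μ | ((k + 1 : ℕ) : ℕ∞) ≤ (A μ ∩ O).encard} := by
      ext μ
      simp only [Set.mem_preimage, Set.mem_singleton_iff, Set.mem_sdiff, Set.mem_ofPred_eq,
        Nat.cast_add, Nat.cast_one, not_le, ENat.lt_add_one_iff (ENat.natCast_ne_top k)]
      exact ⟨fun h => ⟨h.ge, h.le⟩, fun h => le_antisymm h.2 h.1⟩
    rw [this]
    exact (h k).diff (h (k + 1))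

/-- On each `K n` the counting measures are finite, so measurability extends from open sets to Borel
sets by a π-λ argument. The unrestricted count is the supremum over `n`. -/
theorem measurable_encard_of_voidEvents [MeasurableSpace E] [BorelSpace E] (hK : Monotone K)
    (hKo : ∀ n, IsOpen (K n)) (hfin : ∀ μ n, (A μ ∩ K n).Finite) (hcov : ∀ μ, A μ ⊆ ⋃ n, K n)
    {B : Set E} (hB : MeasurableSet B) :
    Measurable[MeasurableSpace.generateFrom (voidEvents A K)] fun μ => (A μ ∩ B).encard := by
  let _ : MeasurableSpace T := MeasurableSpace.generateFrom (voidEvents A K)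
  have hcoe : ∀ f : T → ℕ∞, Measurable f → Measurable fun b => (f b : ℝ≥0∞) := fun f hf =>
    (Measurable.of_discrete (f := fun n : ℕ∞ => (n : ℝ≥0∞))).comp hf
  have happly : ∀ (n : ℕ) μ (B : Set E), MeasurableSet B →
      Measure.count.restrict (A μ ∩ K n) B = ((A μ ∩ (B ∩ K n)).encard : ℝ≥0∞) :=
    fun n μ B hB => by
      rw [count_restrict_apply (hfin μ n).countable hB, Set.inter_assoc, Set.inter_comm (K n) B]
  have hopen : ∀ (n : ℕ) (O : Set E), IsOpen O →
      Measurable fun μ => Measure.count.restrict (A μ ∩ K n) O := fun n O hO => by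
    simp_rw [fun μ => happly n μ O hO.measurableSet]
    exact hcoe _ (measurable_encard_of_voidEvents_of_isOpen (hO.inter (hKo n))
      Set.inter_subset_right)
  have hall : ∀ (n : ℕ) (B : Set E), MeasurableSet B →
      Measurable fun μ => Measure.count.restrict (A μ ∩ K n) B := fun n B hB => by
    have hb := BorelSpace.measurable_eq (α := E)
    have hfm : ∀ μ, IsFiniteMeasure (Measure.count.restrict (A μ ∩ K n)) := fun μ => ⟨by
      rw [Measure.restrict_apply_univ]
      exact Measure.count_apply_lt_top.2 (hfin μ n)⟩
    induction B, hB using MeasurableSpace.induction_on_inter (hb.trans rfl) isPiSystem_isOpen with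
    | empty => simp
    | basic O hO => exact hopen n O hO
    | compl B hB ih =>
      simp_rw [fun μ => measure_compl hB (measure_ne_top (Measure.count.restrict (A μ ∩ K n)) B)]
      exact (hopen n _ isOpen_univ).sub ih
    | iUnion f hd hf ih =>
      simp_rw [fun μ => measure_iUnion (μ := Measure.count.restrict (A μ ∩ K n)) hd hf]
      exact Measurable.tsum ih
  refine measurable_of_encard_coe ?_
  have : (fun μ => ((A μ ∩ B).encard : ℝ≥0∞)) =
      fun μ => ⨆ n, Measure.count.restrict (A μ ∩ K n) B := by
    ext μ
    have hmeas : ∀ n, MeasurableSet (A μ ∩ (B ∩ K n)) := fun n =>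
      ((hfin μ n).subset (Set.inter_subset_inter_right _ Set.inter_subset_right)).measurableSet
    have h1 : A μ ∩ B = ⋃ n, A μ ∩ (B ∩ K n) := by
      rw [← Set.inter_iUnion, ← Set.inter_iUnion, ← Set.inter_assoc, eq_comm,
        Set.inter_eq_left]
      exact Set.inter_subset_left.trans (hcov μ)
    simp_rw [fun n => happly n μ B hB]
    rw [← Measure.count_apply (h1 ▸ MeasurableSet.iUnion hmeas), h1, Monotone.measure_iUnion]
    · exact iSup_congr fun n => Measure.count_apply (hmeas n)
    · intro n m hnm
      exact Set.inter_subset_inter_right _ (Set.inter_subset_inter_right _ (hK hnm))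
  rw [this]
  exact Measurable.iSup fun n => hall n B hB

end Voids

/-- The exhaustion of `ℝ^d × (0,∞)` by bounded open sets bounded away from score `0`. -/
def confExhaustion (d n : ℕ) : Set (Pos d × ℝ) :=
  Metric.ball 0 n ×ˢ Set.Ioi ((n : ℝ) + 1)⁻¹

theorem isOpen_confExhaustion (n : ℕ) : IsOpen (confExhaustion d n) :=
  Metric.isOpen_ball.prod isOpen_Ioi

theorem monotone_confExhaustion : Monotone (confExhaustion d) := by
  intro n m h
  have h' : (n : ℝ) ≤ m := by exact_mod_cast h
  refine Set.prod_mono (Metric.ball_subset_ball h') (Set.Ioi_subset_Ioi ?_)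
  gcongr

theorem Conf.atoms_inter_confExhaustion_finite (μ : Conf d) (n : ℕ) :
    (μ.atoms ∩ confExhaustion d n).Finite :=
  (μ.locFinite n ((n : ℝ) + 1)⁻¹ (by positivity)).subset
    fun p hp => ⟨hp.1, by simpa using (Metric.mem_ball.1 hp.2.1).le, hp.2.2⟩

theorem exists_mem_confExhaustion {p : Pos d × ℝ} (hp : 0 < p.2) :
    ∃ n, p ∈ confExhaustion d n := by
  obtain ⟨n, hn⟩ := exists_nat_gt (max ‖p.1‖ p.2⁻¹)
  refine ⟨n, by simpa using (le_max_left _ _).trans_lt hn, ?_⟩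
  rw [Set.mem_Ioi, inv_lt_comm₀ (by positivity) hp]
  linarith [(le_max_right _ _).trans_lt hn]

/-- Void events form a π-system, so this identity makes laws of simple point configurations
determined by their void probabilities. All later identifications of laws rest on it and its two
analogues. -/
theorem conf_eq_generateFrom : instMeasurableSpaceConf d =
    MeasurableSpace.generateFrom (voidEvents Conf.atoms (confExhaustion d)) := by
  apply le_antisymm
  · refine iSup₂_le fun B hB => Measurable.comap_le (m₂ := ⊤) ?_
    exact measurable_encard_of_voidEvents monotone_confExhaustion isOpen_confExhaustion
      Conf.atoms_inter_confExhaustion_finite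
      (fun μ p hp => Set.mem_iUnion.2 (exists_mem_confExhaustion (μ.pos p hp))) hB
  · refine MeasurableSpace.generateFrom_le ?_
    rintro _ ⟨O, hO, -, rfl⟩
    have : {μ : Conf d | μ.atoms ∩ O = ∅} = (fun μ => (μ.atoms ∩ O).encard) ⁻¹' {0} := by
      ext μ
      simp
    rw [this]
    exact measurable_encard_atoms hO.measurableSet trivial

theorem groundConf_eq_generateFrom : instMeasurableSpaceGroundConf d =
    MeasurableSpace.generateFrom
      (voidEvents GroundConf.pts fun n : ℕ => Metric.ball (0 : Pos d) n) := by
  apply le_antisymm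
  · refine iSup₂_le fun B hB => Measurable.comap_le (m₂ := ⊤) ?_
    refine measurable_encard_of_voidEvents ?_ (fun n => Metric.isOpen_ball) ?_ ?_ hB
    · intro n m h
      exact Metric.ball_subset_ball (by exact_mod_cast h)
    · exact fun S n => (S.locFinite n).subset
        fun t ht => ⟨ht.1, by simpa using (Metric.mem_ball.1 ht.2).le⟩
    · intro S t _
      rw [Metric.iUnion_ball_nat]
      trivial
  · refine MeasurableSpace.generateFrom_le ?_
    rintro _ ⟨O, hO, -, rfl⟩
    have : {S : GroundConf d | S.pts ∩ O = ∅} = (fun S => (S.pts ∩ O).encard) ⁻¹' {0} := by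
      ext S
      simp
    rw [this]
    exact measurable_encard_pts hO.measurableSet trivial

theorem markedConf_eq_generateFrom : (inferInstance : MeasurableSpace (MarkedConf d)) =
    MeasurableSpace.generateFrom
      (voidEvents (fun μ : MarkedConf d => μ.1.atoms) (confExhaustion d)) := by
  change (instMeasurableSpaceConf d).comap Subtype.val = _
  rw [conf_eq_generateFrom, MeasurableSpace.comap_generateFrom]
  congr 1
  ext s
  constructor
  · rintro ⟨_, ⟨O, hO, hn, rfl⟩, rfl⟩
    exact ⟨O, hO, hn, rfl⟩
  · rintro ⟨O, hO, hn, rfl⟩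
    exact ⟨_, ⟨O, hO, hn, rfl⟩, rfl⟩

/-! ### The stationary Poisson process -/

/-- Bounded measurable sets of positions. -/
def boundedSets (d : ℕ) : Set (Set (Pos d)) := {B | MeasurableSet B ∧ ∃ n : ℕ, B ⊆ Metric.ball 0 n}

theorem isPiSystem_boundedSets : IsPiSystem (boundedSets d) := by
  rintro B ⟨hB, n, hn⟩ B' ⟨hB', -⟩ -
  exact ⟨hB.inter hB', n, Set.inter_subset_left.trans hn⟩

theorem ball_mem_boundedSets (n : ℕ) : Metric.ball (0 : Pos d) n ∈ boundedSets d :=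
  ⟨measurableSet_ball, n, subset_rfl⟩

theorem generateFrom_boundedSets :
    MeasurableSpace.generateFrom (boundedSets d) = (inferInstance : MeasurableSpace (Pos d)) := by
  apply le_antisymm
  · exact MeasurableSpace.generateFrom_le fun B hB => hB.1
  · intro B hB
    rw [← Set.inter_univ B, ← Metric.iUnion_ball_nat (0 : Pos d), Set.inter_iUnion]
    exact MeasurableSet.iUnion fun n => MeasurableSpace.measurableSet_generateFrom
      ⟨hB.inter measurableSet_ball, n, Set.inter_subset_right⟩

theorem volume_lt_top_of_mem_boundedSets {B : Set (Pos d)} (hB : B ∈ boundedSets d) :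
    volume B < ∞ := by
  obtain ⟨n, hn⟩ := hB.2
  exact (measure_mono hn).trans_lt measure_ball_lt_top

theorem isCountablySpanning_boundedSets : IsCountablySpanning (boundedSets d) :=
  ⟨fun n => Metric.ball 0 n, fun n => ball_mem_boundedSets n, Metric.iUnion_ball_nat 0⟩

/-- The void events of ground configurations. -/
abbrev groundVoids (d : ℕ) : Set (Set (GroundConf d)) :=
  voidEvents GroundConf.pts fun n : ℕ => Metric.ball (0 : Pos d) n

theorem isPiSystem_groundVoids : IsPiSystem (groundVoids d) :=
  isPiSystem_voidEvents fun _ _ h => Metric.ball_subset_ball (by exact_mod_cast h)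

theorem univ_mem_voidEvents {T E : Type*} [TopologicalSpace E] (A : T → Set E) (K : ℕ → Set E) :
    Set.univ ∈ voidEvents A K :=
  ⟨∅, isOpen_empty, ⟨0, Set.empty_subset _⟩, by ext; simp⟩

theorem groundConf_measure_ext {μ ν : Measure (GroundConf d)} [IsFiniteMeasure μ]
    (h : ∀ s ∈ groundVoids d, μ s = ν s) : μ = ν :=
  ext_of_generate_finite _ groundConf_eq_generateFrom isPiSystem_groundVoids h
    (h _ (univ_mem_voidEvents _ _))

theorem measurableSet_pts_inter_eq_empty {B : Set (Pos d)} (hB : MeasurableSet B) :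
    MeasurableSet {S : GroundConf d | S.pts ∩ B = ∅} := by
  have : {S : GroundConf d | S.pts ∩ B = ∅} = (fun S => (S.pts ∩ B).encard) ⁻¹' {0} := by
    ext S
    simp
  rw [this]
  exact measurable_encard_pts hB trivial

theorem prod_groundConf_measure_ext {μ ν : Measure (Pos d × GroundConf d)}
    (hfin : ∀ n : ℕ, μ (Metric.ball 0 n ×ˢ Set.univ) ≠ ∞)
    (h : ∀ B ∈ boundedSets d, ∀ s ∈ groundVoids d, μ (B ×ˢ s) = ν (B ×ˢ s)) : μ = ν := by
  refine Measure.ext_of_generateFrom_of_iUnion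
    (Set.image2 (· ×ˢ ·) (boundedSets d) (groundVoids d))
    (fun n : ℕ => Metric.ball 0 n ×ˢ Set.univ) ?_
    (isPiSystem_boundedSets.prod isPiSystem_groundVoids) ?_ ?_ hfin ?_
  · rw [← generateFrom_prod_eq isCountablySpanning_boundedSets
      ⟨fun _ => Set.univ, fun _ => univ_mem_voidEvents _ _, Set.iUnion_const _⟩,
      generateFrom_boundedSets, ← groundConf_eq_generateFrom]
  · rw [← Set.iUnion_prod_const, Metric.iUnion_ball_nat, Set.univ_prod_univ]
  · exact fun n => ⟨_, ball_mem_boundedSets n, _, univ_mem_voidEvents _ _, rfl⟩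
  · rintro _ ⟨B, hB, s, hs, rfl⟩
    exact h B hB s hs

theorem shiftGround_shiftGround (x y : Pos d) (S : GroundConf d) :
    shiftGround x (shiftGround y S) = shiftGround (x + y) S := by
  ext t
  simp [shiftGround, add_assoc]

theorem shiftGround_zero (S : GroundConf d) : shiftGround 0 S = S := by
  ext t
  simp [shiftGround]

theorem zero_mem_addOrigin (S : GroundConf d) : 0 ∈ (addOrigin S).pts := Set.mem_insert _ _

theorem tsum_natCast_mul_poisson {x : ℝ} (hx : 0 ≤ x) :
    ∑' k : ℕ, (k : ℝ≥0∞) * ENNReal.ofReal (Real.exp (-x) * x ^ k / (k.factorial : ℝ)) =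
      ENNReal.ofReal x := by
  rw [tsum_eq_zero_add' ENNReal.summable]
  have h : ∀ k : ℕ, ((k + 1 : ℕ) : ℝ≥0∞) *
      ENNReal.ofReal (Real.exp (-x) * x ^ (k + 1) / ((k + 1).factorial : ℝ)) =
      ENNReal.ofReal x * ENNReal.ofReal (Real.exp (-x) * x ^ k / (k.factorial : ℝ)) := fun k => by
    rw [← ENNReal.ofReal_natCast, ← ENNReal.ofReal_mul (by positivity), ← ENNReal.ofReal_mul hx]
    congr 1
    rw [Nat.factorial_succ]
    push_cast
    field_simp
    ring
  simp_rw [h]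
  have hs : HasSum (fun k : ℕ => Real.exp (-x) * x ^ k / (k.factorial : ℝ)) 1 :=
    hasSum_one_poissonMeasure ⟨x, hx⟩
  rw [ENNReal.tsum_mul_left, ← ENNReal.ofReal_tsum_of_nonneg (fun k => by positivity)
    hs.summable, hs.tsum_eq]
  simp

namespace IsUnitPoisson

variable {Ω : Type*} [MeasurableSpace Ω] {Pr : Measure Ω}
  {S : Ω → GroundConf d}

theorem void (hS : IsUnitPoisson Pr S) {B : Set (Pos d)} (hB : MeasurableSet B)
    (hB' : volume B ≠ ∞) :
    Pr {ω | (S ω).pts ∩ B = ∅} = ENNReal.ofReal (Real.exp (-(volume.real B))) := by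
  have h := hS.count B hB hB' 0
  simpa using h

theorem mean (hS : IsUnitPoisson Pr S) {B : Set (Pos d)} (hB : B ∈ boundedSets d) :
    ∫⁻ ω, groundCount d (S ω) B ∂Pr = volume B := by
  have hfin : ∀ ω, ((S ω).pts ∩ B).Finite := fun ω => by
    obtain ⟨n, hn⟩ := hB.2
    exact ((S ω).locFinite n).subset
      fun t ht => ⟨ht.1, by simpa using (Metric.mem_ball.1 (hn ht.2)).le⟩
  have hm : Measurable fun ω => ((S ω).pts ∩ B).ncard :=
    (Measurable.of_discrete (f := ENat.toNat)).comp
      ((measurable_encard_pts hB.1).comp hS.measurable)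
  have hcast : ∀ ω, ((S ω).pts ∩ B).encard = (((S ω).pts ∩ B).ncard : ℕ∞) := fun ω =>
    ((hfin ω).cast_ncard_eq).symm
  have h1 : ∀ ω, groundCount d (S ω) B = (((S ω).pts ∩ B).ncard : ℝ≥0∞) := fun ω => by
    rw [groundCount_apply' _ hB.1, hcast]
    simp
  simp_rw [h1]
  have hv := volume_lt_top_of_mem_boundedSets hB
  rw [← lintegral_map (f := fun n : ℕ => (n : ℝ≥0∞)) Measurable.of_discrete hm,
    lintegral_countable']
  have h2 : ∀ k : ℕ, Pr.map (fun ω => ((S ω).pts ∩ B).ncard) {k} = ENNReal.ofReal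
      (Real.exp (-(volume.real B)) * volume.real B ^ k / (k.factorial : ℝ)) := fun k => by
    rw [Measure.map_apply hm (measurableSet_singleton k), ← hS.count B hB.1 hv.ne k]
    congr 1
    ext ω
    simp [hcast]
  simp_rw [h2]
  rw [tsum_natCast_mul_poisson measureReal_nonneg, ofReal_measureReal hv.ne]

/-- On the event that `C` is empty, the points in `B` are those in `B \ C`, and their number is
independent of the number of points in `C`. -/
theorem mean_mul_void (hS : IsUnitPoisson Pr S) {B C : Set (Pos d)} (hB : B ∈ boundedSets d)
    (hC : MeasurableSet C) (hC' : volume C ≠ ∞) :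
    ∫⁻ ω, groundCount d (S ω) B * {S : GroundConf d | S.pts ∩ C = ∅}.indicator 1 (S ω) ∂Pr =
      volume (B \ C) * ENNReal.ofReal (Real.exp (-(volume.real C))) := by
  have hBC : B \ C ∈ boundedSets d :=
    ⟨hB.1.diff hC, hB.2.imp fun n hn => Set.sdiff_subset.trans hn⟩
  have h1 : ∀ ω, groundCount d (S ω) B * {S : GroundConf d | S.pts ∩ C = ∅}.indicator 1 (S ω) =
      groundCount d (S ω) (B \ C) *
        {S : GroundConf d | S.pts ∩ C = ∅}.indicator 1 (S ω) := fun ω => by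
    by_cases h : (S ω).pts ∩ C = ∅
    · have : (S ω).pts ∩ B = (S ω).pts ∩ (B \ C) := by
        ext t
        refine ⟨fun ht => ⟨ht.1, ht.2, fun htC => ?_⟩, fun ht => ⟨ht.1, ht.2.1⟩⟩
        have : t ∈ (S ω).pts ∩ C := ⟨ht.1, htC⟩
        rw [h] at this
        exact this
      rw [groundCount_apply' _ hB.1, groundCount_apply' _ hBC.1, this]
    · simp [h]
  simp_rw [h1]
  let f : ℕ∞ → ℝ≥0∞ := fun n => n
  let g : ℕ∞ → ℝ≥0∞ := fun n => ({0} : Set ℕ∞).indicator 1 n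
  have hind := hS.indep 2 ![B \ C, C]
    (fun i => by fin_cases i <;> simp [hBC.1, hC])
    (fun i j hij => by
      fin_cases i <;> fin_cases j <;>
        simp_all [Set.disjoint_sdiff_left, Set.disjoint_sdiff_right])
  have hind2 := hind.indepFun (show (0 : Fin 2) ≠ 1 by simp)
  have hind3 := hind2.comp (φ := f) (ψ := g) Measurable.of_discrete Measurable.of_discrete
  have hm1 : Measurable fun ω => groundCount d (S ω) (B \ C) :=
    ((groundCount d).measurable_coe hBC.1).comp hS.measurable
  have hm2 : Measurable fun ω => {S : GroundConf d | S.pts ∩ C = ∅}.indicator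
      (1 : GroundConf d → ℝ≥0∞) (S ω) :=
    (measurable_one.indicator (measurableSet_pts_inter_eq_empty hC)).comp hS.measurable
  have e1 : (f ∘ fun ω => ((S ω).pts ∩ ![B \ C, C] 0).encard) =
      fun ω => groundCount d (S ω) (B \ C) := by
    ext ω
    simp [f, groundCount_apply' _ hBC.1]
  have e2 : (g ∘ fun ω => ((S ω).pts ∩ ![B \ C, C] 1).encard) =
      fun ω => {S : GroundConf d | S.pts ∩ C = ∅}.indicator 1 (S ω) := by
    ext ω
    simp [g, Set.indicator]
  rw [e1, e2] at hind3
  have hmul := lintegral_mul_eq_lintegral_mul_lintegral_of_indepFun hm1 hm2 hind3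
  simp only [Pi.mul_apply] at hmul
  rw [hmul, hS.mean hBC]
  congr 1
  rw [← hS.void hC hC']
  have : (fun ω => {S : GroundConf d | S.pts ∩ C = ∅}.indicator (1 : GroundConf d → ℝ≥0∞) (S ω)) =
      {ω | (S ω).pts ∩ C = ∅}.indicator 1 := by
    ext ω
    simp [Set.indicator]
  rw [this, lintegral_indicator_one]
  exact hS.measurable (measurableSet_pts_inter_eq_empty hC)

/-- Stationarity. -/
theorem map_shiftGround [IsProbabilityMeasure Pr] (hS : IsUnitPoisson Pr S) (z : Pos d) :
    (Pr.map S).map (shiftGround z) = Pr.map S := by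
  have hz : Measurable (shiftGround z : GroundConf d → GroundConf d) :=
    measurable_shiftGround.comp (measurable_const.prodMk measurable_id)
  have := Measure.isProbabilityMeasure_map (μ := Pr) hS.measurable.aemeasurable
  have := Measure.isProbabilityMeasure_map (μ := Pr.map S) hz.aemeasurable
  refine groundConf_measure_ext ?_
  rintro _ ⟨O, hO, ⟨n, hn⟩, rfl⟩
  have hOv : volume O ≠ ∞ := ((measure_mono hn).trans_lt measure_ball_lt_top).ne
  have hv : volume ((fun t => t - z) ⁻¹' O) = volume O := by
    simp_rw [sub_eq_add_neg]
    exact measure_preimage_add_right _ _ _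
  rw [Measure.map_apply hz (measurableSet_pts_inter_eq_empty hO.measurableSet),
    Measure.map_apply hS.measurable (measurableSet_pts_inter_eq_empty hO.measurableSet),
    Measure.map_apply hS.measurable (hz (measurableSet_pts_inter_eq_empty hO.measurableSet))]
  have h1 := hS.void hO.measurableSet hOv
  have h2 := hS.void (B := (fun t => t - z) ⁻¹' O) (hO.measurableSet.preimage (by fun_prop))
    (by rw [hv]; exact hOv)
  have h3 : volume.real ((fun t => t - z) ⁻¹' O) = volume.real O := by
    rw [Measure.real, hv, Measure.real]
  rw [h3] at h2
  refine Eq.trans ?_ (h2.trans h1.symm)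
  congr 1
  ext ω
  simp only [Set.mem_preimage, Set.mem_ofPred_eq, Set.eq_empty_iff_forall_notMem, Set.mem_inter_iff,
    shiftGround]
  constructor
  · intro h t ht
    exact h (t - z) (by simpa using ht)
  · intro h t ht
    exact h (t + z) (by simpa using ht)

end IsUnitPoisson

namespace IsUnitPoisson

variable {Ω : Type*} [MeasurableSpace Ω] {Pr : Measure Ω} [IsProbabilityMeasure Pr]
  {S : Ω → GroundConf d}

/-- The map `(t, S) ↦ (t, S + δ_t)`. -/
def addPoint (q : Pos d × GroundConf d) : Pos d × GroundConf d :=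
  (q.1, shiftGround (-q.1) (addOrigin (shiftGround q.1 q.2)))

theorem mem_addPoint (t x : Pos d) (S : GroundConf d) :
    x ∈ (addPoint (t, S)).2.pts ↔ x = t ∨ x ∈ S.pts := by
  simp [addPoint, shiftGround, addOrigin, ← sub_eq_add_neg, sub_eq_zero]

theorem measurable_addPoint : Measurable (addPoint (d := d)) :=
  measurable_fst.prodMk (measurable_shiftGround.comp (measurable_fst.neg.prodMk
    (measurable_addOrigin.comp measurable_shiftGround)))

/-- It suffices to compare the measures on products of a bounded set `B` with the event that `O` is
void. Both give `|B \ O| exp(-|O|)`: on the left by `mean_mul_void`, on the right because `S + δ_t`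
misses `O` iff `t ∉ O` and `S` misses `O`. -/
theorem mecke_measure (hS : IsUnitPoisson Pr S) :
    ((Pr.map S) ⊗ₘ groundCount d).map Prod.swap =
      ((volume : Measure (Pos d)).prod (Pr.map S)).map addPoint := by
  have := Measure.isProbabilityMeasure_map (μ := Pr) hS.measurable.aemeasurable
  have key : ∀ B ∈ boundedSets d, ∀ O : Set (Pos d), MeasurableSet O → volume O ≠ ∞ →
      ((Pr.map S) ⊗ₘ groundCount d).map Prod.swap (B ×ˢ {S | S.pts ∩ O = ∅}) =
        volume (B \ O) * ENNReal.ofReal (Real.exp (-(volume.real O))) := by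
    intro B hB O hO hOv
    have hOm := measurableSet_pts_inter_eq_empty hO
    rw [Measure.map_apply measurable_swap (hB.1.prod hOm), Set.preimage_swap_prod,
      Measure.compProd_apply_prod hOm hB.1, ← hS.mean_mul_void hB hO hOv,
      ← lintegral_indicator hOm, lintegral_map ?_ hS.measurable]
    · congr 1
      ext ω
      by_cases h : (S ω).pts ∩ O = ∅ <;> simp [Set.indicator, h]
    · exact ((groundCount d).measurable_coe hB.1).indicator hOm
  refine prod_groundConf_measure_ext (fun n => ?_) ?_
  · have := key _ (ball_mem_boundedSets n) ∅ MeasurableSet.empty (by simp)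
    simp only [Set.inter_empty, Set.ofPred_true] at this
    rw [this]
    simp [measure_ball_lt_top.ne]
  · rintro B hB _ ⟨O, hO, ⟨n, hn⟩, rfl⟩
    have hOv : volume O ≠ ∞ := ((measure_mono hn).trans_lt measure_ball_lt_top).ne
    have hOm := measurableSet_pts_inter_eq_empty hO.measurableSet
    rw [key B hB O hO.measurableSet hOv, Measure.map_apply measurable_addPoint (hB.1.prod hOm)]
    have : (addPoint ⁻¹' (B ×ˢ {S : GroundConf d | S.pts ∩ O = ∅}) : Set (Pos d × GroundConf d)) =
        (B \ O) ×ˢ {S | S.pts ∩ O = ∅} := by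
      ext ⟨t, S⟩
      simp only [Set.mem_preimage, Set.mem_prod, Set.mem_ofPred_eq, Set.mem_sdiff,
        Set.eq_empty_iff_forall_notMem, Set.mem_inter_iff, mem_addPoint]
      constructor
      · rintro ⟨h1, h2⟩
        exact ⟨⟨h1, fun h => h2 t ⟨Or.inl rfl, h⟩⟩, fun x hx => h2 x ⟨Or.inr hx.1, hx.2⟩⟩
      · rintro ⟨⟨h1, h2⟩, h3⟩
        refine ⟨h1, ?_⟩
        rintro x ⟨rfl | hx, hxO⟩
        · exact h2 hxO
        · exact h3 x ⟨hx, hxO⟩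
    rw [this, Measure.prod_prod, Measure.map_apply hS.measurable hOm]
    congr 1
    exact (hS.void hO.measurableSet hOv).symm

/-- The refined Campbell formula for the stationary Poisson process. -/
theorem campbell (hS : IsUnitPoisson Pr S) {h : Pos d × GroundConf d → ℝ≥0∞}
    (hh : Measurable h) :
    ∫⁻ T, ∫⁻ t, h (t, shiftGround t T) ∂groundCount d T ∂(Pr.map S) =
      ∫⁻ t : Pos d, ∫⁻ T, h (t, addOrigin T) ∂(Pr.map S) := by
  have := Measure.isProbabilityMeasure_map (μ := Pr) hS.measurable.aemeasurable
  obtain ⟨g, hgdef⟩ : ∃ g : Pos d × GroundConf d → ℝ≥0∞,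
    ∀ t T, g (t, T) = h (t, shiftGround t T) := ⟨fun q => h (q.1, shiftGround q.1 q.2), by simp⟩
  have hg : Measurable g := by
    have : g = fun q => h (q.1, shiftGround q.1 q.2) := by
      ext ⟨t, T⟩
      exact hgdef t T
    rw [this]
    exact hh.comp (measurable_fst.prodMk measurable_shiftGround)
  have h1 := congrArg (fun M => ∫⁻ q, g q ∂M) hS.mecke_measure
  rw [lintegral_map hg measurable_swap,
    Measure.lintegral_compProd (f := fun q => g q.swap) (hg.comp measurable_swap),
    lintegral_map hg measurable_addPoint,
    lintegral_prod (fun a => g (addPoint a)) (hg.comp measurable_addPoint).aemeasurable] at h1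
  simp only [Prod.swap_prod_mk, addPoint, hgdef] at h1
  rw [h1]
  congr 1
  ext t
  have hz : Measurable (shiftGround t : GroundConf d → GroundConf d) :=
    measurable_shiftGround.comp (measurable_const.prodMk measurable_id)
  have h2 : Measurable fun T : GroundConf d => h (t, addOrigin T) :=
    hh.comp (measurable_const.prodMk measurable_addOrigin)
  -- The other side involves `T` only through `shiftGround t T`, which by stationarity may be
  -- replaced by `T`.
  conv_rhs => rw [← hS.map_shiftGround t]
  rw [lintegral_map h2 hz]
  simp [shiftGround_shiftGround, shiftGround_zero]

/-- The mass transport principle for the Palm version of the Poisson process. -/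
theorem mass_transport (hS : IsUnitPoisson Pr S) {k : Pos d × GroundConf d → ℝ≥0∞}
    (hk : Measurable k) :
    ∫⁻ T, ∫⁻ x, k (x, addOrigin T) ∂groundCount d (addOrigin T) ∂(Pr.map S) =
      ∫⁻ T, ∫⁻ x, k (-x, shiftGround x (addOrigin T)) ∂groundCount d (addOrigin T)
        ∂(Pr.map S) := by
  have := Measure.isProbabilityMeasure_map (μ := Pr) hS.measurable.aemeasurable
  -- Any set of positive finite volume would do; its volume cancels at the end.
  set C : Set (Pos d) := Metric.ball 0 1 with hC
  have hCm : MeasurableSet C := measurableSet_ball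
  have hC0 : volume C ≠ 0 := (Metric.measure_ball_pos _ _ one_pos).ne'
  have hCt : volume C ≠ ∞ := measure_ball_lt_top.ne
  let f : Pos d → ℝ≥0∞ := C.indicator 1
  have hf : Measurable f := measurable_one.indicator hCm
  have hfC : ∫⁻ t, f t = volume C := lintegral_indicator_one hCm
  -- Both functions produce the same sum over pairs of points, in which the point sending mass is
  -- localized in `C`. For `h1` the sender is the base point `t` of the Campbell formula; for `h2`
  -- the base point is the receiver and the sender is `x + t`. Applying the Campbell formula to both
  -- gives the two sides of the claim, each times the volume of `C`.
  let h1 : Pos d × GroundConf d → ℝ≥0∞ := fun q => f q.1 * ∫⁻ x, k (x, q.2) ∂groundCount d q.2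
  have hh1' : Measurable fun T : GroundConf d => ∫⁻ x, k (x, T) ∂groundCount d T :=
    measurable_lintegral_kernel_comp _ measurable_id (hk.comp measurable_swap)
  have hh1 : Measurable h1 := (hf.comp measurable_fst).mul (hh1'.comp measurable_snd)
  let h2 : Pos d × GroundConf d → ℝ≥0∞ := fun q =>
    ∫⁻ x, f (x + q.1) * k (-x, shiftGround x q.2) ∂groundCount d q.2
  have hk2 : Measurable fun q : Pos d × GroundConf d => k (-q.1, shiftGround q.1 q.2) :=
    hk.comp (measurable_fst.neg.prodMk measurable_shiftGround)
  have hh2 : Measurable h2 := by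
    refine measurable_lintegral_kernel_comp _ measurable_snd ?_
    exact (hf.comp (by fun_prop)).mul
      (hk2.comp (measurable_snd.prodMk (measurable_snd.comp measurable_fst)))
  have hswap : ∀ T : GroundConf d, ∫⁻ t, h1 (t, shiftGround t T) ∂groundCount d T =
      ∫⁻ t, h2 (t, shiftGround t T) ∂groundCount d T := fun T => by
    simp only [h1, h2]
    simp_rw [lintegral_groundCount_shift, shiftGround_shiftGround, sub_add_cancel, neg_sub]
    have e : ∀ t, f t * ∫⁻ x, k (x - t, shiftGround t T) ∂groundCount d T =
        ∫⁻ x, f t * k (x - t, shiftGround t T) ∂groundCount d T := fun t => by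
      rw [lintegral_const_mul]
      exact hk.comp ((measurable_id.sub_const t).prodMk measurable_const)
    simp_rw [e]
    rw [lintegral_lintegral_swap]
    refine Measurable.aemeasurable ?_
    refine (hf.comp measurable_fst).mul (hk.comp ((measurable_snd.sub measurable_fst).prodMk ?_))
    exact measurable_shiftGround.comp (measurable_fst.prodMk measurable_const)
  have e1 := hS.campbell hh1
  have e2 := hS.campbell hh2
  simp_rw [hswap] at e1
  rw [e1] at e2
  have e3 : ∫⁻ t : Pos d, ∫⁻ T, h1 (t, addOrigin T) ∂(Pr.map S) = volume C *
      ∫⁻ T, ∫⁻ x, k (x, addOrigin T) ∂groundCount d (addOrigin T) ∂(Pr.map S) := by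
    have e : ∀ t, ∫⁻ T, h1 (t, addOrigin T) ∂(Pr.map S) =
        f t * ∫⁻ T, ∫⁻ x, k (x, addOrigin T) ∂groundCount d (addOrigin T) ∂(Pr.map S) := fun t =>
      lintegral_const_mul (f t) (f := fun T => ∫⁻ x, k (x, addOrigin T) ∂groundCount d (addOrigin T))
        (hh1'.comp measurable_addOrigin)
    simp_rw [e]
    rw [lintegral_mul_const _ hf, hfC]
  have e4 : ∫⁻ t : Pos d, ∫⁻ T, h2 (t, addOrigin T) ∂(Pr.map S) = volume C *
      ∫⁻ T, ∫⁻ x, k (-x, shiftGround x (addOrigin T)) ∂groundCount d (addOrigin T)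
        ∂(Pr.map S) := by
    rw [lintegral_lintegral_swap]
    · simp only [h2]
      rw [← lintegral_const_mul]
      · congr 1
        ext T
        have hm : Measurable fun x => k (-x, shiftGround x (addOrigin T)) :=
          hk2.comp (measurable_id.prodMk measurable_const)
        rw [lintegral_lintegral_swap, ← lintegral_const_mul _ hm]
        · congr 1
          ext x
          have hfx : Measurable fun y => f (x + y) := hf.comp (by fun_prop)
          rw [lintegral_mul_const _ hfx, lintegral_add_left_eq_self f x, hfC]
        · exact ((hf.comp (by fun_prop)).mul (hm.comp measurable_snd)).aemeasurable
      · refine measurable_lintegral_kernel_comp _ measurable_addOrigin ?_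
        exact hk2.comp (measurable_snd.prodMk (measurable_addOrigin.comp measurable_fst))
    · exact (hh2.comp (measurable_fst.prodMk
        (measurable_addOrigin.comp measurable_snd))).aemeasurable
  rw [e3, e4] at e2
  exact (ENNReal.mul_right_inj hC0 hCt).1 e2

end IsUnitPoisson

/-! ### Configurations given by sequences of positions and scores -/

/-- The positions `τ i` are distinct and locally finite. -/
def IsLocallyFiniteSeq (τ : ℕ → Pos d) : Prop :=
  Function.Injective τ ∧ ∀ R : ℝ, {i | ‖τ i‖ ≤ R}.Finite

/-- The configuration of the points `(τ i, a i)` with `a i > 0`. -/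
def seqConf (τ : ℕ → Pos d) (a : ℕ → ℝ) : MarkedConf d :=
  have hfin : ∀ R : ℝ, {p : Pos d × ℝ |
      (IsLocallyFiniteSeq τ ∧ ∃ i, p = (τ i, a i) ∧ 0 < a i) ∧ ‖p.1‖ ≤ R}.Finite := fun R => by
    by_cases h : IsLocallyFiniteSeq τ
    · refine ((h.2 R).image (fun i => (τ i, a i))).subset ?_
      rintro _ ⟨⟨-, i, rfl, -⟩, hR⟩
      exact ⟨i, hR, rfl⟩
    · refine Set.finite_empty.subset ?_
      rintro p ⟨⟨h', -⟩, -⟩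
      exact h h'
  ⟨{ atoms := {p | IsLocallyFiniteSeq τ ∧ ∃ i, p = (τ i, a i) ∧ 0 < a i}
     pos := by
      rintro _ ⟨-, i, rfl, hi⟩
      exact hi
     simple := by
      rintro _ ⟨hτ, i, rfl, hi⟩ _ ⟨-, j, rfl, hj⟩ h
      rw [hτ.1 h]
     locFinite := fun R _ _ => (hfin R).subset fun _ hp => ⟨hp.1, hp.2.1⟩ }, hfin⟩

/-- The ground configuration of the points `τ i`. -/
def seqGround (τ : ℕ → Pos d) : GroundConf d where
  pts := {t | IsLocallyFiniteSeq τ ∧ ∃ i, t = τ i}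
  locFinite := fun R => by
    by_cases h : IsLocallyFiniteSeq τ
    · refine ((h.2 R).image τ).subset ?_
      rintro _ ⟨⟨-, i, rfl⟩, hR⟩
      exact ⟨i, hR, rfl⟩
    · refine Set.finite_empty.subset ?_
      rintro p ⟨⟨h', -⟩, -⟩
      exact h h'

theorem mem_seqConf {τ : ℕ → Pos d} (hτ : IsLocallyFiniteSeq τ) {a : ℕ → ℝ} {p : Pos d × ℝ} :
    p ∈ (seqConf τ a).1.atoms ↔ ∃ i, p = (τ i, a i) ∧ 0 < a i :=
  ⟨fun h => h.2, fun h => ⟨hτ, h⟩⟩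

theorem mem_seqGround {τ : ℕ → Pos d} (hτ : IsLocallyFiniteSeq τ) {t : Pos d} :
    t ∈ (seqGround τ).pts ↔ ∃ i, t = τ i :=
  ⟨fun h => h.2, fun h => ⟨hτ, h⟩⟩

open scoped Classical in
theorem lintegral_confCount_seqConf (τ : ℕ → Pos d) (a : ℕ → ℝ) (f : Pos d × ℝ → ℝ≥0∞) :
    ∫⁻ p, f p ∂confCount d (seqConf τ a).1 = if IsLocallyFiniteSeq τ then
      ∑' i, (if 0 < a i then f (τ i, a i) else 0) else 0 := by
  split_ifs with h
  · have e : (seqConf τ a).1.atoms = (fun i => (τ i, a i)) '' {i | 0 < a i} := by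
      ext p
      rw [mem_seqConf h]
      exact ⟨fun ⟨i, hi, h0⟩ => ⟨i, h0, hi.symm⟩, fun ⟨i, h0, hi⟩ => ⟨i, hi.symm, h0⟩⟩
    rw [confCount_apply, e, lintegral_count_restrict_image (Set.to_countable _)
      (fun i _ j _ hij => h.1 (Prod.ext_iff.1 hij).1),
      lintegral_count_restrict (Set.to_countable _),
      tsum_subtype {i | 0 < a i} (fun i => f (τ i, a i))]
    congr 1
  · have e : (seqConf τ a).1.atoms = ∅ := by
      ext p
      simp [seqConf, h]
    rw [confCount_apply, e]
    simp

open scoped Classical in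
theorem lintegral_groundCount_seqGround (τ : ℕ → Pos d) (f : Pos d → ℝ≥0∞) :
    ∫⁻ t, f t ∂groundCount d (seqGround τ) = if IsLocallyFiniteSeq τ then
      ∑' i, f (τ i) else 0 := by
  split_ifs with h
  · have e : (seqGround τ).pts = τ '' Set.univ := by
      ext p
      rw [mem_seqGround h]
      simp [eq_comm]
    rw [groundCount_apply, e, lintegral_count_restrict_image (Set.to_countable _)
      h.1.injOn, lintegral_count_restrict (Set.to_countable _), tsum_univ (fun i => f (τ i))]
  · have e : (seqGround τ).pts = ∅ := by
      ext p
      simp [seqGround, h]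
    rw [groundCount_apply, e]
    simp

theorem measurableSet_isLocallyFiniteSeq :
    MeasurableSet {τ : ℕ → Pos d | IsLocallyFiniteSeq τ} := by
  have : {τ : ℕ → Pos d | IsLocallyFiniteSeq τ} =
      (⋂ i, ⋂ j, ⋂ _ : i ≠ j, {τ : ℕ → Pos d | τ i = τ j}ᶜ) ∩
      ⋂ R : ℕ, ⋃ n : ℕ, ⋂ i : ℕ, ⋂ _ : n ≤ i, {τ : ℕ → Pos d | ‖τ i‖ ≤ R}ᶜ := by
    ext τ
    simp only [IsLocallyFiniteSeq, Set.mem_ofPred_eq, Set.mem_inter_iff, Set.mem_iInter,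
      Set.mem_compl_iff, Set.mem_iUnion]
    refine and_congr ⟨fun h i j hij => fun h' => hij (h h'), fun h i j hij => ?_⟩ ⟨fun h R => ?_,
      fun h R => ?_⟩
    · by_contra h'
      exact h i j h' hij
    · obtain ⟨n, hn⟩ := (h R).bddAbove
      exact ⟨n + 1, fun i hi h' => absurd (hn h') (by omega)⟩
    · obtain ⟨R', hR'⟩ := exists_nat_ge R
      obtain ⟨n, hn⟩ := h R'
      refine (Set.finite_Iio n).subset fun i hi => ?_
      by_contra h'
      exact hn i (not_lt.1 h') (le_trans hi hR')
  rw [this]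
  refine MeasurableSet.inter ?_ ?_
  · exact MeasurableSet.iInter fun i => MeasurableSet.iInter fun j => MeasurableSet.iInter fun _ =>
      (measurableSet_eq_fun (measurable_pi_apply i) (measurable_pi_apply j)).compl
  · exact MeasurableSet.iInter fun R => MeasurableSet.iUnion fun n => MeasurableSet.iInter fun i =>
      MeasurableSet.iInter fun _ =>
        (measurableSet_le (measurable_pi_apply i).norm measurable_const).compl

open scoped Classical in
theorem measurable_seqConf :
    Measurable fun q : (ℕ → Pos d) × (ℕ → ℝ) => seqConf q.1 q.2 := by
  refine Measurable.subtype_mk (measurable_to_conf fun B hB => ?_)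
  change Measurable fun q : (ℕ → Pos d) × (ℕ → ℝ) => confCount d (seqConf q.1 q.2).1 B
  simp_rw [← lintegral_indicator_one hB, lintegral_confCount_seqConf]
  refine Measurable.ite (measurable_fst measurableSet_isLocallyFiniteSeq) ?_ measurable_const
  refine Measurable.tsum fun i => ?_
  exact Measurable.ite (measurableSet_lt measurable_const (by fun_prop))
    ((measurable_one.indicator hB).comp (by fun_prop)) measurable_const

open scoped Classical in
theorem measurable_seqGround : Measurable (seqGround : (ℕ → Pos d) → GroundConf d) := by
  refine measurable_to_groundConf fun B hB => ?_
  simp_rw [← lintegral_indicator_one hB, lintegral_groundCount_seqGround]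
  refine Measurable.ite measurableSet_isLocallyFiniteSeq ?_ measurable_const
  exact Measurable.tsum fun i =>
    (measurable_one.indicator hB).comp (measurable_pi_apply i)

theorem IsLocallyFiniteSeq.sub {τ : ℕ → Pos d} (hτ : IsLocallyFiniteSeq τ) (z : Pos d) :
    IsLocallyFiniteSeq fun i => τ i - z :=
  ⟨fun i j h => hτ.1 (sub_left_injective h), fun R => (hτ.2 (R + ‖z‖)).subset fun i hi => by
    have h1 := norm_add_le (τ i - z) z
    rw [sub_add_cancel] at h1
    exact h1.trans (by simpa using hi)⟩

theorem shiftMarked_seqConf {τ : ℕ → Pos d} (hτ : IsLocallyFiniteSeq τ) (a : ℕ → ℝ) (z : Pos d) :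
    shiftMarked z (seqConf τ a) = seqConf (fun i => τ i - z) a := by
  refine Subtype.ext (Conf.ext (Set.ext fun p => ?_))
  rw [mem_seqConf (hτ.sub z)]
  change (p.1 + z, p.2) ∈ (seqConf τ a).1.atoms ↔ _
  rw [mem_seqConf hτ]
  simp [Prod.ext_iff, eq_sub_iff_add_eq]

theorem shiftGround_seqGround {τ : ℕ → Pos d} (hτ : IsLocallyFiniteSeq τ) (z : Pos d) :
    shiftGround z (seqGround τ) = seqGround (fun i => τ i - z) := by
  refine GroundConf.ext (Set.ext fun t => ?_)
  rw [mem_seqGround (hτ.sub z)]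
  change t + z ∈ (seqGround τ).pts ↔ _
  rw [mem_seqGround hτ]
  simp [eq_sub_iff_add_eq]

theorem proj_seqConf {τ : ℕ → Pos d} {a : ℕ → ℝ} (ha : ∀ i, 0 < a i) :
    proj (seqConf τ a) = seqGround τ := by
  refine GroundConf.ext (Set.ext fun t => ?_)
  constructor
  · rintro ⟨_, ⟨h, i, rfl, -⟩, rfl⟩
    exact ⟨h, i, rfl⟩
  · rintro ⟨h, i, rfl⟩
    exact ⟨(τ i, a i), ⟨h, i, rfl, ha i⟩, rfl⟩

/-- The sequence `0, τ 0, τ 1, …`. -/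
def consZero (τ : ℕ → Pos d) (i : ℕ) : Pos d := Nat.casesOn i 0 τ

theorem measurable_consZero : Measurable (consZero : (ℕ → Pos d) → ℕ → Pos d) := by
  refine measurable_pi_lambda _ fun i => ?_
  cases i with
  | zero => exact measurable_const
  | succ i => exact measurable_pi_apply i

theorem IsLocallyFiniteSeq.consZero {τ : ℕ → Pos d} (hτ : IsLocallyFiniteSeq τ)
    (h0 : ∀ i, τ i ≠ 0) : IsLocallyFiniteSeq (consZero τ) := by
  constructor
  · intro i j h
    cases i <;> cases j
    · rfl
    · exact absurd h.symm (h0 _)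
    · exact absurd h (h0 _)
    · rw [hτ.1 h]
  · intro R
    refine (((hτ.2 R).image Nat.succ).insert 0).subset ?_
    intro i hi
    cases i with
    | zero => exact Set.mem_insert _ _
    | succ i => exact Set.mem_insert_of_mem _ ⟨i, hi, rfl⟩

theorem seqGround_consZero {τ : ℕ → Pos d} (hτ : IsLocallyFiniteSeq τ) (h0 : ∀ i, τ i ≠ 0) :
    seqGround (consZero τ) = addOrigin (seqGround τ) := by
  refine GroundConf.ext (Set.ext fun t => ?_)
  rw [mem_seqGround (hτ.consZero h0)]
  change _ ↔ t = 0 ∨ t ∈ (seqGround τ).pts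
  rw [mem_seqGround hτ]
  constructor
  · rintro ⟨i, rfl⟩
    cases i with
    | zero => exact Or.inl rfl
    | succ i => exact Or.inr ⟨i, rfl⟩
  · rintro (rfl | ⟨i, rfl⟩)
    · exact ⟨0, rfl⟩
    · exact ⟨i + 1, rfl⟩

/-! ### Independent marking -/

/-- The void probability of an independently marked configuration with ground configuration `S`,
where `v t` is the probability that a mark at `t` causes no hit. -/
def markedVoid (v : Pos d → ℝ≥0∞) (S : GroundConf d) : ℝ≥0∞ :=
  {S | groundCount d S (v ⁻¹' {0}) = 0}.indicator (fun S => ENNReal.ofReal (Real.exp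
    (-(∫⁻ t, ENNReal.ofReal (-Real.log (v t).toReal) ∂groundCount d S).toReal))) S

theorem measurable_markedVoid {v : Pos d → ℝ≥0∞} (hv : Measurable v) :
    Measurable (markedVoid v) := by
  have h1 : Measurable fun S : GroundConf d =>
      ∫⁻ t, ENNReal.ofReal (-Real.log (v t).toReal) ∂groundCount d S :=
    measurable_lintegral_kernel_comp _ measurable_id
      (f := fun _ t => ENNReal.ofReal (-Real.log (v t).toReal)) (by fun_prop)
  refine Measurable.indicator (by fun_prop) ?_
  exact ((groundCount d).measurable_coe (hv (measurableSet_singleton 0)))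
    (measurableSet_singleton 0)

/-- Given the positions, the probability of no hit is a product over the points. The exponential of
a sum of logarithms, cut off where `v` vanishes, is a form of this product that is visibly
measurable in the configuration. -/
theorem markedVoid_seqGround {v : Pos d → ℝ≥0∞} (hv : Measurable v) (hv1 : ∀ t, v t ≤ 1)
    {τ : ℕ → Pos d} (hτ : IsLocallyFiniteSeq τ) {I : Finset ℕ} (hI : ∀ i ∉ I, v (τ i) = 1) :
    markedVoid v (seqGround τ) = ∏ i ∈ I, v (τ i) := by
  have hcount : groundCount d (seqGround τ) (v ⁻¹' {0}) = 0 ↔ ∀ i, v (τ i) ≠ 0 := by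
    rw [← lintegral_indicator_one (hv (measurableSet_singleton 0)),
      lintegral_groundCount_seqGround, if_pos hτ]
    simp [ENNReal.tsum_eq_zero]
  by_cases h : ∀ i, v (τ i) ≠ 0
  · rw [markedVoid, Set.indicator_of_mem (by exact hcount.2 h), lintegral_groundCount_seqGround,
      if_pos hτ, tsum_eq_sum (s := I)]
    · have hvt : ∀ i, v (τ i) ≠ ∞ := fun i => ((hv1 _).trans_lt ENNReal.one_lt_top).ne
      have hpos : ∀ i, 0 < (v (τ i)).toReal := fun i => ENNReal.toReal_pos (h i) (hvt i)
      have hlog : ∀ i, 0 ≤ -Real.log (v (τ i)).toReal := fun i =>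
        neg_nonneg.2 (Real.log_nonpos (hpos i).le
          (by simpa using ENNReal.toReal_mono ENNReal.one_ne_top (hv1 (τ i))))
      rw [← ENNReal.ofReal_sum_of_nonneg (fun i _ => hlog i),
        ENNReal.toReal_ofReal (Finset.sum_nonneg fun i _ => hlog i), ← Finset.sum_neg_distrib,
        Real.exp_sum, ENNReal.ofReal_prod_of_nonneg (fun i _ => (Real.exp_pos _).le)]
      refine Finset.prod_congr rfl fun i _ => ?_
      rw [neg_neg, Real.exp_log (hpos i), ENNReal.ofReal_toReal (hvt i)]
    · intro i hi
      simp [hI i hi]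
  · rw [markedVoid, Set.indicator_of_notMem (by exact fun h' => h (hcount.1 h'))]
    push Not at h
    obtain ⟨i, hi⟩ := h
    refine (Finset.prod_eq_zero (i := i) ?_ hi).symm
    by_contra hiI
    rw [hI i hiI] at hi
    exact one_ne_zero hi

/-- Points outside the ball of radius `n` cannot produce an atom in `O`, so only finitely many
independent marks matter. -/
theorem infinitePi_void {m : Measure ℝ} [IsProbabilityMeasure m] {O : Set (Pos d × ℝ)}
    (hO : MeasurableSet O) {n : ℕ} (hn : O ⊆ confExhaustion d n) {τ : ℕ → Pos d}
    (hτ : IsLocallyFiniteSeq τ) :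
    Measure.infinitePi (fun _ : ℕ => m) {a | (seqConf τ a).1.atoms ∩ O = ∅} =
      markedVoid (fun t => m (Prod.mk t ⁻¹' Oᶜ)) (seqGround τ) := by
  have hI : ∀ i ∉ (hτ.2 n).toFinset, Prod.mk (τ i) ⁻¹' Oᶜ = Set.univ := fun i hi => by
    ext s
    simp only [Set.mem_preimage, Set.mem_compl_iff, Set.mem_univ, iff_true]
    intro h
    have := (hn h).1
    simp only [Metric.mem_ball, dist_zero_right] at this
    exact hi (by simpa using this.le)
  rw [markedVoid_seqGround (measurable_measure_prodMk_left hO.compl) (fun t => prob_le_one) hτ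
    (I := (hτ.2 n).toFinset) (fun i hi => by rw [hI i hi, measure_univ]),
    ← Measure.infinitePi_pi (fun _ : ℕ => m)
      (fun i _ => hO.compl.preimage measurable_prodMk_left)]
  congr 1
  ext a
  simp only [Set.mem_ofPred_eq, Set.eq_empty_iff_forall_notMem, Set.mem_inter_iff,
    mem_seqConf hτ, Set.mem_pi, Set.mem_preimage, Set.mem_compl_iff]
  constructor
  · intro h i _ hi
    -- A nonpositive mark produces no atom, but a pair in `O` has a score above `(n + 1)⁻¹`, hence
    -- is an atom.
    have := (hn hi).2
    exact h _ ⟨⟨i, rfl, lt_trans (by positivity) this⟩, hi⟩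
  · rintro h _ ⟨⟨i, rfl, -⟩, hi⟩
    by_cases hiI : i ∈ (hτ.2 n).toFinset
    · exact h i hiI hi
    · have : a i ∈ Prod.mk (τ i) ⁻¹' Oᶜ := by rw [hI i hiI]; trivial
      exact this hi

theorem measurableSet_atoms_inter_eq_empty {B : Set (Pos d × ℝ)} (hB : MeasurableSet B) :
    MeasurableSet {μ : Conf d | μ.atoms ∩ B = ∅} := by
  have : {μ : Conf d | μ.atoms ∩ B = ∅} = (fun μ => (μ.atoms ∩ B).encard) ⁻¹' {0} := by
    ext μ
    simp
  rw [this]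
  exact measurable_encard_atoms hB trivial

theorem markedConf_voidEvents_mem_univ :
    Set.univ ∈ voidEvents (fun μ : MarkedConf d => μ.1.atoms) (confExhaustion d) :=
  univ_mem_voidEvents _ _

/-- The refined Campbell formula transfers from the positions to an independent marking. -/
theorem marked_campbell {μT : Measure (ℕ → Pos d)} [IsProbabilityMeasure μT]
    {m : Measure ℝ} [IsProbabilityMeasure m]
    (hv : ∀ᵐ τ ∂μT, IsLocallyFiniteSeq τ) (h0 : ∀ᵐ τ ∂μT, ∀ i, τ i ≠ 0)
    (hC : ∀ h : Pos d × GroundConf d → ℝ≥0∞, Measurable h →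
      ∫⁻ T, ∫⁻ t, h (t, shiftGround t T) ∂groundCount d T ∂(μT.map seqGround) =
        ∫⁻ t : Pos d, ∫⁻ T, h (t, addOrigin T) ∂(μT.map seqGround))
    {H : Pos d × MarkedConf d → ℝ≥0∞} (hH : Measurable H) :
    ∫⁻ q, ∑' i, H (q.1 i, shiftMarked (q.1 i) (seqConf q.1 q.2))
        ∂(μT.prod (Measure.infinitePi fun _ : ℕ => m)) =
      ∫⁻ t : Pos d, ∫⁻ q, H (t, seqConf (consZero q.1) q.2)
        ∂(μT.prod (Measure.infinitePi fun _ : ℕ => m)) := by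
  set ρ := Measure.infinitePi fun _ : ℕ => m with hρ
  have hf : ∀ i : ℕ, Measurable fun q : (ℕ → Pos d) × (ℕ → ℝ) =>
      (q.1 i, shiftMarked (q.1 i) (seqConf q.1 q.2)) := fun i => by
    have hi : Measurable fun q : (ℕ → Pos d) × (ℕ → ℝ) => q.1 i := by fun_prop
    exact hi.prodMk (measurable_shiftMarked.comp (hi.prodMk measurable_seqConf))
  have hg : Measurable fun q : (ℕ → Pos d) × (ℕ → ℝ) => seqConf (consZero q.1) q.2 :=
    measurable_seqConf.comp ((measurable_consZero.comp measurable_fst).prodMk measurable_snd)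
  have hρp : IsProbabilityMeasure ((μT.prod ρ).map fun q => seqConf (consZero q.1) q.2) :=
    Measure.isProbabilityMeasure_map hg.aemeasurable
  -- The two measures are compared on products of a bounded set with a void event. Integrating out
  -- the marks turns void probabilities into the function `V` of the positions alone, to which the
  -- Campbell formula `hC` for the positions applies.
  have key : (volume : Measure (Pos d)).prod
      ((μT.prod ρ).map fun q => seqConf (consZero q.1) q.2) =
      Measure.sum fun i : ℕ => (μT.prod ρ).map fun q =>
        (q.1 i, shiftMarked (q.1 i) (seqConf q.1 q.2)) := by
    refine Measure.prod_eq_generateFrom generateFrom_boundedSets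
      markedConf_eq_generateFrom.symm isPiSystem_boundedSets
      (isPiSystem_voidEvents monotone_confExhaustion)
      ⟨fun n : ℕ => Metric.ball 0 n, ball_mem_boundedSets, fun n => measure_ball_lt_top,
        Metric.iUnion_ball_nat 0⟩
      ⟨fun _ => Set.univ, fun _ => markedConf_voidEvents_mem_univ,
        fun _ => measure_lt_top _ _, Set.iUnion_const _⟩ ?_
    rintro B hB _ ⟨O, hO, ⟨n, hn⟩, rfl⟩
    have hOm : MeasurableSet {μ : MarkedConf d | μ.1.atoms ∩ O = ∅} := 
      measurable_subtype_coe (measurableSet_atoms_inter_eq_empty hO.measurableSet)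
    have hvm : Measurable fun t : Pos d => m (Prod.mk t ⁻¹' Oᶜ) :=
      measurable_measure_prodMk_left hO.measurableSet.compl
    set V : GroundConf d → ℝ≥0∞ := markedVoid fun t => m (Prod.mk t ⁻¹' Oᶜ) with hV
    have hVm : Measurable V := measurable_markedVoid hvm
    let f : Pos d → ℝ≥0∞ := B.indicator 1
    have hfm : Measurable f := measurable_one.indicator hB.1
    have e1 : ∀ i : ℕ, ((μT.prod ρ).map fun q => (q.1 i, shiftMarked (q.1 i) (seqConf q.1 q.2)))
        (B ×ˢ {μ : MarkedConf d | μ.1.atoms ∩ O = ∅}) =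
        ∫⁻ τ, f (τ i) * V (shiftGround (τ i) (seqGround τ)) ∂μT := fun i => by
      rw [Measure.map_apply (hf i) (hB.1.prod hOm),
        Measure.prod_apply ((hf i) (hB.1.prod hOm))]
      refine lintegral_congr_ae ?_
      filter_upwards [hv] with τ hτ
      by_cases hi : τ i ∈ B
      · have : Prod.mk τ ⁻¹' ((fun q : (ℕ → Pos d) × (ℕ → ℝ) =>
            (q.1 i, shiftMarked (q.1 i) (seqConf q.1 q.2))) ⁻¹'
              (B ×ˢ {μ : MarkedConf d | μ.1.atoms ∩ O = ∅})) =
            {a | (seqConf (fun j => τ j - τ i) a).1.atoms ∩ O = ∅} := by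
          ext a
          simp [hi, shiftMarked_seqConf hτ]
        rw [this, hρ, infinitePi_void hO.measurableSet hn (hτ.sub _), shiftGround_seqGround hτ]
        simp [f, hi, hV]
      · have : Prod.mk τ ⁻¹' ((fun q : (ℕ → Pos d) × (ℕ → ℝ) =>
            (q.1 i, shiftMarked (q.1 i) (seqConf q.1 q.2))) ⁻¹'
              (B ×ˢ {μ : MarkedConf d | μ.1.atoms ∩ O = ∅})) = ∅ := by
          ext a
          simp [hi]
        rw [this]
        simp [f, hi]
    have e2 : ((μT.prod ρ).map fun q => seqConf (consZero q.1) q.2)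
        {μ : MarkedConf d | μ.1.atoms ∩ O = ∅} = ∫⁻ τ, V (addOrigin (seqGround τ)) ∂μT := by
      rw [Measure.map_apply hg hOm, Measure.prod_apply (hg hOm)]
      refine lintegral_congr_ae ?_
      -- No position is at the origin, so prepending it keeps the positions distinct.
      filter_upwards [hv, h0] with τ hτ hτ0
      rw [← seqGround_consZero hτ hτ0, hV, ← infinitePi_void hO.measurableSet hn (hτ.consZero hτ0)]
      rfl
    rw [Measure.sum_apply _ (hB.1.prod hOm), e2]
    simp_rw [e1]
    have hshift : Measurable fun q : Pos d × GroundConf d => f q.1 * V q.2 :=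
      (hfm.comp measurable_fst).mul (hVm.comp measurable_snd)
    have e3 := hC _ hshift
    simp only at e3
    rw [← lintegral_tsum]
    · have hk : Measurable fun T : GroundConf d =>
          ∫⁻ t, f t * V (shiftGround t T) ∂groundCount d T := by
        refine measurable_lintegral_kernel_comp _ measurable_id ?_
        exact (hfm.comp measurable_snd).mul
          (hVm.comp (measurable_shiftGround.comp measurable_swap))
      rw [lintegral_map hk measurable_seqGround] at e3
      have e4 : ∫⁻ τ, ∑' i, f (τ i) * V (shiftGround (τ i) (seqGround τ)) ∂μT =
          ∫⁻ τ, ∫⁻ t, f t * V (shiftGround t (seqGround τ)) ∂groundCount d (seqGround τ) ∂μT := by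
        refine lintegral_congr_ae ?_
        filter_upwards [hv] with τ hτ
        rw [lintegral_groundCount_seqGround, if_pos hτ]
      rw [e4, e3]
      have e5 : ∀ t, ∫⁻ T, f t * V (addOrigin T) ∂(μT.map seqGround) =
          f t * ∫⁻ τ, V (addOrigin (seqGround τ)) ∂μT := fun t => by
        have hVa : Measurable fun T => V (addOrigin T) := hVm.comp measurable_addOrigin
        rw [lintegral_const_mul _ hVa, lintegral_map hVa measurable_seqGround]
      simp_rw [e5]
      rw [lintegral_mul_const _ hfm, lintegral_indicator_one hB.1]
    · intro i
      have hi : Measurable fun τ : ℕ → Pos d => τ i := measurable_pi_apply i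
      exact ((hfm.comp hi).mul (hVm.comp
        (measurable_shiftGround.comp (hi.prodMk measurable_seqGround)))).aemeasurable
  have h1 := congrArg (fun M => ∫⁻ q, H q ∂M) key
  rw [lintegral_sum_measure, lintegral_prod _ hH.aemeasurable] at h1
  simp_rw [fun i => lintegral_map (μ := μT.prod ρ) hH (hf i)] at h1
  have hHf : ∀ i : ℕ, Measurable fun q : (ℕ → Pos d) × (ℕ → ℝ) =>
      H (q.1 i, shiftMarked (q.1 i) (seqConf q.1 q.2)) := fun i => hH.comp (hf i)
  rw [lintegral_tsum fun i => (hHf i).aemeasurable]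
  refine Eq.trans h1.symm (lintegral_congr fun t => ?_)
  rw [lintegral_map (f := fun y => H (t, y)) (hH.comp measurable_prodMk_left) hg]

namespace IsMarkedPoisson

variable {Ω : Type*} [MeasurableSpace Ω] {Pr : Measure Ω} [IsProbabilityMeasure Pr]
  {m : Measure ℝ} {P : Ω → MarkedConf d}

/-- Passes from the abstract probability space to the product of a law of position sequences with
i.i.d. marks, where one can condition on the positions by Fubini. -/
theorem exists_law [IsProbabilityMeasure m] (hP : IsMarkedPoisson Pr m P) :
    ∃ μT : Measure (ℕ → Pos d), IsProbabilityMeasure μT ∧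
      (∀ᵐ τ ∂μT, IsLocallyFiniteSeq τ) ∧
      Pr.map P = (μT.prod (Measure.infinitePi fun _ : ℕ => m)).map (fun q => seqConf q.1 q.2) ∧
      Pr.map (fun ω => proj (P ω)) = μT.map seqGround := by
  obtain ⟨t, ζ, ht, hζ, hatoms, hlaw, hζi, hind⟩ := hP.marks
  have hT : Measurable fun ω i => t i ω := measurable_pi_lambda _ ht
  have hZ : Measurable fun ω i => ζ i ω := measurable_pi_lambda _ hζ
  have hloc : ∀ᵐ ω ∂Pr, IsLocallyFiniteSeq fun i => t i ω := by
    filter_upwards [hatoms] with ω hω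
    refine ⟨hω.1, fun R => ?_⟩
    have hinj : Function.Injective fun i => (t i ω, ζ i ω) := fun i j h =>
      hω.1 (Prod.ext_iff.1 h).1
    refine (((P ω).2 R).preimage hinj.injOn).subset fun i hi => ⟨?_, hi⟩
    rw [hω.2]
    exact ⟨i, rfl⟩
  have hPeq : ∀ᵐ ω ∂Pr, P ω = seqConf (fun i => t i ω) (fun i => ζ i ω) := by
    filter_upwards [hatoms, hloc] with ω hω hτ
    refine Subtype.ext (Conf.ext (Set.ext fun p => ?_))
    rw [mem_seqConf hτ]
    constructor
    · intro hp
      have hp0 := (P ω).1.pos p hp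
      rw [hω.2] at hp
      obtain ⟨i, rfl⟩ := hp
      exact ⟨i, rfl, hp0⟩
    · rintro ⟨i, rfl, -⟩
      rw [hω.2]
      exact ⟨i, rfl⟩
  have hproj : ∀ᵐ ω ∂Pr, proj (P ω) = seqGround (fun i => t i ω) := by
    filter_upwards [hatoms, hloc] with ω hω hτ
    refine GroundConf.ext (Set.ext fun p => ?_)
    rw [mem_seqGround hτ]
    change p ∈ Prod.fst '' (P ω).1.atoms ↔ _
    rw [hω.2, ← Set.range_comp]
    simp [eq_comm]
  have hprod : Pr.map (fun ω => (fun i => t i ω, fun i => ζ i ω)) =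
      (Pr.map fun ω i => t i ω).prod (Measure.infinitePi fun _ : ℕ => m) := by
    rw [(indepFun_iff_map_prod_eq_prod_map_map hT.aemeasurable hZ.aemeasurable).1 hind,
      hζi.map_fun_eq_infinitePi_map hζ]
    simp_rw [hlaw]
  refine ⟨Pr.map fun ω i => t i ω, Measure.isProbabilityMeasure_map hT.aemeasurable, ?_, ?_, ?_⟩
  · rw [ae_map_iff hT.aemeasurable measurableSet_isLocallyFiniteSeq]
    exact hloc
  · rw [← hprod, Measure.map_map measurable_seqConf (hT.prodMk hZ)]
    exact Measure.map_congr hPeq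
  · rw [Measure.map_map measurable_seqGround hT]
    exact Measure.map_congr hproj

end IsMarkedPoisson

/-- A single point has volume zero only in positive dimension; this is where `0 < d` enters. -/
theorem IsUnitPoisson.ae_zero_notMem (hd : 0 < d) {Ω : Type*} [MeasurableSpace Ω] {Pr : Measure Ω}
    [IsProbabilityMeasure Pr] {S : Ω → GroundConf d} (hS : IsUnitPoisson Pr S) :
    ∀ᵐ T ∂(Pr.map S), 0 ∉ T.pts := by
  have : Nonempty (Fin d) := ⟨⟨0, hd⟩⟩
  have hm : MeasurableSet {T : GroundConf d | 0 ∉ T.pts} :=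
    ((measurable_const (a := (0 : Pos d))).prodMk measurable_id measurableSet_mem_pts).compl
  rw [ae_map_iff hS.measurable.aemeasurable hm]
  refine (mem_ae_iff_prob_eq_one (hS.measurable hm)).2 ?_
  have h := hS.void (measurableSet_singleton (0 : Pos d)) (by simp)
  simpa [Measure.real] using h

/-! ### Palm versions -/

theorem lintegral_tsum_atoms_map {β : Type*} [MeasurableSpace β] {μ : Measure β}
    {f : β → MarkedConf d} (hf : Measurable f) {h : Pos d × MarkedConf d → ℝ≥0∞}
    (hh : Measurable h) :
    ∫⁻ ν, ∑' p : ν.1.atoms, h (p.1.1, shiftMarked p.1.1 ν) ∂(μ.map f) =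
      ∫⁻ b, ∫⁻ p, h (p.1, shiftMarked p.1 (f b)) ∂confCount d (f b).1 ∂μ := by
  have h1 : ∀ ν : MarkedConf d, ∑' p : ν.1.atoms, h (p.1.1, shiftMarked p.1.1 ν) =
      ∫⁻ p, h (p.1, shiftMarked p.1 ν) ∂confCount d ν.1 := fun ν =>
    (lintegral_confCount ν.1 (fun p => h (p.1, shiftMarked p.1 ν))).symm
  simp_rw [h1]
  rw [lintegral_map ?_ hf]
  refine measurable_lintegral_kernel_comp _ measurable_subtype_coe ?_
  have hp : Measurable fun x : MarkedConf d × (Pos d × ℝ) => x.2.1 := by fun_prop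
  exact hh.comp (hp.prodMk (measurable_shiftMarked.comp (hp.prodMk measurable_fst)))

/-- The Palm version is unique in distribution. -/
theorem IsPalmVersion.unique {L Lt Lt' : Measure (MarkedConf d)} (h : IsPalmVersion L Lt)
    (h' : IsPalmVersion L Lt') (h0 : intensity L ≠ 0) (h1 : intensity L ≠ ∞) : Lt = Lt' := by
  ext A hA
  have hm : Measurable fun q : Pos d × MarkedConf d =>
      (Metric.ball (0 : Pos d) 1).indicator 1 q.1 * A.indicator (1 : MarkedConf d → ℝ≥0∞) q.2 :=
    ((measurable_one.indicator measurableSet_ball).comp measurable_fst).mul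
      ((measurable_one.indicator hA).comp measurable_snd)
  have e := (h.campbell _ hm).symm.trans (h'.campbell _ hm)
  rw [ENNReal.mul_right_inj h0 h1] at e
  have h2 : ∀ M : Measure (MarkedConf d), ∫⁻ t : Pos d, ∫⁻ μ,
      (Metric.ball (0 : Pos d) 1).indicator 1 t * A.indicator 1 μ ∂M =
      volume (Metric.ball (0 : Pos d) 1) * M A := fun M => by
    simp_rw [lintegral_const_mul _ (measurable_one.indicator hA), lintegral_indicator_one hA]
    rw [lintegral_mul_const _ (measurable_one.indicator measurableSet_ball),
      lintegral_indicator_one measurableSet_ball]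
  simp only [h2] at e
  exact (ENNReal.mul_right_inj (Metric.measure_ball_pos _ _ one_pos).ne'
    measure_ball_lt_top.ne).1 e

/-! ### The scored process: equivariance, intensity and Palm version -/

section Scored

variable {w : Pos d → ℝ} {Φ : Pos d → GroundConf d → GroundConf d}

theorem proj_shiftMarked (z : Pos d) (μ : MarkedConf d) :
    proj (shiftMarked z μ) = shiftGround z (proj μ) := by
  refine GroundConf.ext (Set.ext fun t => ?_)
  constructor
  · rintro ⟨p, hp, rfl⟩
    exact ⟨(p.1 + z, p.2), hp, rfl⟩
  · rintro ⟨p, hp, h⟩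
    refine ⟨(t, p.2), ?_, rfl⟩
    change (t + z, p.2) ∈ μ.1.atoms
    rw [← h]
    exact hp

theorem scoring_shiftMarked (hΦ : IsNeighborhoodRule Φ) (z : Pos d) (μ : MarkedConf d) {t : Pos d}
    (ht : t ∈ (proj μ).pts) :
    scoring w Φ (t - z) (shiftMarked z μ) = scoring w Φ t μ := by
  unfold scoring
  rw [proj_shiftMarked, hΦ.equivariant _ _ _ ht]
  congr 1
  ext r
  constructor
  · rintro ⟨x, hx, rfl⟩
    refine ⟨x + z, hx, ?_⟩
    change w (x + z - t) * score μ.1 (x + z) = w (x - (t - z)) * score μ.1 (x + z)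
    rw [sub_sub_eq_add_sub]
  · rintro ⟨x, hx, rfl⟩
    refine ⟨x - z, ?_, ?_⟩
    · change x - z + z ∈ (Φ t (proj μ)).pts
      rwa [sub_add_cancel]
    · change w (x - z - (t - z)) * score μ.1 (x - z + z) = w (x - t) * score μ.1 x
      rw [sub_add_cancel, sub_sub_sub_cancel_right]

theorem scored_shiftMarked (hΦ : IsNeighborhoodRule Φ) (z : Pos d) (μ : MarkedConf d) :
    scored w Φ (shiftMarked z μ) = shiftMarked z (scored w Φ μ) := by
  refine Subtype.ext (Conf.ext (Set.ext fun p => ?_))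
  change (p.1 ∈ (proj (shiftMarked z μ)).pts ∧ p.2 = scoring w Φ p.1 (shiftMarked z μ) ∧ 0 < p.2) ↔
    (p.1 + z ∈ (proj μ).pts ∧ p.2 = scoring w Φ (p.1 + z) μ ∧ 0 < p.2)
  rw [proj_shiftMarked]
  refine and_congr_right fun h => ?_
  rw [← scoring_shiftMarked hΦ z μ h, add_sub_cancel_right]

theorem bddAbove_scoring (hΦ : IsNeighborhoodRule Φ) {μ : MarkedConf d} {t : Pos d}
    (ht : t ∈ (proj μ).pts) :
    BddAbove ((fun x => w (x - t) * score μ.1 x) '' (Φ t (proj μ)).pts) :=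
  ((hΦ.finite _ t ht).image _).bddAbove

/-- A point is its own neighbor and `w 0 > 0`, so no point loses its atom when only positive scores
are kept. Thus `X` has exactly the positions of the Poisson process. -/
theorem scoring_pos (hΦ : IsNeighborhoodRule Φ) (hw_zero : 0 < w 0) {μ : MarkedConf d} {t : Pos d}
    (ht : t ∈ (proj μ).pts) : 0 < scoring w Φ t μ := by
  refine lt_of_lt_of_le ?_ (le_csSup (bddAbove_scoring hΦ ht) ⟨t, hΦ.self_mem _ _ ht, rfl⟩)
  obtain ⟨p, hp, rfl⟩ := ht
  simp only [sub_self, score_of_mem hp]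
  exact mul_pos hw_zero (μ.1.pos p hp)

theorem lintegral_confCount_scored_eq_proj (hΦ : IsNeighborhoodRule Φ) (hw_zero : 0 < w 0)
    (μ : MarkedConf d) (f : Pos d → ℝ≥0∞) :
    ∫⁻ p, f p.1 ∂confCount d (scored w Φ μ).1 = ∫⁻ t, f t ∂groundCount d (proj μ) := by
  rw [lintegral_confCount_scored, lintegral_groundCount, lintegral_groundCount]
  refine tsum_congr fun t => ?_
  rw [if_pos (scoring_pos hΦ hw_zero t.2)]

theorem volume_unitCube : volume {x : Pos d | ∀ i, x i ∈ Set.Icc (0 : ℝ) 1} = 1 := by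
  have h := (EuclideanSpace.volume_preserving_symm_measurableEquiv_toLp (Fin d)).measure_preimage
    (s := Set.Icc (0 : Fin d → ℝ) 1) measurableSet_Icc.nullMeasurableSet
  rw [Real.volume_Icc_pi] at h
  simp only [Pi.one_apply, Pi.zero_apply, sub_zero, ENNReal.ofReal_one, Finset.prod_const_one] at h
  rw [← h]
  congr 1
  ext x
  simp [Set.mem_Icc, Pi.le_def, forall_and]

theorem measurableSet_unitCube : MeasurableSet {x : Pos d | ∀ i, x i ∈ Set.Icc (0 : ℝ) 1} := by
  have : {x : Pos d | ∀ i, x i ∈ Set.Icc (0 : ℝ) 1} =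
      ⋂ i, (fun x : Pos d => x i) ⁻¹' Set.Icc (0 : ℝ) 1 := by
    ext x
    simp
  rw [this]
  exact MeasurableSet.iInter fun i => measurableSet_Icc.preimage (by fun_prop)

/-- The distribution of the Palm version of the moving maxima process. -/
def palmLaw (w : Pos d → ℝ) (Φ : Pos d → GroundConf d → GroundConf d) (m : Measure ℝ)
    (μT : Measure (ℕ → Pos d)) : Measure (MarkedConf d) :=
  (μT.prod (Measure.infinitePi fun _ : ℕ => m)).map
    fun q => scored w Φ (seqConf (consZero q.1) q.2)

variable {μT : Measure (ℕ → Pos d)} [IsProbabilityMeasure μT] {m : Measure ℝ}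
  [IsProbabilityMeasure m]

theorem intensity_moving_maxima (hw : Measurable w) (hw_nonneg : ∀ x, 0 ≤ w x) (hw_zero : 0 < w 0)
    (hΦ : IsNeighborhoodRule Φ) (hm : ∀ᵐ a ∂(Measure.infinitePi fun _ : ℕ => m), ∀ i, 0 < a i)
    (hC : ∀ h : Pos d × GroundConf d → ℝ≥0∞, Measurable h →
      ∫⁻ T, ∫⁻ t, h (t, shiftGround t T) ∂groundCount d T ∂(μT.map seqGround) =
        ∫⁻ t : Pos d, ∫⁻ T, h (t, addOrigin T) ∂(μT.map seqGround)) :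
    intensity ((μT.prod (Measure.infinitePi fun _ : ℕ => m)).map
      fun q => scored w Φ (seqConf q.1 q.2)) = 1 := by
  set C := {x : Pos d | ∀ i, x i ∈ Set.Icc (0 : ℝ) 1} with hCdef
  have hCm : MeasurableSet C := measurableSet_unitCube
  have hsm : Measurable fun q : (ℕ → Pos d) × (ℕ → ℝ) => scored w Φ (seqConf q.1 q.2) :=
    (measurable_scored hw hw_nonneg hΦ).comp measurable_seqConf
  have h1 : ∀ μ : MarkedConf d, (({p | p ∈ μ.1.atoms ∧ ∀ i, p.1 i ∈ Set.Icc (0 : ℝ) 1}.encard :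
      ℕ∞) : ℝ≥0∞) = confCount d μ.1 (Prod.fst ⁻¹' C) := fun μ => by
    rw [confCount_apply' _ (measurable_fst hCm)]
    rfl
  unfold intensity
  simp_rw [h1]
  have hcm : Measurable fun μ : MarkedConf d => confCount d μ.1 (Prod.fst ⁻¹' C) :=
    ((confCount d).measurable_coe (measurable_fst hCm)).comp measurable_subtype_coe
  have hcg : Measurable fun T : GroundConf d => groundCount d T C :=
    (groundCount d).measurable_coe hCm
  rw [lintegral_map hcm hsm]
  have h2 : ∀ μ : MarkedConf d, confCount d (scored w Φ μ).1 (Prod.fst ⁻¹' C) =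
      groundCount d (proj μ) C := fun μ => by
    rw [← lintegral_indicator_one (measurable_fst hCm), ← lintegral_indicator_one hCm,
      ← lintegral_confCount_scored_eq_proj hΦ hw_zero]
    rfl
  simp_rw [h2]
  rw [lintegral_prod (fun q : (ℕ → Pos d) × (ℕ → ℝ) => groundCount d (proj (seqConf q.1 q.2)) C)
    (hcg.comp (measurable_proj.comp measurable_seqConf)).aemeasurable]
  have h3 : ∀ τ : ℕ → Pos d, ∫⁻ a, groundCount d (proj (seqConf τ a)) C
      ∂(Measure.infinitePi fun _ : ℕ => m) = groundCount d (seqGround τ) C := fun τ => by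
    rw [lintegral_congr_ae (g := fun _ => groundCount d (seqGround τ) C)]
    · simp
    · filter_upwards [hm] with a ha
      rw [proj_seqConf ha]
  simp_rw [h3]
  rw [← lintegral_map hcg measurable_seqGround]
  have h4 := hC (fun q => C.indicator 1 q.1) ((measurable_one.indicator hCm).comp measurable_fst)
  have := Measure.isProbabilityMeasure_map (μ := μT) measurable_seqGround.aemeasurable
  simp only [lintegral_indicator_one hCm, lintegral_const, measure_univ, mul_one] at h4
  rw [h4, volume_unitCube]

/-- Scoring commutes with shifts, so `marked_campbell`, applied to `h` composed with the scoring
map, is the Campbell formula of the scored process. -/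
theorem isPalmVersion_palmLaw (hw : Measurable w) (hw_nonneg : ∀ x, 0 ≤ w x) (hw_zero : 0 < w 0)
    (hΦ : IsNeighborhoodRule Φ) (hm : ∀ᵐ a ∂(Measure.infinitePi fun _ : ℕ => m), ∀ i, 0 < a i)
    (hv : ∀ᵐ τ ∂μT, IsLocallyFiniteSeq τ) (h0 : ∀ᵐ τ ∂μT, ∀ i, τ i ≠ 0)
    (hC : ∀ h : Pos d × GroundConf d → ℝ≥0∞, Measurable h →
      ∫⁻ T, ∫⁻ t, h (t, shiftGround t T) ∂groundCount d T ∂(μT.map seqGround) =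
        ∫⁻ t : Pos d, ∫⁻ T, h (t, addOrigin T) ∂(μT.map seqGround)) :
    IsPalmVersion ((μT.prod (Measure.infinitePi fun _ : ℕ => m)).map
      fun q => scored w Φ (seqConf q.1 q.2)) (palmLaw w Φ m μT) := by
  have hs := measurable_scored hw hw_nonneg hΦ
  have hsm : Measurable fun q : (ℕ → Pos d) × (ℕ → ℝ) => scored w Φ (seqConf q.1 q.2) :=
    hs.comp measurable_seqConf
  have hsm0 : Measurable fun q : (ℕ → Pos d) × (ℕ → ℝ) =>
      scored w Φ (seqConf (consZero q.1) q.2) :=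
    hs.comp (measurable_seqConf.comp ((measurable_consZero.comp measurable_fst).prodMk
      measurable_snd))
  refine ⟨Measure.isProbabilityMeasure_map hsm0.aemeasurable, fun h hh => ?_⟩
  rw [intensity_moving_maxima hw hw_nonneg hw_zero hΦ hm hC, one_mul,
    lintegral_tsum_atoms_map hsm hh]
  have hH : Measurable fun q : Pos d × MarkedConf d => h (q.1, scored w Φ q.2) :=
    hh.comp (measurable_fst.prodMk (hs.comp measurable_snd))
  have e1 : ∀ t : Pos d, ∫⁻ μ, h (t, μ) ∂(palmLaw w Φ m μT) =
      ∫⁻ q, h (t, scored w Φ (seqConf (consZero q.1) q.2))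
        ∂(μT.prod (Measure.infinitePi fun _ : ℕ => m)) := fun t =>
    lintegral_map (f := fun μ => h (t, μ)) (hh.comp measurable_prodMk_left) hsm0
  simp_rw [e1]
  rw [← marked_campbell hv h0 hC hH]
  refine lintegral_congr_ae ?_
  have hv' : ∀ᵐ q ∂(μT.prod (Measure.infinitePi fun _ : ℕ => m)), IsLocallyFiniteSeq q.1 :=
    Measure.quasiMeasurePreserving_fst.ae hv
  have hm' : ∀ᵐ q ∂(μT.prod (Measure.infinitePi fun _ : ℕ => m)), ∀ i, 0 < q.2 i :=
    Measure.quasiMeasurePreserving_snd.ae hm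
  filter_upwards [hv', hm'] with q hq hq'
  rw [lintegral_confCount_scored_eq_proj hΦ hw_zero _
    (fun t => h (t, shiftMarked t (scored w Φ (seqConf q.1 q.2)))), proj_seqConf hq',
    lintegral_groundCount_seqGround, if_pos hq]
  simp_rw [scored_shiftMarked hΦ]

end Scored

/-! ### Regularly varying tails -/

section Tail

variable {m : Measure ℝ} [IsProbabilityMeasure m]

theorem real_Ioi_eq_one_sub_cdf (u : ℝ) : m.real (Set.Ioi u) = 1 - cdf m u := by
  rw [cdf_eq_real, ← Set.compl_Iic, probReal_compl_eq_one_sub measurableSet_Iic]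

theorem antitone_real_Ioi : Antitone fun u => m.real (Set.Ioi u) := fun _ _ h =>
  measureReal_mono (Set.Ioi_subset_Ioi h)

theorem tendsto_real_Ioi_atTop : Tendsto (fun u => m.real (Set.Ioi u)) atTop (𝓝 0) := by
  simp_rw [real_Ioi_eq_one_sub_cdf]
  simpa using (tendsto_cdf_atTop m).const_sub 1

theorem IsRegularlyVaryingTail.pos {α : ℝ} (h : IsRegularlyVaryingTail m α) (u : ℝ) :
    0 < m.real (Set.Ioi u) := by
  have h1 := h 1 one_pos
  simp only [mul_one, Real.one_rpow] at h1
  have h2 : ∀ᶠ v in atTop, 0 < m.real (Set.Ioi v) := by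
    -- If the tail vanished at `v`, the ratio would be `0 / 0 = 0` instead of being near `1`.
    -- Positivity far out gives positivity everywhere by monotonicity.
    filter_upwards [h1.eventually_ne one_ne_zero] with v hv
    refine lt_of_le_of_ne measureReal_nonneg fun h0 => hv ?_
    rw [← h0]
    simp
  obtain ⟨v, hv, huv⟩ := (h2.and (eventually_ge_atTop u)).exists
  exact hv.trans_le (antitone_real_Ioi huv)

/-- The quantile function of the law of `ζ / u` given `ζ > u`, for `ζ` with law `m`, reversed:
a uniform random variable is mapped to this law. -/
def tailQuantile (m : Measure ℝ) (u s : ℝ) : ℝ :=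
  (Set.Ioo (0 : ℝ) 1).indicator
    (fun s => sInf {y | m.real (Set.Ioi (u * y)) ≤ s * m.real (Set.Ioi u)}) s

theorem tailQuantile_le_iff {u s y : ℝ} (hu : 0 < u) (h0 : 0 < m.real (Set.Ioi u))
    (hs : s ∈ Set.Ioo (0 : ℝ) 1) :
    tailQuantile m u s ≤ y ↔ m.real (Set.Ioi (u * y)) ≤ s * m.real (Set.Ioi u) := by
  rw [tailQuantile, Set.indicator_of_mem hs]
  set E := {y | m.real (Set.Ioi (u * y)) ≤ s * m.real (Set.Ioi u)} with hE
  have hup : ∀ {x z}, x ∈ E → x ≤ z → z ∈ E := fun {x z} hx hxz =>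
    (antitone_real_Ioi (by gcongr : u * x ≤ u * z)).trans hx
  have hne : E.Nonempty := by
    have h1 : Tendsto (fun y => m.real (Set.Ioi (u * y))) atTop (𝓝 0) :=
      tendsto_real_Ioi_atTop.comp (tendsto_id.const_mul_atTop hu)
    obtain ⟨y, hy⟩ := (h1.eventually_lt_const (mul_pos hs.1 h0)).exists
    exact ⟨y, hy.le⟩
  -- For `y < 1` the tail at `u * y` is at least the tail at `u`, which exceeds `s` times itself
  -- because `s < 1`.
  have hbdd : BddBelow E := by
    refine ⟨1, fun y hy => ?_⟩
    by_contra h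
    have h1 : m.real (Set.Ioi u) ≤ m.real (Set.Ioi (u * y)) :=
      antitone_real_Ioi (by nlinarith [not_le.1 h])
    have h2 : m.real (Set.Ioi (u * y)) ≤ s * m.real (Set.Ioi u) := hy
    nlinarith [hs.2]
  -- Right continuity of the distribution function shows that the infimum is attained.
  have hmem : sInf E ∈ E := by
    have h1 : Tendsto (fun y => m.real (Set.Ioi (u * y))) (𝓝[>] sInf E)
        (𝓝 (m.real (Set.Ioi (u * sInf E)))) := by
      simp_rw [real_Ioi_eq_one_sub_cdf]
      refine Tendsto.const_sub 1 ?_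
      refine ((cdf m).right_continuous (u * sInf E)).tendsto.comp ?_
      refine tendsto_nhdsWithin_iff.2 ⟨?_, ?_⟩
      · exact ((continuous_const.mul continuous_id).tendsto _).mono_left nhdsWithin_le_nhds
      · filter_upwards [self_mem_nhdsWithin] with y hy
        exact mul_le_mul_of_nonneg_left (le_of_lt hy) hu.le
    refine le_of_tendsto h1 ?_
    filter_upwards [self_mem_nhdsWithin] with y hy
    obtain ⟨e, he, hey⟩ := exists_lt_of_csInf_lt hne hy
    exact hup he hey.le
  exact ⟨fun h => hup hmem h, fun h => csInf_le hbdd h⟩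

theorem measurable_tailQuantile {u : ℝ} (hu : 0 < u) (h0 : 0 < m.real (Set.Ioi u)) :
    Measurable (tailQuantile m u) := by
  refine measurable_of_Iic fun y => ?_
  have : tailQuantile m u ⁻¹' Set.Iic y =
      (Set.Ioo 0 1 ∩ {s | m.real (Set.Ioi (u * y)) ≤ s * m.real (Set.Ioi u)}) ∪
        ((Set.Ioo 0 1)ᶜ ∩ {_s | 0 ≤ y}) := by
    ext s
    by_cases hs : s ∈ Set.Ioo (0 : ℝ) 1
    · simp [hs, tailQuantile_le_iff hu h0 hs]
    · simp [hs, tailQuantile]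
  rw [this]
  refine (measurableSet_Ioo.inter (measurableSet_le measurable_const (by fun_prop))).union
    (measurableSet_Ioo.compl.inter (MeasurableSet.const _))

/-- Realizes the exceedance laws for all `u` as functions of one uniform variable. Weak convergence
then becomes pointwise convergence of quantiles, suited to dominated convergence. -/
theorem map_restrict_Ioi_eq {u : ℝ} (hu : 0 < u) (h0 : 0 < m.real (Set.Ioi u)) :
    (m.restrict (Set.Ioi u)).map (fun x => x / u) = m (Set.Ioi u) •
      (volume.restrict (Set.Ioo (0 : ℝ) 1)).map (tailQuantile m u) := by
  have hq := measurable_tailQuantile hu h0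
  have hd : Measurable fun x : ℝ => x / u := by fun_prop
  have : IsFiniteMeasure ((m.restrict (Set.Ioi u)).map (fun x => x / u)) := inferInstance
  refine Measure.ext_of_Iic _ _ fun y => ?_
  have hV : m (Set.Ioi u) = ENNReal.ofReal (m.real (Set.Ioi u)) :=
    (ofReal_measureReal (measure_ne_top _ _)).symm
  rw [Measure.smul_apply, Measure.map_apply hd measurableSet_Iic,
    Measure.map_apply hq measurableSet_Iic,
    Measure.restrict_apply (hd measurableSet_Iic), Measure.restrict_apply (hq measurableSet_Iic)]
  have e1 : (fun x => x / u) ⁻¹' Set.Iic y ∩ Set.Ioi u = Set.Ioi u \ Set.Ioi (u * y) := by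
    ext x
    simp only [Set.mem_inter_iff, Set.mem_preimage, Set.mem_Iic, Set.mem_Ioi, Set.mem_sdiff,
      not_lt, div_le_iff₀ hu, mul_comm y u]
    tauto
  have e2 : tailQuantile m u ⁻¹' Set.Iic y ∩ Set.Ioo (0 : ℝ) 1 =
      Set.Ioo 0 1 ∩ Set.Ici (m.real (Set.Ioi (u * y)) / m.real (Set.Ioi u)) := by
    ext s
    simp only [Set.mem_inter_iff, Set.mem_preimage, Set.mem_Iic, Set.mem_Ici, div_le_iff₀ h0]
    constructor
    · rintro ⟨h1, h2⟩
      exact ⟨h2, (tailQuantile_le_iff hu h0 h2).1 h1⟩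
    · rintro ⟨h1, h2⟩
      exact ⟨(tailQuantile_le_iff hu h0 h1).2 h2, h1⟩
  rw [e1, e2]
  rcases le_or_gt 1 y with hy | hy
  · have hsub : Set.Ioi (u * y) ⊆ Set.Ioi u := Set.Ioi_subset_Ioi (by nlinarith)
    rw [measure_sdiff hsub measurableSet_Ioi.nullMeasurableSet (measure_ne_top _ _)]
    have hr0 : 0 ≤ m.real (Set.Ioi (u * y)) / m.real (Set.Ioi u) := by positivity
    have e3 : volume (Set.Ioo (0 : ℝ) 1 ∩
        Set.Ici (m.real (Set.Ioi (u * y)) / m.real (Set.Ioi u))) =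
        ENNReal.ofReal (1 - m.real (Set.Ioi (u * y)) / m.real (Set.Ioi u)) := by
      have e4 : Set.Ico (0 : ℝ) 1 ∩ Set.Ici (m.real (Set.Ioi (u * y)) / m.real (Set.Ioi u)) =
          Set.Ico (m.real (Set.Ioi (u * y)) / m.real (Set.Ioi u)) 1 := by
        ext s
        simp only [Set.mem_inter_iff, Set.mem_Ico, Set.mem_Ici]
        exact ⟨fun h => ⟨h.2, h.1.2⟩, fun h => ⟨⟨hr0.trans h.1, h.2⟩, h.1⟩⟩
      rw [← Real.volume_Ico, ← e4]
      exact measure_congr (Ioo_ae_eq_Ico.inter (ae_eq_refl _))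
    rw [e3, hV, ← ofReal_measureReal (μ := m) (s := Set.Ioi (u * y)) (measure_ne_top _ _),
      smul_eq_mul, ← ENNReal.ofReal_mul h0.le, ← ENNReal.ofReal_sub _ measureReal_nonneg]
    congr 1
    field_simp
  · have hsub : Set.Ioi u ⊆ Set.Ioi (u * y) := Set.Ioi_subset_Ioi (by nlinarith)
    have h1 : 1 ≤ m.real (Set.Ioi (u * y)) / m.real (Set.Ioi u) :=
      (one_le_div h0).2 (measureReal_mono hsub)
    have e3 : Set.Ioo (0 : ℝ) 1 ∩
        Set.Ici (m.real (Set.Ioi (u * y)) / m.real (Set.Ioi u)) = ∅ := by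
      ext s
      simp only [Set.mem_inter_iff, Set.mem_Ioo, Set.mem_Ici, Set.mem_empty_iff_false, iff_false]
      rintro ⟨h2, h3⟩
      linarith [h2.2]
    rw [e3, Set.sdiff_eq_empty.2 hsub]
    simp

/-- The limiting tail `y ^ (-α)` is strictly decreasing with inverse `s ^ (-α⁻¹)`, so convergence of
the tails at levels around the limit traps the quantile. -/
theorem IsRegularlyVaryingTail.tendsto_tailQuantile {α : ℝ} (hα : 0 < α)
    (h : IsRegularlyVaryingTail m α) {s : ℝ} (hs : s ∈ Set.Ioo (0 : ℝ) 1) :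
    Tendsto (fun u => tailQuantile m u s) atTop (𝓝 (s ^ (-α⁻¹))) := by
  have hpow : ∀ y : ℝ, 0 < y → (y ^ (-α) < s ↔ s ^ (-α⁻¹) < y) := fun y hy => by
    constructor
    · intro h1
      have := Real.rpow_lt_rpow_of_neg (by positivity) h1 (by simpa : -α⁻¹ < 0)
      rwa [← Real.rpow_mul hy.le, neg_mul_neg, mul_inv_cancel₀ hα.ne', Real.rpow_one] at this
    · intro h1
      have := Real.rpow_lt_rpow_of_neg (Real.rpow_pos_of_pos hs.1 _) h1 (by simpa : -α < 0)
      rwa [← Real.rpow_mul hs.1.le, neg_mul_neg, inv_mul_cancel₀ hα.ne', Real.rpow_one] at this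
  have hpow' : ∀ y : ℝ, 0 < y → (s < y ^ (-α) ↔ y < s ^ (-α⁻¹)) := fun y hy => by
    constructor
    · intro h1
      have := Real.rpow_lt_rpow_of_neg hs.1 h1 (by simpa : -α⁻¹ < 0)
      rwa [← Real.rpow_mul hy.le, neg_mul_neg, mul_inv_cancel₀ hα.ne', Real.rpow_one] at this
    · intro h1
      have := Real.rpow_lt_rpow_of_neg hy h1 (by simpa : -α < 0)
      rwa [← Real.rpow_mul hs.1.le, neg_mul_neg, inv_mul_cancel₀ hα.ne', Real.rpow_one] at this
  have hs0 : 0 < s ^ (-α⁻¹) := Real.rpow_pos_of_pos hs.1 _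
  refine tendsto_order.2 ⟨fun y hy => ?_, fun y hy => ?_⟩
  -- Regular variation is available only at positive levels, so `y` is raised to a positive level
  -- that is still below the limit.
  · have hz : max y (s ^ (-α⁻¹) / 2) < s ^ (-α⁻¹) := max_lt hy (by linarith)
    have hz0 : 0 < max y (s ^ (-α⁻¹) / 2) := lt_max_of_lt_right (by linarith)
    filter_upwards [(h _ hz0).eventually_const_lt ((hpow' _ hz0).2 hz), eventually_gt_atTop 0]
      with u hu hu0
    refine (le_max_left y (s ^ (-α⁻¹) / 2)).trans_lt (lt_of_not_ge fun hle => ?_)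
    rw [tailQuantile_le_iff hu0 (h.pos u) hs, ← div_le_iff₀ (h.pos u)] at hle
    exact absurd hle hu.not_ge
  · obtain ⟨z, hz, hzy⟩ := exists_between hy
    have hz0 : 0 < z := hs0.trans hz
    filter_upwards [(h _ hz0).eventually_lt_const ((hpow _ hz0).2 hz), eventually_gt_atTop 0]
      with u hu hu0
    refine lt_of_le_of_lt ?_ hzy
    rw [tailQuantile_le_iff hu0 (h.pos u) hs, ← div_le_iff₀ (h.pos u)]
    exact hu.le

end Tail

/-! ### The principle of a single big jump -/

section SingleBigJump

variable {m : Measure ℝ} [IsProbabilityMeasure m]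

/-- Replacing the `j`-th mark by an independent copy does not change the law. This isolates the
large mark from the others. -/
theorem map_update_infinitePi (j : ℕ) :
    (m.prod (Measure.infinitePi fun _ : ℕ => m)).map
      (fun q : ℝ × (ℕ → ℝ) => Function.update q.2 j q.1) = Measure.infinitePi fun _ : ℕ => m := by
  have hu : Measurable fun q : ℝ × (ℕ → ℝ) => Function.update q.2 j q.1 := by
    refine measurable_pi_lambda _ fun i => ?_
    by_cases h : i = j
    · subst h
      simpa using measurable_fst
    · simp only [Function.update_of_ne h]
      fun_prop
  refine Measure.eq_infinitePi _ fun s t ht => ?_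
  rw [Measure.map_apply hu (MeasurableSet.pi s.countable_toSet fun i _ => ht i)]
  by_cases hj : j ∈ s
  · have : (fun q : ℝ × (ℕ → ℝ) => Function.update q.2 j q.1) ⁻¹' (Set.pi s t) =
        t j ×ˢ Set.pi (s.erase j : Finset ℕ) t := by
      ext ⟨z, a⟩
      simp only [Set.mem_preimage, Set.mem_pi, Set.mem_prod, Finset.mem_coe, Finset.mem_erase]
      constructor
      · intro h
        refine ⟨by simpa using h j hj, fun i hi => ?_⟩
        simpa [Function.update_of_ne hi.1] using h i hi.2
      · rintro ⟨h1, h2⟩ i hi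
        by_cases hij : i = j
        · subst hij
          simpa using h1
        · simpa [Function.update_of_ne hij] using h2 i ⟨hij, hi⟩
    rw [this, Measure.prod_prod, Measure.infinitePi_pi _ (fun i _ => ht i),
      Finset.mul_prod_erase s (fun i => m (t i)) hj]
  · have : (fun q : ℝ × (ℕ → ℝ) => Function.update q.2 j q.1) ⁻¹' (Set.pi s t) =
        Set.univ ×ˢ Set.pi s t := by
      ext ⟨z, a⟩
      simp only [Set.mem_preimage, Set.mem_pi, Set.mem_prod, Finset.mem_coe, Set.mem_univ,
        true_and]
      refine forall₂_congr fun i hi => ?_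
      rw [Function.update_of_ne (by rintro rfl; exact hj hi)]
    rw [this, Measure.prod_prod, Measure.infinitePi_pi _ (fun i _ => ht i)]
    simp

theorem measurableSet_lt_const_mul (j : ℕ) (c u : ℝ) :
    MeasurableSet {a : ℕ → ℝ | u < c * a j} :=
  measurableSet_lt measurable_const (by fun_prop)

theorem infinitePi_real_lt (j : ℕ) {c : ℝ} (hc : 0 < c) (u : ℝ) :
    (Measure.infinitePi fun _ : ℕ => m).real {a | u < c * a j} = m.real (Set.Ioi (u / c)) := by
  have h := Measure.infinitePi_pi (fun _ : ℕ => m) (s := {j}) (t := fun _ => Set.Ioi (u / c))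
    (fun _ _ => measurableSet_Ioi)
  rw [Measure.real, Measure.real]
  congr 1
  rw [Finset.prod_singleton] at h
  rw [← h]
  congr 1
  ext a
  simp [div_lt_iff₀ hc, mul_comm]

theorem infinitePi_real_lt_inter {i j : ℕ} (hij : i ≠ j) {b c : ℝ} (hb : 0 < b) (hc : 0 < c)
    (u : ℝ) :
    (Measure.infinitePi fun _ : ℕ => m).real ({a | u < b * a i} ∩ {a | u < c * a j}) =
      m.real (Set.Ioi (u / b)) * m.real (Set.Ioi (u / c)) := by
  have h := Measure.infinitePi_pi (fun _ : ℕ => m) (s := {i, j})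
    (t := fun k => if k = i then Set.Ioi (u / b) else Set.Ioi (u / c))
    (fun k _ => by split_ifs <;> exact measurableSet_Ioi)
  rw [Measure.real, Measure.real, Measure.real, ← ENNReal.toReal_mul]
  congr 1
  rw [Finset.prod_pair hij] at h
  simp only [if_true, hij.symm, if_false] at h
  rw [← h]
  congr 1
  ext a
  simp [div_lt_iff₀ hb, div_lt_iff₀ hc, mul_comm, hij.symm]

/-- After isolating the `j`-th mark, its law on `a j > u / c` is the tail mass times the law of a
quantile. The final division by `c` appears because the rescaling is by `u` and not by the threshold
`u / c`. -/
theorem setIntegral_single_jump (j : ℕ) {c u : ℝ} (hc : 0 < c) (hu : 0 < u)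
    (h0 : 0 < m.real (Set.Ioi (u / c))) {g : (ℕ → ℝ) → ℝ} (hg : Measurable g) :
    ∫ a in {a : ℕ → ℝ | u < c * a j}, g (u⁻¹ • a) ∂(Measure.infinitePi fun _ : ℕ => m) =
      m.real (Set.Ioi (u / c)) *
        ∫ q, g (Function.update (u⁻¹ • q.2) j (tailQuantile m (u / c) q.1 / c))
          ∂((volume.restrict (Set.Ioo (0 : ℝ) 1)).prod (Measure.infinitePi fun _ : ℕ => m)) := by
  set ρ := Measure.infinitePi fun _ : ℕ => m with hρ
  have hup : ∀ {f : ℝ → ℝ}, Measurable f →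
      Measurable fun q : ℝ × (ℕ → ℝ) => Function.update q.2 j (f q.1) := fun {f} hf => by
    refine measurable_pi_lambda _ fun i => ?_
    by_cases h : i = j
    · subst h
      simpa [Function.comp_def] using hf.comp measurable_fst
    · simp only [Function.update_of_ne h]
      fun_prop
  have hA := measurableSet_lt_const_mul j c u
  have hpos : 0 < u / c := by positivity
  have e1 : ρ.restrict {a | u < c * a j} = ((m.restrict (Set.Ioi (u / c))).prod ρ).map
      fun q : ℝ × (ℕ → ℝ) => Function.update q.2 j q.1 := by
    have hup' := hup measurable_id
    simp only [id] at hup'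
    conv_lhs => rw [hρ, ← map_update_infinitePi j]
    rw [Measure.restrict_map hup' hA]
    congr 1
    have : (fun q : ℝ × (ℕ → ℝ) => Function.update q.2 j q.1) ⁻¹' {a | u < c * a j} =
        Set.Ioi (u / c) ×ˢ Set.univ := by
      ext q
      simp [div_lt_iff₀ hc, mul_comm]
    rw [this, ← Measure.prod_restrict, Measure.restrict_univ]
  have hq := measurable_tailQuantile hpos h0
  have e2 : ((m.restrict (Set.Ioi (u / c))).prod ρ).map (Prod.map (fun x => x / (u / c)) id) =
      m (Set.Ioi (u / c)) • ((volume.restrict (Set.Ioo (0 : ℝ) 1)).prod ρ).map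
        (Prod.map (tailQuantile m (u / c)) id) := by
    rw [← Measure.map_prod_map _ _ (by fun_prop) measurable_id,
      ← Measure.map_prod_map _ _ hq measurable_id, map_restrict_Ioi_eq hpos h0,
      Measure.prod_smul_left]
  let φ : ℝ × (ℕ → ℝ) → ℝ := fun q => g (Function.update (u⁻¹ • q.2) j (q.1 / c))
  have hφ : Measurable φ := by
    have h1 : Measurable fun q : ℝ × (ℕ → ℝ) => (q.1, u⁻¹ • q.2) := by fun_prop
    exact hg.comp ((hup (f := fun x => x / c) (by fun_prop)).comp h1)
  have e3 := congrArg (fun M => ∫ q, φ q ∂M) e2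
  rw [integral_map (by fun_prop) hφ.aestronglyMeasurable, integral_smul_measure,
    integral_map (hq.prodMap measurable_id).aemeasurable hφ.aestronglyMeasurable] at e3
  have hup' : Measurable fun q : ℝ × (ℕ → ℝ) => Function.update q.2 j q.1 := hup measurable_id
  have hgu : Measurable fun a : ℕ → ℝ => g (u⁻¹ • a) := hg.comp (measurable_const_smul u⁻¹)
  rw [e1, integral_map hup'.aemeasurable hgu.aestronglyMeasurable]
  refine Eq.trans (integral_congr_ae (ae_of_all _ fun q => ?_)) e3
  simp only [φ, Prod.map_fst, Prod.map_snd, id]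
  congr 1
  ext i
  by_cases h : i = j
  · subst h
    simp
    field_simp
  · simp [Function.update_of_ne h]

/-- Regular variation sends the ratio of the tails at `u / c` and at `u` to `c ^ α`. The rescaled
large mark converges to `s ^ (-α⁻¹) / c`, and every other coordinate is divided by `u` and vanishes.
-/
theorem tendsto_single_jump {α : ℝ} (hα : 0 < α) (hreg : IsRegularlyVaryingTail m α) (j : ℕ)
    {c : ℝ} (hc : 0 ≤ c) {g : (ℕ → ℝ) → ℝ} (hg : Continuous g) {K : ℝ} (hK : ∀ a, |g a| ≤ K) :
    Tendsto (fun u => (m.real (Set.Ioi u))⁻¹ *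
        ∫ a in {a : ℕ → ℝ | u < c * a j}, g (u⁻¹ • a) ∂(Measure.infinitePi fun _ : ℕ => m)) atTop
      (𝓝 (c ^ α * ∫ s in Set.Ioo (0 : ℝ) 1, g (Pi.single j (s ^ (-α⁻¹) / c)))) := by
  rcases hc.eq_or_lt with rfl | hc
  -- A neighbor of weight zero never causes an exceedance; the factor `0 ^ α = 0` makes the division
  -- by `c = 0` in the limit harmless.
  · rw [Real.zero_rpow hα.ne', zero_mul]
    refine tendsto_const_nhds.congr' ?_
    filter_upwards [eventually_ge_atTop 0] with u hu
    have : {a : ℕ → ℝ | u < 0 * a j} = ∅ := by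
      ext a
      simp [hu]
    rw [this]
    simp
  set ρ := Measure.infinitePi fun _ : ℕ => m with hρ
  have h1 : Tendsto (fun u => (m.real (Set.Ioi u))⁻¹ * m.real (Set.Ioi (u / c))) atTop
      (𝓝 (c ^ α)) := by
    have := hreg c⁻¹ (inv_pos.2 hc)
    rw [Real.inv_rpow hc.le, Real.rpow_neg hc.le, inv_inv] at this
    refine this.congr fun u => ?_
    rw [div_eq_mul_inv u c, div_eq_inv_mul]
  have hdiv : Tendsto (fun u : ℝ => u / c) atTop atTop := tendsto_id.atTop_div_const hc
  have h2 : Tendsto (fun u => ∫ q, g (Function.update (u⁻¹ • q.2) j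
      (tailQuantile m (u / c) q.1 / c)) ∂((volume.restrict (Set.Ioo (0 : ℝ) 1)).prod ρ)) atTop
      (𝓝 (∫ q : ℝ × (ℕ → ℝ), g (Pi.single j (q.1 ^ (-α⁻¹) / c))
        ∂((volume.restrict (Set.Ioo (0 : ℝ) 1)).prod ρ))) := by
    refine tendsto_integral_filter_of_dominated_convergence (fun _ => K) ?_ ?_ ?_ ?_
    · filter_upwards [eventually_gt_atTop 0] with u hu
      have hpos : 0 < u / c := by positivity
      have hq := measurable_tailQuantile hpos (hreg.pos (u / c))
      refine (hg.measurable.comp ?_).aestronglyMeasurable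
      refine measurable_pi_lambda _ fun i => ?_
      by_cases h : i = j
      · subst h
        simpa [Function.comp_def] using (hq.comp measurable_fst).div_const c
      · simp only [Function.update_of_ne h]
        fun_prop
    · exact Eventually.of_forall fun u => ae_of_all _ fun q => hK _
    · exact integrable_const _
    · have hae : ∀ᵐ q ∂((volume.restrict (Set.Ioo (0 : ℝ) 1)).prod ρ), q.1 ∈ Set.Ioo (0 : ℝ) 1 :=
        Measure.quasiMeasurePreserving_fst.ae (ae_restrict_mem measurableSet_Ioo)
      filter_upwards [hae] with q hq
      refine (hg.tendsto _).comp (tendsto_pi_nhds.2 fun i => ?_)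
      by_cases h : i = j
      · subst h
        simpa using ((hreg.tendsto_tailQuantile hα hq).comp hdiv).div_const c
      · simp only [Function.update_of_ne h, Pi.single_eq_of_ne h, Pi.smul_apply, smul_eq_mul]
        simpa using tendsto_inv_atTop_zero.mul_const (q.2 i)
  have h3 : ∫ q : ℝ × (ℕ → ℝ), g (Pi.single j (q.1 ^ (-α⁻¹) / c))
      ∂((volume.restrict (Set.Ioo (0 : ℝ) 1)).prod ρ) =
      ∫ s in Set.Ioo (0 : ℝ) 1, g (Pi.single j (s ^ (-α⁻¹) / c)) := by
    rw [integral_fun_fst (μ := volume.restrict (Set.Ioo (0 : ℝ) 1)) (ν := ρ)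
      (fun s : ℝ => g (Pi.single j (s ^ (-α⁻¹) / c)))]
    simp
  rw [h3] at h2
  refine (h1.mul h2).congr' ?_
  filter_upwards [eventually_gt_atTop 0] with u hu
  rw [setIntegral_single_jump j hc hu (hreg.pos _) hg.measurable]
  ring

/-- By independence the probability is a product of two tails. One is comparable to the
normalization and the other tends to zero. -/
theorem tendsto_inv_mul_real_inter {α : ℝ} (hreg : IsRegularlyVaryingTail m α) {i j : ℕ}
    (hij : i ≠ j) {b c : ℝ} (hb : 0 ≤ b) (hc : 0 ≤ c) :
    Tendsto (fun u => (m.real (Set.Ioi u))⁻¹ * (Measure.infinitePi fun _ : ℕ => m).real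
      ({a | u < b * a i} ∩ {a | u < c * a j})) atTop (𝓝 0) := by
  rcases hb.eq_or_lt with rfl | hb
  · refine tendsto_const_nhds.congr' ?_
    filter_upwards [eventually_ge_atTop 0] with u hu
    simp [hu.not_gt]
  rcases hc.eq_or_lt with rfl | hc
  · refine tendsto_const_nhds.congr' ?_
    filter_upwards [eventually_ge_atTop 0] with u hu
    simp [hu.not_gt]
  have h1 := hreg b⁻¹ (inv_pos.2 hb)
  have h2 : Tendsto (fun u => m.real (Set.Ioi (u / c))) atTop (𝓝 0) :=
    tendsto_real_Ioi_atTop.comp (tendsto_id.atTop_div_const hc)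
  have h3 := h1.mul h2
  rw [mul_zero] at h3
  refine h3.congr fun u => ?_
  rw [infinitePi_real_lt_inter hij hb hc, div_eq_mul_inv u b, div_eq_inv_mul]
  ring

/-- The union of exceedance events is made disjoint one index at a time. By
`tendsto_inv_mul_real_inter` the overlaps are negligible, so the single jump limits add up. -/
theorem tendsto_big_jump {α : ℝ} (hα : 0 < α) (hreg : IsRegularlyVaryingTail m α) (J : Finset ℕ)
    {c : ℕ → ℝ} (hc : ∀ j, 0 ≤ c j) {g : (ℕ → ℝ) → ℝ} (hg : Continuous g) {K : ℝ}
    (hK : ∀ a, |g a| ≤ K) :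
    Tendsto (fun u => (m.real (Set.Ioi u))⁻¹ *
        ∫ a in {a : ℕ → ℝ | ∃ j ∈ J, u < c j * a j}, g (u⁻¹ • a)
          ∂(Measure.infinitePi fun _ : ℕ => m)) atTop
      (𝓝 (∑ j ∈ J, c j ^ α * ∫ s in Set.Ioo (0 : ℝ) 1, g (Pi.single j (s ^ (-α⁻¹) / c j)))) := by
  classical
  set ρ := Measure.infinitePi fun _ : ℕ => m with hρ
  have hgint : ∀ (u : ℝ) (s : Set (ℕ → ℝ)), IntegrableOn (fun a => g (u⁻¹ • a)) s ρ := fun u s =>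
    Integrable.integrableOn (Integrable.of_bound
      (hg.measurable.comp (measurable_const_smul u⁻¹)).aestronglyMeasurable K
      (ae_of_all _ fun a => hK _))
  have hK0 : 0 ≤ K := (abs_nonneg _).trans (hK 0)
  induction J using Finset.induction_on with
  | empty => simp
  | insert j J hj ih =>
    rw [Finset.sum_insert hj]
    have hA := fun u => measurableSet_lt_const_mul j (c j) u
    let B : ℝ → Set (ℕ → ℝ) := fun u => {a | ∃ i ∈ J, u < c i * a i}
    have hBeq : ∀ u, B u = ⋃ i ∈ J, {a : ℕ → ℝ | u < c i * a i} := fun u => by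
      ext a
      simp [B]
    have herr : Tendsto (fun u => (m.real (Set.Ioi u))⁻¹ *
        ∫ a in B u ∩ {a : ℕ → ℝ | u < c j * a j}, g (u⁻¹ • a) ∂ρ) atTop (𝓝 0) := by
      have h1 : Tendsto (fun u => K * ∑ i ∈ J, (m.real (Set.Ioi u))⁻¹ *
          ρ.real ({a | u < c i * a i} ∩ {a | u < c j * a j})) atTop (𝓝 0) := by
        have : Tendsto (fun u => ∑ i ∈ J, (m.real (Set.Ioi u))⁻¹ *
            ρ.real ({a | u < c i * a i} ∩ {a | u < c j * a j})) atTop (𝓝 (∑ i ∈ J, 0)) :=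
          tendsto_finsetSum _ fun i hi => tendsto_inv_mul_real_inter hreg
            (by rintro rfl; exact hj hi) (hc i) (hc j)
        simpa using this.const_mul K
      refine squeeze_zero_norm (fun u => ?_) h1
      rw [norm_mul, Real.norm_of_nonneg (inv_nonneg.2 measureReal_nonneg), ← Finset.mul_sum,
        mul_left_comm]
      refine mul_le_mul_of_nonneg_left ?_ (inv_nonneg.2 measureReal_nonneg)
      refine (norm_setIntegral_le_of_norm_le_const (measure_lt_top _ _) fun a _ => hK _).trans ?_
      refine mul_le_mul_of_nonneg_left ?_ hK0
      rw [hBeq, Set.iUnion₂_inter]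
      exact measureReal_biUnion_finset_le _ _
    have hlim := (tendsto_single_jump hα hreg j (hc j) hg hK).add (ih.sub herr)
    rw [sub_zero] at hlim
    refine hlim.congr fun u => ?_
    rw [← mul_sub, ← mul_add]
    congr 1
    have e1 : {a : ℕ → ℝ | ∃ i ∈ insert j J, u < c i * a i} =
        {a | u < c j * a j} ∪ (B u \ {a | u < c j * a j}) := by
      ext a
      simp only [Finset.mem_insert, exists_eq_or_imp, Set.mem_ofPred_eq, Set.mem_union,
        Set.mem_sdiff, B]
      tauto
    have hBm : MeasurableSet (B u) := by
      rw [hBeq]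
      exact Finset.measurableSet_biUnion _ fun i _ => measurableSet_lt_const_mul i (c i) u
    have e2 := integral_inter_add_sdiff (hA u) (hgint u (B u))
    rw [e1, setIntegral_union Set.disjoint_sdiff_right (hBm.diff (hA u)) (hgint u _) (hgint u _)]
    linarith

/-- The union bound supplies a majorant whose only dependence on the positions is through the number
of neighbors. -/
theorem abs_big_jump_le (J : Finset ℕ) {c : ℕ → ℝ} (hc : ∀ j, 0 ≤ c j) {C : ℝ} (hC : 0 < C)
    (hcC : ∀ j, c j ≤ C) {f : (ℕ → ℝ) → ℝ} {K : ℝ} (hK : ∀ a, |f a| ≤ K) {u : ℝ} (hu : 0 < u) :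
    |(m.real (Set.Ioi u))⁻¹ * ∫ a in {a : ℕ → ℝ | ∃ j ∈ J, u < c j * a j}, f a
        ∂(Measure.infinitePi fun _ : ℕ => m)| ≤
      K * (m.real (Set.Ioi (u / C)) / m.real (Set.Ioi u)) * J.card := by
  have hK0 : 0 ≤ K := (abs_nonneg _).trans (hK 0)
  have h1 := norm_setIntegral_le_of_norm_le_const
    (μ := Measure.infinitePi fun _ : ℕ => m) (f := f) (C := K)
    (s := {a : ℕ → ℝ | ∃ j ∈ J, u < c j * a j}) (measure_lt_top _ _) fun a _ => hK _
  have h2 : (Measure.infinitePi fun _ : ℕ => m).real {a : ℕ → ℝ | ∃ j ∈ J, u < c j * a j} ≤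
      J.card * m.real (Set.Ioi (u / C)) := by
    have e : {a : ℕ → ℝ | ∃ j ∈ J, u < c j * a j} = ⋃ i ∈ J, {a : ℕ → ℝ | u < c i * a i} := by
      ext a
      simp
    rw [e]
    refine (measureReal_biUnion_finset_le _ _).trans ?_
    rw [← nsmul_eq_mul]
    refine Finset.sum_le_card_nsmul _ _ _ fun i _ => ?_
    rw [← infinitePi_real_lt i hC u]
    refine measureReal_mono fun a ha => ?_
    have ha' : u < c i * a i := ha
    have : 0 < a i := pos_of_mul_pos_right (hu.trans ha') (hc i)
    exact ha'.trans_le (mul_le_mul_of_nonneg_right (hcC i) this.le)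
  rw [abs_mul, abs_of_nonneg (inv_nonneg.2 measureReal_nonneg), ← Real.norm_eq_abs]
  calc _ ≤ (m.real (Set.Ioi u))⁻¹ * (K * (J.card * m.real (Set.Ioi (u / C)))) :=
        mul_le_mul_of_nonneg_left (h1.trans (mul_le_mul_of_nonneg_left h2 hK0))
          (inv_nonneg.2 measureReal_nonneg)
    _ = _ := by rw [div_eq_mul_inv]; ring

end SingleBigJump

/-! ### Moving maxima along sequences of positions and marks -/

/-- With fixed positions a vague test function sees only the finitely many indices in a ball. It
vanishes at nonpositive scores, so an atom that appears or disappears as its score crosses zero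
causes no discontinuity. -/
theorem continuous_seqConf {Y : Type*} [TopologicalSpace Y] {τ : ℕ → Pos d}
    (hτ : IsLocallyFiniteSeq τ) {A : Y → ℕ → ℝ} (hA : ∀ i, Continuous fun y => A y i) :
    Continuous fun y => (seqConf τ (A y)).1 := by
  refine continuous_iInf_rng.2 fun f => continuous_iInf_rng.2 fun hf =>
    continuous_induced_rng.2 ?_
  obtain ⟨R, ε, hε, hsupp⟩ := hf.supp
  have hzero : ∀ p : Pos d × ℝ, p.2 ≤ 0 → f p = 0 := fun p hp => by
    by_contra h
    linarith [(hsupp p h).2]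
  have key : ∀ y, ∑' p : (seqConf τ (A y)).1.atoms, f p.1 =
      ∑ i ∈ (hτ.2 R).toFinset, f (τ i, A y i) := fun y => by
    have hinj : Function.Injective fun i => (τ i, A y i) := fun i j h => hτ.1 (Prod.ext_iff.1 h).1
    have hs : Function.support ((seqConf τ (A y)).1.atoms.indicator f) ⊆
        Set.range fun i => (τ i, A y i) := fun p hp => by
      obtain ⟨i, hi, -⟩ := (mem_seqConf hτ).1 (Set.mem_of_indicator_ne_zero hp)
      exact ⟨i, hi.symm⟩
    have hterm : ∀ i, (seqConf τ (A y)).1.atoms.indicator f (τ i, A y i) = f (τ i, A y i) :=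
      fun i => by
        by_cases h : 0 < A y i
        · exact Set.indicator_of_mem ((mem_seqConf hτ).2 ⟨i, rfl, h⟩) f
        · rw [hzero _ (not_lt.1 h)]
          refine Set.indicator_apply_eq_zero.2 fun _ => hzero _ (not_lt.1 h)
    rw [tsum_subtype (seqConf τ (A y)).1.atoms f, ← hinj.tsum_eq hs]
    simp_rw [hterm]
    refine tsum_eq_sum fun i hi => ?_
    by_contra h
    exact hi ((Set.Finite.mem_toFinset _).2 (hsupp _ h).1)
  change Continuous fun y => ∑' p : (seqConf τ (A y)).1.atoms, f p.1
  simp_rw [key]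
  exact continuous_finsetSum _ fun i _ => hf.cont.comp (continuous_const.prodMk (hA i))

theorem scale_seqConf {τ : ℕ → Pos d} (hτ : IsLocallyFiniteSeq τ) (b : ℕ → ℝ) {u : ℝ}
    (hu : 0 < u) : scale 1 u (seqConf τ b).1 = (seqConf τ (u⁻¹ • b)).1 := by
  ext p
  rw [mem_scale hu, mem_seqConf hτ, mem_seqConf hτ]
  refine exists_congr fun i => ?_
  simp only [Prod.ext_iff, Pi.smul_apply, smul_eq_mul]
  constructor
  · rintro ⟨⟨h1, h2⟩, h3⟩
    refine ⟨⟨h1, ?_⟩, by positivity⟩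
    rw [← h2]
    field_simp
  · rintro ⟨⟨h1, h2⟩, h3⟩
    refine ⟨⟨h1, ?_⟩, pos_of_mul_pos_right h3 (inv_pos.2 hu).le⟩
    rw [h2]
    field_simp

theorem score_seqConf {τ : ℕ → Pos d} (hτ : IsLocallyFiniteSeq τ) {b : ℕ → ℝ} {i : ℕ}
    (hb : 0 ≤ b i) : score (seqConf τ b).1 (τ i) = b i := by
  rcases hb.eq_or_lt with h | h
  · rw [← h]
    refine score_of_notMem fun s hs => ?_
    obtain ⟨j, hj, h0⟩ := (mem_seqConf hτ).1 hs
    have : i = j := hτ.1 (Prod.ext_iff.1 hj).1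
    subst this
    exact h.not_lt h0
  · exact score_of_mem (p := (τ i, b i)) ((mem_seqConf hτ).2 ⟨i, rfl, h⟩)

section

variable {w : Pos d → ℝ} {Φ : Pos d → GroundConf d → GroundConf d} {τ : ℕ → Pos d}

/-- The indices of the neighbors of the point `τ i`. -/
def neighborIndices (Φ : Pos d → GroundConf d → GroundConf d) (τ : ℕ → Pos d) (i : ℕ) : Set ℕ :=
  {k | τ k ∈ (Φ (τ i) (seqGround τ)).pts}

/-- The scores of the moving maxima model as a function of the marks. -/
def seqScore (w : Pos d → ℝ) (Φ : Pos d → GroundConf d → GroundConf d) (τ : ℕ → Pos d)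
    (y : ℕ → ℝ) (i : ℕ) : ℝ :=
  sSup ((fun k => w (τ k - τ i) * y k) '' neighborIndices Φ τ i)

theorem image_neighborIndices (hΦ : IsNeighborhoodRule Φ) (hτ : IsLocallyFiniteSeq τ) (i : ℕ) :
    τ '' neighborIndices Φ τ i = (Φ (τ i) (seqGround τ)).pts := by
  ext x
  constructor
  · rintro ⟨k, hk, rfl⟩
    exact hk
  · intro hx
    obtain ⟨k, rfl⟩ := (mem_seqGround hτ).1
      (hΦ.subset _ _ ((mem_seqGround hτ).2 ⟨i, rfl⟩) hx)
    exact ⟨k, hx, rfl⟩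

theorem finite_neighborIndices (hΦ : IsNeighborhoodRule Φ) (hτ : IsLocallyFiniteSeq τ) (i : ℕ) :
    (neighborIndices Φ τ i).Finite :=
  (hΦ.finite _ _ ((mem_seqGround hτ).2 ⟨i, rfl⟩)).preimage hτ.1.injOn

theorem self_mem_neighborIndices (hΦ : IsNeighborhoodRule Φ) (hτ : IsLocallyFiniteSeq τ) (i : ℕ) :
    i ∈ neighborIndices Φ τ i :=
  hΦ.self_mem _ _ ((mem_seqGround hτ).2 ⟨i, rfl⟩)

theorem nonempty_neighborIndices (hΦ : IsNeighborhoodRule Φ) (hτ : IsLocallyFiniteSeq τ) (i : ℕ) :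
    (finite_neighborIndices hΦ hτ i).toFinset.Nonempty :=
  ⟨i, (Set.Finite.mem_toFinset _).2 (self_mem_neighborIndices hΦ hτ i)⟩

theorem seqScore_eq_sup' (hΦ : IsNeighborhoodRule Φ) (hτ : IsLocallyFiniteSeq τ) (y : ℕ → ℝ)
    (i : ℕ) : seqScore w Φ τ y i = (finite_neighborIndices hΦ hτ i).toFinset.sup'
      (nonempty_neighborIndices hΦ hτ i)
      (fun k => w (τ k - τ i) * y k) := by
  rw [Finset.sup'_eq_csSup_image, Set.Finite.coe_toFinset]
  rfl

theorem continuous_seqScore (hΦ : IsNeighborhoodRule Φ) (hτ : IsLocallyFiniteSeq τ) (i : ℕ) :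
    Continuous fun y => seqScore w Φ τ y i := by
  simp_rw [seqScore_eq_sup' hΦ hτ]
  exact Continuous.finset_sup'_apply _ fun k _ => by fun_prop

theorem lt_seqScore_iff (hΦ : IsNeighborhoodRule Φ) (hτ : IsLocallyFiniteSeq τ) (y : ℕ → ℝ)
    (i : ℕ) (u : ℝ) : u < seqScore w Φ τ y i ↔
      ∃ k ∈ (finite_neighborIndices hΦ hτ i).toFinset, u < w (τ k - τ i) * y k := by
  rw [seqScore_eq_sup' hΦ hτ, Finset.lt_sup'_iff]

open scoped Pointwise in
theorem seqScore_smul {z : ℝ} (hz : 0 ≤ z) (y : ℕ → ℝ) : seqScore w Φ τ (z • y) = z • seqScore w Φ τ y := by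
  ext i
  have : (fun k => w (τ k - τ i) * (z • y) k) '' neighborIndices Φ τ i =
      z • ((fun k => w (τ k - τ i) * y k) '' neighborIndices Φ τ i) := by
    rw [← Set.image_smul, Set.image_image]
    refine Set.image_congr fun k _ => ?_
    simp only [Pi.smul_apply, smul_eq_mul]
    ring
  rw [Pi.smul_apply, seqScore, this, Real.sSup_smul_of_nonneg hz]
  rfl

open scoped Classical in
theorem seqScore_single (hw_nonneg : ∀ x, 0 ≤ w x) (hΦ : IsNeighborhoodRule Φ)
    (hτ : IsLocallyFiniteSeq τ) (j i : ℕ) :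
    seqScore w Φ τ (Pi.single j 1) i =
      if j ∈ neighborIndices Φ τ i then w (τ j - τ i) else 0 := by
  have hnn : ∀ k, 0 ≤ w (τ k - τ i) * (Pi.single j 1 : ℕ → ℝ) k := fun k =>
    mul_nonneg (hw_nonneg _) ((Pi.single_nonneg (α := fun _ : ℕ => ℝ)).2 zero_le_one k)
  rw [seqScore_eq_sup' hΦ hτ]
  refine le_antisymm (Finset.sup'_le _ _ fun k hk => ?_) ?_
  · by_cases hkj : k = j
    · subst hkj
      rw [Set.Finite.mem_toFinset] at hk
      simp [hk]
    · rw [Pi.single_eq_of_ne hkj, mul_zero]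
      split_ifs
      exacts [hw_nonneg _, le_rfl]
  · split_ifs with h
    · refine le_trans ?_ (Finset.le_sup' _ ((Set.Finite.mem_toFinset _).2 h))
      simp
    · exact (hnn i).trans (Finset.le_sup' (fun k => w (τ k - τ i) * (Pi.single j 1 : ℕ → ℝ) k)
        ((Set.Finite.mem_toFinset _).2 (self_mem_neighborIndices hΦ hτ i)))

theorem scored_seqConf (hΦ : IsNeighborhoodRule Φ)
    (hτ : IsLocallyFiniteSeq τ) {ζ : ℕ → ℝ} (hζ : ∀ i, 0 < ζ i) :
    scored w Φ (seqConf τ ζ) = seqConf τ (seqScore w Φ τ ζ) := by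
  have hs : ∀ i, scoring w Φ (τ i) (seqConf τ ζ) = seqScore w Φ τ ζ i := fun i => by
    rw [scoring, proj_seqConf hζ, ← image_neighborIndices hΦ hτ, Set.image_image, seqScore]
    congr 1
    refine Set.image_congr fun k _ => ?_
    rw [score_seqConf hτ (hζ k).le]
  refine Subtype.ext (Conf.ext (Set.ext fun p => ?_))
  rw [mem_seqConf hτ]
  change (p.1 ∈ (proj (seqConf τ ζ)).pts ∧ p.2 = scoring w Φ p.1 (seqConf τ ζ) ∧ 0 < p.2) ↔ _
  rw [proj_seqConf hζ, mem_seqGround hτ]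
  constructor
  · rintro ⟨⟨i, hi⟩, h2, h3⟩
    rw [hi, hs] at h2
    exact ⟨i, Prod.ext hi h2, h2 ▸ h3⟩
  · rintro ⟨i, rfl, h⟩
    exact ⟨⟨i, rfl⟩, (hs i).symm, h⟩

/-- The points that have `x` as a neighbor, with the weights of `x` as seen from them. -/
def clusterAt (w : Pos d → ℝ) (Φ : Pos d → GroundConf d → GroundConf d) (x : Pos d)
    (S : GroundConf d) : Conf d :=
  shift (-x) (clusterW w Φ (shiftGround x S))

theorem measurable_clusterAt (hw : Measurable w) (hΦ : IsNeighborhoodRule Φ) :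
    Measurable fun q : Pos d × GroundConf d => clusterAt w Φ q.1 q.2 :=
  measurable_shift.comp (measurable_fst.neg.prodMk
    ((measurable_clusterW hw hΦ).comp measurable_shiftGround))

theorem mem_clusterAt (hΦ : IsNeighborhoodRule Φ) (x : Pos d) (S : GroundConf d)
    (p : Pos d × ℝ) : p ∈ (clusterAt w Φ x S).atoms ↔
      p.1 ∈ S.pts ∧ x ∈ (Φ p.1 S).pts ∧ p.2 = w (x - p.1) ∧ 0 < p.2 := by
  change (p.1 + -x + x ∈ S.pts ∧ 0 ∈ (Φ (p.1 + -x) (shiftGround x S)).pts ∧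
    p.2 = w (-(p.1 + -x)) ∧ 0 < p.2) ↔ _
  rw [neg_add_cancel_right, ← sub_eq_add_neg, neg_sub]
  refine and_congr_right fun h => ?_
  rw [hΦ.equivariant S x _ h]
  change 0 + x ∈ (Φ p.1 S).pts ∧ _ ↔ _
  rw [zero_add]

/-- This identifies the big-jump limit: if `τ j` carries the only nonzero mark, exactly the points
that have `τ j` as a neighbor and give it positive weight keep a positive score. -/
theorem seqConf_seqScore_single (hw_nonneg : ∀ x, 0 ≤ w x) (hΦ : IsNeighborhoodRule Φ)
    (hτ : IsLocallyFiniteSeq τ) (j : ℕ) {z : ℝ} (hz : 0 < z) :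
    (seqConf τ (seqScore w Φ τ (Pi.single j z))).1 =
      scale 1 z⁻¹ (clusterAt w Φ (τ j) (seqGround τ)) := by
  classical
  have h1 : (Pi.single j z : ℕ → ℝ) = z • Pi.single j 1 := by
    rw [← Pi.single_smul, smul_eq_mul, mul_one]
  rw [h1, seqScore_smul hz.le]
  have h2 := scale_seqConf hτ (seqScore w Φ τ (Pi.single j 1)) (inv_pos.2 hz)
  rw [inv_inv] at h2
  rw [← h2]
  congr 1
  ext p
  rw [mem_seqConf hτ, mem_clusterAt hΦ, mem_seqGround hτ]
  simp_rw [seqScore_single hw_nonneg hΦ hτ]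
  constructor
  · rintro ⟨i, rfl, h⟩
    have hij : j ∈ neighborIndices Φ τ i := by
      by_contra hij
      simp [hij] at h
    exact ⟨⟨i, rfl⟩, hij, by simp [hij], by simpa [hij] using h⟩
  · rintro ⟨⟨i, hi⟩, h2, h3, h4⟩
    have hij : j ∈ neighborIndices Φ τ i := by
      rw [neighborIndices, Set.mem_ofPred_eq, ← hi]
      exact h2
    refine ⟨i, Prod.ext hi ?_, ?_⟩
    · simp only [if_pos hij]
      rw [h3, hi]
    · rw [if_pos hij, ← hi, ← h3]
      exact h4

theorem lintegral_groundCount_neighbors (hΦ : IsNeighborhoodRule Φ) (hτ : IsLocallyFiniteSeq τ)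
    (i : ℕ) (f : Pos d → ℝ≥0∞) :
    ∫⁻ x, f x ∂groundCount d (Φ (τ i) (seqGround τ)) =
      ∑ j ∈ (finite_neighborIndices hΦ hτ i).toFinset, f (τ j) := by
  rw [groundCount_apply, ← image_neighborIndices hΦ hτ,
    lintegral_count_restrict_image (Set.to_countable _) hτ.1.injOn,
    lintegral_count_restrict (Set.to_countable _),
    tsum_subtype (neighborIndices Φ τ i) fun j => f (τ j),
    tsum_eq_sum (s := (finite_neighborIndices hΦ hτ i).toFinset)]
  · exact Finset.sum_congr rfl fun j hj =>
      Set.indicator_of_mem ((Set.Finite.mem_toFinset _).1 hj) _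
  · exact fun j hj => Set.indicator_of_notMem
      (fun h => hj ((Set.Finite.mem_toFinset _).2 h)) _

end

/-! ### The limit of the Palm version -/

section

variable {w : Pos d → ℝ} {Φ : Pos d → GroundConf d → GroundConf d}

/-- The contribution of one neighbor of the origin to the tail configuration. -/
def jumpIntegral (w : Pos d → ℝ) (Φ : Pos d → GroundConf d → GroundConf d) (α : ℝ)
    (F : Conf d → ℝ≥0∞) (x : Pos d) (S : GroundConf d) : ℝ≥0∞ :=
  ENNReal.ofReal (w x ^ α) *
    ∫⁻ s in Set.Ioo (0 : ℝ) 1, F (scale 1 (w x * s ^ α⁻¹) (clusterAt w Φ x S))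

theorem measurable_jumpIntegral (hw : Measurable w) (hΦ : IsNeighborhoodRule Φ) (α : ℝ)
    {F : Conf d → ℝ≥0∞} (hF : Measurable F) :
    Measurable fun q : Pos d × GroundConf d => jumpIntegral w Φ α F q.1 q.2 := by
  refine Measurable.mul (by fun_prop) (Measurable.lintegral_prod_right' (f := fun q :
    (Pos d × GroundConf d) × ℝ =>
      F (scale 1 (w q.1.1 * q.2 ^ α⁻¹) (clusterAt w Φ q.1.1 q.1.2))) ?_)
  refine hF.comp (measurable_scale.comp (Measurable.prodMk (by fun_prop) ?_))
  exact (measurable_clusterAt hw hΦ).comp measurable_fst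

theorem measurable_neighborhood_zero (hΦ : IsNeighborhoodRule Φ) :
    Measurable fun S : GroundConf d => Φ 0 (addOrigin S) :=
  hΦ.measurable.comp (measurable_const.prodMk measurable_addOrigin)

/-- Up to normalization, `ν` is the law of the tail configuration of the moving maxima model whose
Poisson process has law `Λ`. -/
def IsJumpMeasure (w : Pos d → ℝ) (Φ : Pos d → GroundConf d → GroundConf d) (α : ℝ)
    (Λ : Measure (GroundConf d)) (ν : Measure (Conf d)) : Prop :=
  ∀ F : Conf d → ℝ≥0∞, Measurable F →
    ∫⁻ μ, F μ ∂ν = ∫⁻ S, ∫⁻ x, jumpIntegral w Φ α F x (addOrigin S)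
      ∂groundCount d (Φ 0 (addOrigin S)) ∂Λ

theorem exists_jumpMeasure (hw : Measurable w) (hΦ : IsNeighborhoodRule Φ) (α : ℝ)
    (Λ : Measure (GroundConf d)) [IsProbabilityMeasure Λ] :
    ∃ ν : Measure (Conf d), IsJumpMeasure w Φ α Λ ν := by
  let κ : Kernel (GroundConf d) (Pos d) :=
    (groundCount d).comap _ (measurable_neighborhood_zero hΦ)
  -- The sampling recipe: choose the positions, a neighbor `x` of the origin biased by `w x ^ α`,
  -- and a uniform `s`. Scaling by `w x * s ^ α⁻¹` corresponds to the limiting mark `s ^ (-α⁻¹) / w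
  -- x` at `x`.
  let e : (GroundConf d × Pos d) × ℝ → Conf d := fun q =>
    scale 1 (w q.1.2 * q.2 ^ α⁻¹) (clusterAt w Φ q.1.2 (addOrigin q.1.1))
  have he : Measurable e := by
    refine measurable_scale.comp (Measurable.prodMk (by fun_prop) ?_)
    exact (measurable_clusterAt hw hΦ).comp ((measurable_snd.comp measurable_fst).prodMk
      (measurable_addOrigin.comp (measurable_fst.comp measurable_fst)))
  have hd : Measurable fun q : GroundConf d × Pos d => ENNReal.ofReal (w q.2 ^ α) := by fun_prop
  refine ⟨((((Λ ⊗ₘ κ).withDensity fun q => ENNReal.ofReal (w q.2 ^ α))).prod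
    (volume.restrict (Set.Ioo (0 : ℝ) 1))).map e, fun F hF => ?_⟩
  have hI : Measurable fun q : GroundConf d × Pos d =>
      ∫⁻ s in Set.Ioo (0 : ℝ) 1, F (e (q, s)) :=
    Measurable.lintegral_prod_right' (f := fun q => F (e q)) (hF.comp he)
  have hFe : Measurable fun q => F (e q) := hF.comp he
  rw [lintegral_map hF he, lintegral_prod _ hFe.aemeasurable,
    lintegral_withDensity_eq_lintegral_mul _ hd hI,
    Measure.lintegral_compProd (hd.mul hI)]
  rfl

theorem jumpIntegral_one {α : ℝ} (x : Pos d) (S : GroundConf d) :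
    jumpIntegral w Φ α 1 x S = ENNReal.ofReal (w x ^ α) := by
  simp [jumpIntegral]

/-- The origin is its own neighbor and alone contributes `w 0 ^ α`. -/
theorem jumpMeasure_univ_ne_zero (hw_zero : 0 < w 0) (hΦ : IsNeighborhoodRule Φ) {α : ℝ}
    {Λ : Measure (GroundConf d)} [IsProbabilityMeasure Λ] {ν : Measure (Conf d)}
    (hν : IsJumpMeasure w Φ α Λ ν) : ν Set.univ ≠ 0 := by
  have h1 := hν 1 measurable_one
  simp only [Pi.one_apply, lintegral_one] at h1
  rw [h1]
  have h2 : ENNReal.ofReal (w 0 ^ α) ≤ ∫⁻ S, ∫⁻ x, jumpIntegral w Φ α 1 x (addOrigin S)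
        ∂groundCount d (Φ 0 (addOrigin S)) ∂Λ := by
    calc _ = ∫⁻ S, ENNReal.ofReal (w 0 ^ α) ∂Λ := by simp
      _ ≤ _ := lintegral_mono fun S => ?_
    rw [lintegral_groundCount]
    have h0 : (0 : Pos d) ∈ (Φ 0 (addOrigin S)).pts := hΦ.self_mem _ _ (zero_mem_addOrigin S)
    refine le_trans ?_ (ENNReal.le_tsum (⟨0, h0⟩ : (Φ 0 (addOrigin S)).pts))
    rw [jumpIntegral_one]
  have h3 : 0 < ENNReal.ofReal (w 0 ^ α) := ENNReal.ofReal_pos.2 (by positivity)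
  exact (h3.trans_le h2).ne'

theorem jumpMeasure_univ_ne_top (hw_nonneg : ∀ x, 0 ≤ w x) {C : ℝ} (hC : ∀ x, w x ≤ C)
    {α : ℝ} (hα : 0 < α) {Λ : Measure (GroundConf d)} {ν : Measure (Conf d)}
    (hN : ∫⁻ S, (((Φ 0 (addOrigin S)).pts.encard : ℕ∞) : ℝ≥0∞) ∂Λ ≠ ∞)
    (hν : IsJumpMeasure w Φ α Λ ν) : ν Set.univ ≠ ∞ := by
  have h1 := hν 1 measurable_one
  simp only [Pi.one_apply, lintegral_one] at h1
  rw [h1]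
  refine ne_top_of_le_ne_top (ENNReal.mul_ne_top (ENNReal.ofReal_ne_top (r := C ^ α)) hN) ?_
  rw [← lintegral_const_mul' _ _ ENNReal.ofReal_ne_top]
  refine lintegral_mono fun S => ?_
  have h2 := groundCount_apply' (Φ 0 (addOrigin S)) MeasurableSet.univ
  rw [Set.inter_univ] at h2
  dsimp only
  rw [← h2, ← lintegral_const]
  refine lintegral_mono fun x => ?_
  rw [jumpIntegral_one]
  exact ENNReal.ofReal_le_ofReal (Real.rpow_le_rpow (hw_nonneg x) (hC x) hα.le)

end

/-! ### Convergence of the Palm version -/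

section

variable {w : Pos d → ℝ} {Φ : Pos d → GroundConf d → GroundConf d}
  {m : Measure ℝ}

theorem integral_indicator_scored_seqConf (hΦ : IsNeighborhoodRule Φ)
    (hm : ∀ᵐ a ∂(Measure.infinitePi fun _ : ℕ => m), ∀ i, 0 < a i) {τ : ℕ → Pos d}
    (hτ : IsLocallyFiniteSeq τ) (hτ0 : τ 0 = 0) {u : ℝ} (hu : 0 < u) (h : Conf d → ℝ) :
    ∫ a, {a | u < score (scored w Φ (seqConf τ a)).1 0}.indicator
        (fun a => h (scale 1 u (scored w Φ (seqConf τ a)).1)) a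
        ∂(Measure.infinitePi fun _ : ℕ => m) =
      ∫ a in {a | ∃ j ∈ (finite_neighborIndices hΦ hτ 0).toFinset, u < w (τ j) * a j},
        h (seqConf τ (seqScore w Φ τ (u⁻¹ • a))).1 ∂(Measure.infinitePi fun _ : ℕ => m) := by
  have hs : MeasurableSet
      {a : ℕ → ℝ | ∃ j ∈ (finite_neighborIndices hΦ hτ 0).toFinset, u < w (τ j) * a j} := by
    have : {a : ℕ → ℝ | ∃ j ∈ (finite_neighborIndices hΦ hτ 0).toFinset, u < w (τ j) * a j} =
        ⋃ j ∈ (finite_neighborIndices hΦ hτ 0).toFinset, {a | u < w (τ j) * a j} := by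
      ext a
      simp
    rw [this]
    exact Finset.measurableSet_biUnion _ fun i _ => measurableSet_lt_const_mul i _ u
  rw [← integral_indicator hs]
  refine integral_congr_ae ?_
  filter_upwards [hm] with a ha
  have h1 := scored_seqConf (w := w) hΦ hτ ha
  have h2 : u < score (scored w Φ (seqConf τ a)).1 0 ↔
      ∃ j ∈ (finite_neighborIndices hΦ hτ 0).toFinset, u < w (τ j) * a j := by
    rw [h1]
    -- No sign of `w` is assumed here. If the maximum is negative, there is no atom at the origin
    -- and the score has its default value `0`, which is below `u`.
    by_cases hpos : 0 ≤ seqScore w Φ τ a 0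
    · have h3 := score_seqConf hτ hpos
      rw [hτ0] at h3
      rw [h3, lt_seqScore_iff hΦ hτ]
      simp [hτ0]
    · have h3 : score (seqConf τ (seqScore w Φ τ a)).1 0 = 0 := by
        refine score_of_notMem fun s hs => ?_
        obtain ⟨j, hj, h0⟩ := (mem_seqConf hτ).1 hs
        have : j = 0 := hτ.1 ((Prod.ext_iff.1 hj).1.symm.trans hτ0.symm)
        subst this
        exact hpos h0.le
      rw [h3]
      refine iff_of_false hu.not_gt fun h4 => ?_
      have h5 := (lt_seqScore_iff (w := w) hΦ hτ a 0 u).2 (by simpa [hτ0] using h4)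
      exact hpos (hu.trans h5).le
  have h3 : scale 1 u (scored w Φ (seqConf τ a)).1 =
      (seqConf τ (seqScore w Φ τ (u⁻¹ • a))).1 := by
    rw [h1, scale_seqConf hτ _ hu, seqScore_smul (inv_pos.2 hu).le]
  by_cases hlt : u < score (scored w Φ (seqConf τ a)).1 0
  · rw [Set.indicator_of_mem (s := {a | u < score (scored w Φ (seqConf τ a)).1 0}) hlt,
      Set.indicator_of_mem (s := {a : ℕ → ℝ | ∃ j ∈ (finite_neighborIndices hΦ hτ 0).toFinset,
        u < w (τ j) * a j}) (h2.1 hlt), h3]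
  · rw [Set.indicator_of_notMem (s := {a | u < score (scored w Φ (seqConf τ a)).1 0}) hlt,
      Set.indicator_of_notMem (s := {a : ℕ → ℝ | ∃ j ∈ (finite_neighborIndices hΦ hτ 0).toFinset,
        u < w (τ j) * a j}) (fun h => hlt (h2.2 h))]

variable [IsProbabilityMeasure m]

/-- Matches the two forms of the limit: the sum over indices given by `tendsto_big_jump` and the
integral over neighbors in `IsJumpMeasure`. -/
theorem toReal_lintegral_jumpIntegral (hw_nonneg : ∀ x, 0 ≤ w x) (hΦ : IsNeighborhoodRule Φ)
    {α : ℝ} (hα : 0 < α) {τ : ℕ → Pos d} (hτ : IsLocallyFiniteSeq τ) (hτ0 : τ 0 = 0)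
    {h : Conf d → ℝ} (hc : Continuous h) (hnn : ∀ μ, 0 ≤ h μ) {K : ℝ} (hK : ∀ μ, h μ ≤ K) :
    (∫⁻ x, jumpIntegral w Φ α (fun μ => ENNReal.ofReal (h μ)) x (seqGround τ)
        ∂groundCount d (Φ 0 (seqGround τ))).toReal =
      ∑ j ∈ (finite_neighborIndices hΦ hτ 0).toFinset, w (τ j) ^ α *
        ∫ s in Set.Ioo (0 : ℝ) 1,
          h (seqConf τ (seqScore w Φ τ (Pi.single j (s ^ (-α⁻¹) / w (τ j))))).1 := by
  have h1 := lintegral_groundCount_neighbors hΦ hτ 0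
    (fun x => jumpIntegral w Φ α (fun μ => ENNReal.ofReal (h μ)) x (seqGround τ))
  rw [hτ0] at h1
  have hle : ∀ x, jumpIntegral w Φ α (fun μ => ENNReal.ofReal (h μ)) x (seqGround τ) ≠ ∞ :=
    fun x => by
      refine ENNReal.mul_ne_top ENNReal.ofReal_ne_top (ne_top_of_le_ne_top
        (b := ∫⁻ s in Set.Ioo (0 : ℝ) 1, ENNReal.ofReal K) (by simp)
        (lintegral_mono fun s => ENNReal.ofReal_le_ofReal (hK _)))
  rw [h1, ENNReal.toReal_sum fun j _ => hle _]
  refine Finset.sum_congr rfl fun j _ => ?_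
  rcases (hw_nonneg (τ j)).eq_or_lt with h0 | h0
  · rw [jumpIntegral, ← h0, Real.zero_rpow hα.ne']
    simp
  rw [jumpIntegral, ENNReal.toReal_mul, ENNReal.toReal_ofReal (by positivity)]
  congr 1
  have hg : Continuous fun y : ℕ → ℝ => h (seqConf τ (seqScore w Φ τ y)).1 :=
    hc.comp (continuous_seqConf hτ fun i => continuous_seqScore hΦ hτ i)
  have hms : Measurable fun s : ℝ => (Pi.single j (s ^ (-α⁻¹) / w (τ j)) : ℕ → ℝ) := by
    refine measurable_pi_lambda _ fun i => ?_
    by_cases hij : i = j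
    · subst hij
      simp only [Pi.single_eq_same]
      fun_prop
    · simp only [Pi.single_eq_of_ne hij]
      fun_prop
  have hgm : Measurable fun s : ℝ =>
      h (seqConf τ (seqScore w Φ τ (Pi.single j (s ^ (-α⁻¹) / w (τ j))))).1 :=
    hg.measurable.comp hms
  rw [integral_eq_lintegral_of_nonneg_ae (ae_of_all _ fun s => hnn _) hgm.aestronglyMeasurable]
  congr 1
  refine setLIntegral_congr_fun measurableSet_Ioo fun s hs => ?_
  have hz : 0 < s ^ (-α⁻¹) / w (τ j) := div_pos (Real.rpow_pos_of_pos hs.1 _) h0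
  rw [seqConf_seqScore_single hw_nonneg hΦ hτ j hz, inv_div, Real.rpow_neg hs.1.le, div_inv_eq_mul]

/-- The limit is first taken for fixed positions by `tendsto_big_jump`, then averaged over the
positions by dominated convergence. -/
theorem tendsto_setIntegral_palmLaw (hw : Measurable w) (hw_nonneg : ∀ x, 0 ≤ w x)
    {C : ℝ} (hC0 : 0 < C) (hC : ∀ x, w x ≤ C) (hΦ : IsNeighborhoodRule Φ)
    {α : ℝ} (hα : 0 < α) (hreg : IsRegularlyVaryingTail m α)
    (hm : ∀ᵐ a ∂(Measure.infinitePi fun _ : ℕ => m), ∀ i, 0 < a i)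
    {μT : Measure (ℕ → Pos d)} [IsProbabilityMeasure μT]
    (hv : ∀ᵐ τ ∂μT, IsLocallyFiniteSeq τ) (h0 : ∀ᵐ τ ∂μT, ∀ i, τ i ≠ 0)
    (hN : ∫⁻ S, (((Φ 0 (addOrigin S)).pts.encard : ℕ∞) : ℝ≥0∞) ∂(μT.map seqGround) ≠ ∞)
    {ν : Measure (Conf d)} (hν : IsJumpMeasure w Φ α (μT.map seqGround) ν)
    {h : Conf d → ℝ} (hc : Continuous h) (hmeas : Measurable h) (hnn : ∀ μ, 0 ≤ h μ) {K : ℝ}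
    (hK : ∀ μ, h μ ≤ K) :
    Tendsto (fun u => (m.real (Set.Ioi u))⁻¹ *
        ∫ μ in {μ : MarkedConf d | u < score μ.1 0}, h (scale 1 u μ.1) ∂palmLaw w Φ m μT) atTop
      (𝓝 (∫⁻ μ, ENNReal.ofReal (h μ) ∂ν).toReal) := by
  set ρ := Measure.infinitePi fun _ : ℕ => m with hρ
  have hsc : Measurable fun q : (ℕ → Pos d) × (ℕ → ℝ) => scored w Φ (seqConf (consZero q.1) q.2) :=
    (measurable_scored hw hw_nonneg hΦ).comp (measurable_seqConf.comp
      ((measurable_consZero.comp measurable_fst).prodMk measurable_snd))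
  have hscore : Measurable fun μ : MarkedConf d => score μ.1 0 :=
    measurable_score.comp (measurable_const.prodMk measurable_subtype_coe)
  have hsu : ∀ u : ℝ, MeasurableSet {μ : MarkedConf d | u < score μ.1 0} := fun u =>
    measurableSet_lt measurable_const hscore
  have hhu : ∀ u : ℝ, Measurable fun μ : MarkedConf d => h (scale 1 u μ.1) := fun u =>
    hmeas.comp (measurable_scale.comp (measurable_const.prodMk measurable_subtype_coe))
  let f : ℝ → (ℕ → Pos d) × (ℕ → ℝ) → ℝ := fun u q =>
    {μ : MarkedConf d | u < score μ.1 0}.indicator (fun μ => h (scale 1 u μ.1))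
      (scored w Φ (seqConf (consZero q.1) q.2))
  have hf : ∀ u, Measurable (f u) := fun u => ((hhu u).indicator (hsu u)).comp hsc
  have hK0 : 0 ≤ K := (hnn ⟨∅, by simp, by simp, by simp⟩).trans (hK _)
  have hfK : ∀ u q, |f u q| ≤ K := fun u q => by
    simp only [f]
    by_cases hq : scored w Φ (seqConf (consZero q.1) q.2) ∈ {μ : MarkedConf d | u < score μ.1 0}
    · rw [Set.indicator_of_mem hq, abs_of_nonneg (hnn _)]
      exact hK _
    · rw [Set.indicator_of_notMem hq, abs_zero]
      exact hK0
  have e1 : ∀ u, ∫ μ in {μ : MarkedConf d | u < score μ.1 0}, h (scale 1 u μ.1)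
      ∂palmLaw w Φ m μT = ∫ τ, ∫ a, f u (τ, a) ∂ρ ∂μT := fun u => by
    rw [← integral_indicator (hsu u), palmLaw, integral_map hsc.aemeasurable
      ((hhu u).indicator (hsu u)).aestronglyMeasurable, ← integral_prod]
    exact Integrable.of_bound (hf u).aestronglyMeasurable K (ae_of_all _ fun q => hfK u q)
  have e2 : ∀ u, (m.real (Set.Ioi u))⁻¹ * ∫ μ in {μ : MarkedConf d | u < score μ.1 0},
      h (scale 1 u μ.1) ∂palmLaw w Φ m μT =
      ∫ τ, (m.real (Set.Ioi u))⁻¹ * ∫ a, f u (τ, a) ∂ρ ∂μT := fun u => by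
    rw [e1, integral_const_mul]
  simp_rw [e2]
  let G : GroundConf d → ℝ≥0∞ := fun S => ∫⁻ x, jumpIntegral w Φ α
    (fun μ => ENNReal.ofReal (h μ)) x (addOrigin S) ∂groundCount d (Φ 0 (addOrigin S))
  have hG : Measurable G := by
    refine measurable_lintegral_kernel_comp (groundCount d) (measurable_neighborhood_zero hΦ)
      (f := fun S x => jumpIntegral w Φ α (fun μ => ENNReal.ofReal (h μ)) x (addOrigin S)) ?_
    exact (measurable_jumpIntegral hw hΦ α hmeas.ennreal_ofReal).comp
      (measurable_snd.prodMk (measurable_addOrigin.comp measurable_fst))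
  have hGν : ∫⁻ μ, ENNReal.ofReal (h μ) ∂ν = ∫⁻ τ, G (seqGround τ) ∂μT := by
    rw [hν _ hmeas.ennreal_ofReal]
    exact lintegral_map hG measurable_seqGround
  have hfin : ∫⁻ τ, G (seqGround τ) ∂μT ≠ ∞ := by
    rw [← hGν]
    refine ne_top_of_le_ne_top (b := ∫⁻ _, ENNReal.ofReal K ∂ν) ?_
      (lintegral_mono fun μ => ENNReal.ofReal_le_ofReal (hK μ))
    rw [lintegral_const]
    exact ENNReal.mul_ne_top ENNReal.ofReal_ne_top (jumpMeasure_univ_ne_top hw_nonneg hC hα hN hν)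
  have hGs : Measurable fun τ => G (seqGround τ) := hG.comp measurable_seqGround
  rw [hGν, ← integral_toReal hGs.aemeasurable (ae_lt_top hGs hfin)]
  let N : (ℕ → Pos d) → ℝ≥0∞ := fun τ => groundCount d (Φ 0 (addOrigin (seqGround τ))) Set.univ
  have hNm : Measurable N := ((groundCount d).measurable_coe MeasurableSet.univ).comp
    ((measurable_neighborhood_zero hΦ).comp measurable_seqGround)
  have hNfin : ∫⁻ τ, N τ ∂μT ≠ ∞ := by
    have hm1 : Measurable fun S : GroundConf d =>
        groundCount d (Φ 0 (addOrigin S)) Set.univ :=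
      ((groundCount d).measurable_coe MeasurableSet.univ).comp (measurable_neighborhood_zero hΦ)
    have h1 := lintegral_map (μ := μT) hm1 measurable_seqGround
    simp_rw [groundCount_apply' _ MeasurableSet.univ, Set.inter_univ] at h1
    simp_rw [N, groundCount_apply' _ MeasurableSet.univ, Set.inter_univ]
    rw [← h1]
    exact hN
  have hval : ∀ᵐ τ ∂μT, IsLocallyFiniteSeq (consZero τ) ∧
      seqGround (consZero τ) = addOrigin (seqGround τ) := by
    filter_upwards [hv, h0] with τ h1 h2
    exact ⟨h1.consZero h2, seqGround_consZero h1 h2⟩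
  have hcont : ∀ {τ : ℕ → Pos d}, IsLocallyFiniteSeq τ →
      Continuous fun y : ℕ → ℝ => h (seqConf τ (seqScore w Φ τ y)).1 := fun hτ =>
    hc.comp (continuous_seqConf hτ fun i => continuous_seqScore hΦ hτ i)
  have habs : ∀ μ, |h μ| ≤ K := fun μ => by
    rw [abs_of_nonneg (hnn μ)]
    exact hK μ
  -- `C ^ α` is the limit of the tail ratio in `abs_big_jump_le`, so `C ^ α + 1` bounds it for large
  -- `u`; the number of neighbors `N` is integrable by assumption.
  refine tendsto_integral_filter_of_dominated_convergence
    (fun τ => K * (C ^ α + 1) * (N τ).toReal) ?_ ?_ ?_ ?_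
  · exact Eventually.of_forall fun u =>
      ((hf u).stronglyMeasurable.integral_prod_right'.const_mul _).aestronglyMeasurable
  · have h1 : Tendsto (fun u => m.real (Set.Ioi (u / C)) / m.real (Set.Ioi u)) atTop
        (𝓝 (C ^ α)) := by
      have := hreg C⁻¹ (inv_pos.2 hC0)
      rwa [Real.inv_rpow hC0.le, Real.rpow_neg hC0.le, inv_inv] at this
    filter_upwards [eventually_gt_atTop 0, h1.eventually_le_const (lt_add_one _)] with u hu hu1
    filter_upwards [hval] with τ hτ
    have e3 : ∫ a, f u (τ, a) ∂ρ = _ :=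
      integral_indicator_scored_seqConf (w := w) hΦ hm hτ.1 rfl hu h
    rw [e3, Real.norm_eq_abs]
    refine (abs_big_jump_le _ (fun j => hw_nonneg _) hC0 (fun j => hC _) (fun a => habs _)
      hu).trans ?_
    have hcard : (N τ).toReal = (finite_neighborIndices hΦ hτ.1 0).toFinset.card := by
      have h4 := lintegral_groundCount_neighbors hΦ hτ.1 0 1
      have h5 : N τ = ∫⁻ x, (1 : Pos d → ℝ≥0∞) x
          ∂groundCount d (Φ (consZero τ 0) (seqGround (consZero τ))) := by
        rw [hτ.2]
        simp only [Pi.one_apply, lintegral_one]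
        rfl
      rw [h5, h4]
      simp
    rw [hcard]
    gcongr
  · exact (integrable_toReal_of_lintegral_ne_top hNm.aemeasurable hNfin).const_mul _
  · filter_upwards [hval] with τ ⟨hτ, hτG⟩
    have h2 := tendsto_big_jump hα hreg (finite_neighborIndices hΦ hτ 0).toFinset
      (fun j => hw_nonneg (consZero τ j)) (hcont hτ) (fun y => habs _)
    rw [← toReal_lintegral_jumpIntegral hw_nonneg hΦ hα hτ rfl hc hnn hK, hτG] at h2
    refine h2.congr' ?_
    filter_upwards [eventually_gt_atTop 0] with u hu
    rw [← integral_indicator_scored_seqConf (w := w) hΦ hm hτ rfl hu h]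
    rfl

end

/-! ### Tail configurations are unique -/

theorem measurable_tsum_vagueTest {f : Pos d × ℝ → ℝ} (hf : IsVagueTest f)
    (hf0 : ∀ p, 0 ≤ f p) : Measurable fun μ : Conf d => ∑' p : μ.atoms, f p := by
  have h1 : ∀ μ : Conf d, ∑' p : μ.atoms, f p =
      (∫⁻ p, ENNReal.ofReal (f p) ∂confCount d μ).toReal := fun μ => by
    rw [lintegral_confCount, ENNReal.tsum_toReal_eq fun _ => ENNReal.ofReal_ne_top]
    simp_rw [ENNReal.toReal_ofReal (hf0 _)]
  simp_rw [h1]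
  exact (measurable_lintegral_kernel_comp (confCount d) measurable_id
    (f := fun _ p => ENNReal.ofReal (f p))
    ((hf.cont.measurable.comp measurable_snd).ennreal_ofReal)).ennreal_toReal

theorem continuous_tsum_vagueTest {f : Pos d × ℝ → ℝ} (hf : IsVagueTest f) :
    Continuous fun μ : Conf d => ∑' p : μ.atoms, f p :=
  continuous_iff_le_induced.2 (iInf₂_le f hf)

theorem summable_vagueTest {f : Pos d × ℝ → ℝ} (hf : IsVagueTest f) (μ : Conf d) :
    Summable fun p : μ.atoms => f p := by
  obtain ⟨R, ε, hε, hs⟩ := hf.supp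
  refine summable_of_hasFiniteSupport (((μ.locFinite R ε hε).preimage
    Subtype.val_injective.injOn).subset fun p hp => ?_)
  exact ⟨p.2, hs _ hp⟩

theorem exists_vagueTest {O : Set (Pos d × ℝ)} (hO : IsOpen O) {n : ℕ}
    (hn : O ⊆ confExhaustion d n) :
    ∃ f : Pos d × ℝ → ℝ, IsVagueTest f ∧ (∀ p, 0 ≤ f p) ∧ ∀ p, 0 < f p ↔ p ∈ O := by
  -- The distance to the empty set would be `0` by convention; the complement of `O` is nonempty
  -- since `O` contains only positive scores.
  have hne : Oᶜ.Nonempty := ⟨(0, 0), fun h => by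
    have h1 : ((n : ℝ) + 1)⁻¹ < 0 := (hn h).2
    exact h1.not_ge (by positivity)⟩
  have hpos : ∀ p, 0 < Metric.infDist p Oᶜ ↔ p ∈ O := fun p => by
    rw [← hO.isClosed_compl.notMem_iff_infDist_pos hne, Set.notMem_compl_iff]
  have hnn : ∀ p, 0 ≤ min 1 (Metric.infDist p Oᶜ) := fun p =>
    le_min zero_le_one Metric.infDist_nonneg
  refine ⟨fun p => min 1 (Metric.infDist p Oᶜ), ⟨?_, ⟨1, fun p => ?_⟩,
    ⟨n, ((n : ℝ) + 1)⁻¹, by positivity, fun p hp => ?_⟩⟩, hnn, fun p => ?_⟩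
  · exact continuous_const.min (Metric.continuous_infDist_pt _)
  · rw [abs_of_nonneg (hnn p)]
    exact min_le_left _ _
  · have h1 : p ∈ O := (hpos p).1 (lt_of_lt_of_le (lt_of_le_of_ne (hnn p) hp.symm)
      (min_le_right _ _))
    exact ⟨(mem_ball_zero_iff.1 (hn h1).1).le, (hn h1).2⟩
  · rw [lt_min_iff, hpos]
    exact and_iff_right zero_lt_one

/-- The vaguely continuous function `g` vanishes exactly when no atom lies in `O`. Hence `max 0 (1 -
k * g)` tends to the indicator of the void event, and void events determine the law. -/
theorem conf_measure_ext {ν ν' : Measure (Conf d)} [IsProbabilityMeasure ν]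
    [IsProbabilityMeasure ν']
    (h : ∀ h : Conf d → ℝ, Continuous h → Measurable h → (∃ C : ℝ, ∀ μ, |h μ| ≤ C) →
      ∫ μ, h μ ∂ν = ∫ μ, h μ ∂ν') : ν = ν' := by
  refine ext_of_generate_finite _ conf_eq_generateFrom
    (isPiSystem_voidEvents monotone_confExhaustion) ?_ (by simp)
  rintro _ ⟨O, hO, ⟨n, hn⟩, rfl⟩
  obtain ⟨f, hf, hf0, hfO⟩ := exists_vagueTest hO hn
  set g : Conf d → ℝ := fun μ => ∑' p : μ.atoms, f p with hg
  have hgm : Measurable g := measurable_tsum_vagueTest hf hf0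
  have hgc : Continuous g := continuous_tsum_vagueTest hf
  have hg0 : ∀ μ, 0 ≤ g μ := fun μ => tsum_nonneg fun p => hf0 _
  have hgv : ∀ μ, g μ = 0 ↔ μ.atoms ∩ O = ∅ := fun μ => by
    rw [hg, ← (summable_vagueTest hf μ).hasSum_iff, hasSum_zero_iff_of_nonneg fun p => hf0 _]
    constructor
    · intro h0
      refine Set.eq_empty_of_forall_notMem fun p hp => ?_
      have h1 := congrFun h0 ⟨p, hp.1⟩
      exact ((hfO p).2 hp.2).ne' h1
    · intro h0
      ext ⟨p, hp⟩
      by_contra hne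
      have : p ∈ μ.atoms ∩ O := ⟨hp, (hfO p).1 (lt_of_le_of_ne (hf0 p) (Ne.symm hne))⟩
      rw [h0] at this
      exact this
  let hk : ℕ → Conf d → ℝ := fun k μ => max 0 (1 - k * g μ)
  have hkm : ∀ k, Measurable (hk k) := fun k => by fun_prop
  have hkc : ∀ k, Continuous (hk k) := fun k => by fun_prop
  have hkb : ∀ k μ, |hk k μ| ≤ 1 := fun k μ => by
    have h0 : 0 ≤ hk k μ := le_max_left _ _
    rw [abs_of_nonneg h0]
    refine max_le zero_le_one ?_
    have := mul_nonneg (Nat.cast_nonneg (α := ℝ) k) (hg0 μ)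
    linarith
  have hlim : ∀ μ, Tendsto (fun k => hk k μ) atTop
      (𝓝 ({μ : Conf d | μ.atoms ∩ O = ∅}.indicator 1 μ)) := fun μ => by
    by_cases hμ : μ.atoms ∩ O = ∅
    · rw [Set.indicator_of_mem (s := {μ : Conf d | μ.atoms ∩ O = ∅}) hμ]
      simp [hk, (hgv μ).2 hμ]
    · rw [Set.indicator_of_notMem (s := {μ : Conf d | μ.atoms ∩ O = ∅}) hμ]
      have hgp : 0 < g μ := lt_of_le_of_ne (hg0 μ) fun h => hμ ((hgv μ).1 h.symm)
      refine tendsto_const_nhds.congr' ?_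
      have h1 : Tendsto (fun k : ℕ => (k : ℝ) * g μ) atTop atTop :=
        tendsto_natCast_atTop_atTop.atTop_mul_const hgp
      filter_upwards [h1.eventually_ge_atTop 1] with k hk1
      exact (max_eq_left (by linarith)).symm
  have hT : ∀ (ν : Measure (Conf d)) [IsProbabilityMeasure ν],
      Tendsto (fun k => ∫ μ, hk k μ ∂ν) atTop (𝓝 (ν.real {μ : Conf d | μ.atoms ∩ O = ∅})) := by
    intro ν _
    rw [← integral_indicator_one (measurableSet_atoms_inter_eq_empty hO.measurableSet)]
    exact tendsto_integral_of_dominated_convergence (fun _ => 1)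
      (fun k => (hkm k).aestronglyMeasurable) (integrable_const _)
      (fun k => ae_of_all _ fun μ => hkb k μ) (ae_of_all _ hlim)
  have h1 := hT ν
  simp_rw [fun k => h (hk k) (hkc k) (hkm k) ⟨1, hkb k⟩] at h1
  exact (measureReal_eq_measureReal_iff).1 (tendsto_nhds_unique h1 (hT ν'))

/-- A positive finite intensity makes the Palm version unique, so both convergence statements
concern the same conditional laws. -/
theorem IsTailConfiguration.unique {r : ℝ → ℝ} {L : Measure (MarkedConf d)}
    {ν ν' : Measure (Conf d)} (h : IsTailConfiguration r L ν) (h' : IsTailConfiguration r L ν')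
    (h0 : intensity L ≠ 0) (h1 : intensity L ≠ ∞) : ν = ν' := by
  have := h.prob
  have := h'.prob
  obtain ⟨Lt, hL, hc⟩ := h.conv
  obtain ⟨Lt', hL', hc'⟩ := h'.conv
  obtain rfl := hL.unique hL' h0 h1
  exact conf_measure_ext fun f hf hm hb => tendsto_nhds_unique (hc f hf hm hb) (hc' f hf hm hb)

/-! ### Existence of the tail configuration -/

theorem score_scale {u : ℝ} (hu : 0 < u) (μ : Conf d) (t : Pos d) :
    score (scale 1 u μ) t = score μ t / u := by
  by_cases h : ∃ s, (t, s) ∈ μ.atoms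
  · obtain ⟨s, hs⟩ := h
    have h1 : ((t, s / u) : Pos d × ℝ) ∈ (scale 1 u μ).atoms := by
      rw [mem_scale hu]
      simpa [mul_div_cancel₀ s hu.ne'] using hs
    exact (score_of_mem h1).trans (congrArg (· / u) (score_of_mem hs).symm)
  · push Not at h
    rw [score_of_notMem h, zero_div]
    exact score_of_notMem fun s hs => h _ ((mem_scale hu _ _).1 hs)

section

variable {w : Pos d → ℝ} {Φ : Pos d → GroundConf d → GroundConf d}

theorem score_clusterAt_zero (hΦ : IsNeighborhoodRule Φ) {x : Pos d} {S : GroundConf d}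
    (h0 : 0 ∈ S.pts) (hx : x ∈ (Φ 0 S).pts) (hwx : 0 < w x) :
    score (clusterAt w Φ x S) 0 = w x :=
  score_of_mem (p := (0, w x)) ((mem_clusterAt hΦ x S _).2 ⟨h0, hx, by simp, hwx⟩)

theorem ae_groundCount_mem (S : GroundConf d) : ∀ᵐ x ∂groundCount d S, x ∈ S.pts :=
  ae_restrict_mem S.countable_pts.measurableSet

theorem scale_scale {u v : ℝ} (hu : 0 < u) (hv : 0 < v) (μ : Conf d) :
    scale 1 u (scale 1 v μ) = scale 1 (v * u) μ := by
  ext p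
  rw [mem_scale hu, mem_scale hv, mem_scale (mul_pos hv hu), mul_assoc]

/-- The polar decomposition: the sampled configuration has score `(s ^ α⁻¹)⁻¹` at the origin, and
dividing by it removes `s`. After normalization, radius and angular part are therefore independent,
the radius being Pareto. -/
theorem lintegral_score_scale_jumpMeasure (hw_nonneg : ∀ x, 0 ≤ w x) (hΦ : IsNeighborhoodRule Φ)
    {α : ℝ} (hα : 0 < α) {Λ : Measure (GroundConf d)} {ν : Measure (Conf d)}
    (hν : IsJumpMeasure w Φ α Λ ν) {F : ℝ × Conf d → ℝ≥0∞} (hF : Measurable F) :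
    ∫⁻ μ, F (score μ 0, scale 1 (score μ 0) μ) ∂ν = ∫⁻ S, ∫⁻ x, ENNReal.ofReal (w x ^ α) *
      (∫⁻ s in Set.Ioo (0 : ℝ) 1, F ((s ^ α⁻¹)⁻¹, scale 1 (w x) (clusterAt w Φ x (addOrigin S))))
        ∂groundCount d (Φ 0 (addOrigin S)) ∂Λ := by
  have hsc : Measurable fun μ : Conf d => score μ 0 :=
    measurable_score.comp (measurable_const.prodMk measurable_id)
  have hFm : Measurable fun μ : Conf d => F (score μ 0, scale 1 (score μ 0) μ) :=
    hF.comp (hsc.prodMk (measurable_scale.comp (hsc.prodMk measurable_id)))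
  rw [hν _ hFm]
  refine lintegral_congr fun S => lintegral_congr_ae ?_
  filter_upwards [ae_groundCount_mem (Φ 0 (addOrigin S))] with x hx
  rw [jumpIntegral]
  rcases (hw_nonneg x).eq_or_lt with hwx | hwx
  · rw [← hwx, Real.zero_rpow hα.ne', ENNReal.ofReal_zero, zero_mul, zero_mul]
  congr 1
  refine setLIntegral_congr_fun measurableSet_Ioo fun s hs => ?_
  have hs0 : 0 < s ^ α⁻¹ := Real.rpow_pos_of_pos hs.1 _
  have h1 : score (scale 1 (w x * s ^ α⁻¹) (clusterAt w Φ x (addOrigin S))) 0 =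
      (s ^ α⁻¹)⁻¹ := by
    rw [score_scale (mul_pos hwx hs0), score_clusterAt_zero hΦ (zero_mem_addOrigin S) hx hwx]
    field_simp
  simp only [h1]
  rw [scale_scale (inv_pos.2 hs0) (mul_pos hwx hs0), mul_inv_cancel_right₀ hs0.ne']

theorem jumpMeasure_univ {α : ℝ} {Λ : Measure (GroundConf d)} {ν : Measure (Conf d)}
    (hν : IsJumpMeasure w Φ α Λ ν) : ν Set.univ = ∫⁻ S, ∫⁻ x, ENNReal.ofReal (w x ^ α)
        ∂groundCount d (Φ 0 (addOrigin S)) ∂Λ := by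
  have h1 := hν 1 measurable_one
  simp only [Pi.one_apply, lintegral_one, jumpIntegral_one] at h1
  exact h1

theorem lintegral_score_jumpMeasure (hw : Measurable w) (hw_nonneg : ∀ x, 0 ≤ w x)
    (hΦ : IsNeighborhoodRule Φ) {α : ℝ} (hα : 0 < α) {Λ : Measure (GroundConf d)}
    {ν : Measure (Conf d)} (hν : IsJumpMeasure w Φ α Λ ν) {f : ℝ → ℝ≥0∞} (hf : Measurable f) :
    ∫⁻ μ, f (score μ 0) ∂ν = ν Set.univ * ∫⁻ s in Set.Ioo (0 : ℝ) 1, f ((s ^ α⁻¹)⁻¹) := by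
  have hwm : Measurable fun x => ENNReal.ofReal (w x ^ α) := by fun_prop
  have h1 := lintegral_score_scale_jumpMeasure hw_nonneg hΦ hα hν (F := fun q => f q.1)
    (hf.comp measurable_fst)
  simp only at h1
  rw [h1, jumpMeasure_univ hν, ← lintegral_mul_const _ (measurable_lintegral_kernel_comp
    (groundCount d) (measurable_neighborhood_zero hΦ) (f := fun _ x => ENNReal.ofReal (w x ^ α))
    (hwm.comp measurable_snd))]
  exact lintegral_congr fun S => lintegral_mul_const _ hwm

theorem isTailConfiguration_jumpMeasure (hw : Measurable w) (hw_nonneg : ∀ x, 0 ≤ w x)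
    (hw_zero : 0 < w 0) {C : ℝ} (hC : ∀ x, w x ≤ C) (hΦ : IsNeighborhoodRule Φ)
    {m : Measure ℝ} [IsProbabilityMeasure m]
    {α : ℝ} (hα : 0 < α) (hreg : IsRegularlyVaryingTail m α)
    (hm : ∀ᵐ a ∂(Measure.infinitePi fun _ : ℕ => m), ∀ i, 0 < a i)
    {μT : Measure (ℕ → Pos d)} [IsProbabilityMeasure μT]
    (hv : ∀ᵐ τ ∂μT, IsLocallyFiniteSeq τ) (h0 : ∀ᵐ τ ∂μT, ∀ i, τ i ≠ 0)
    (hN : ∫⁻ S, (((Φ 0 (addOrigin S)).pts.encard : ℕ∞) : ℝ≥0∞) ∂(μT.map seqGround) ≠ ∞)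
    {ν : Measure (Conf d)} (hν : IsJumpMeasure w Φ α (μT.map seqGround) ν)
    {L : Measure (MarkedConf d)} (hL : IsPalmVersion L (palmLaw w Φ m μT)) :
    IsTailConfiguration (fun _ => 1) L ((ν Set.univ)⁻¹ • ν) := by
  have hC0 : 0 < C := hw_zero.trans_le (hC 0)
  have : IsProbabilityMeasure (μT.map seqGround) :=
    Measure.isProbabilityMeasure_map measurable_seqGround.aemeasurable
  have hν0 := jumpMeasure_univ_ne_zero hw_zero hΦ hν
  have hν1 := jumpMeasure_univ_ne_top hw_nonneg hC hα hN hν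
  have : IsFiniteMeasure ν := ⟨hν1.lt_top⟩
  refine ⟨⟨?_⟩, ?_, palmLaw w Φ m μT, hL, fun h hc hmeas ⟨K, hK⟩ => ?_⟩
  · rw [Measure.smul_apply, smul_eq_mul, ENNReal.inv_mul_cancel hν0 hν1]
  · refine Measure.ae_smul_measure ?_ _
    have hms : MeasurableSet {x : ℝ | ¬ 1 < x} := measurableSet_Ioi.compl
    have h1 := lintegral_score_jumpMeasure hw hw_nonneg hΦ hα hν
      (f := Set.indicator {x : ℝ | ¬ 1 < x} 1) (measurable_one.indicator hms)
    have h2 : ∫⁻ s in Set.Ioo (0 : ℝ) 1,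
        Set.indicator {x : ℝ | ¬ 1 < x} (1 : ℝ → ℝ≥0∞) ((s ^ α⁻¹)⁻¹) = 0 := by
      refine setLIntegral_eq_zero measurableSet_Ioo fun s hs => ?_
      refine Set.indicator_of_notMem (fun hn => absurd ?_ hn) _
      exact (one_lt_inv₀ (Real.rpow_pos_of_pos hs.1 _)).2
        (Real.rpow_lt_one hs.1.le hs.2 (inv_pos.2 hα))
    have hsc : Measurable fun μ : Conf d => score μ 0 :=
      measurable_score.comp (measurable_const.prodMk measurable_id)
    have hfm : Measurable fun μ : Conf d =>
        Set.indicator {x : ℝ | ¬ 1 < x} (1 : ℝ → ℝ≥0∞) (score μ 0) :=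
      (measurable_one.indicator hms).comp hsc
    rw [h2, mul_zero, lintegral_eq_zero_iff hfm] at h1
    filter_upwards [h1] with μ hμ
    by_contra hlt
    have : Set.indicator {x : ℝ | ¬ 1 < x} (1 : ℝ → ℝ≥0∞) (score μ 0) = 1 :=
      Set.indicator_of_mem (s := {x : ℝ | ¬ 1 < x}) hlt _
    exact one_ne_zero (this.symm.trans hμ)
  · have hlim : ∀ {f : Conf d → ℝ}, Continuous f → Measurable f → (∀ μ, 0 ≤ f μ) →
        ∀ {B : ℝ}, (∀ μ, f μ ≤ B) → Tendsto (fun u => (m.real (Set.Ioi u))⁻¹ *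
          ∫ μ in {μ : MarkedConf d | u < score μ.1 0}, f (scale 1 u μ.1) ∂palmLaw w Φ m μT) atTop
          (𝓝 (∫ μ, f μ ∂ν)) := fun {f} hfc hfm hf0 B hB => by
      rw [integral_eq_lintegral_of_nonneg_ae (ae_of_all _ hf0) hfm.aestronglyMeasurable]
      exact tendsto_setIntegral_palmLaw hw hw_nonneg hC0 hC hΦ hα hreg hm hv h0 hN hν hfc hfm
        hf0 hB
    have hK0 : ∀ μ, 0 ≤ h μ + K := fun μ => by linarith [neg_abs_le (h μ), hK μ]
    have hK1 : ∀ μ, h μ + K ≤ 2 * K := fun μ => by linarith [le_abs_self (h μ), hK μ]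
    have : IsProbabilityMeasure (palmLaw w Φ m μT) := hL.prob
    have l1 := hlim (f := fun _ => 1) continuous_const measurable_const (fun _ => zero_le_one)
      (B := 1) fun _ => le_rfl
    have l2 := hlim (f := fun μ => h μ + K) (hc.add continuous_const) (hmeas.add_const K) hK0 hK1
    have hint : Integrable h ν := Integrable.of_bound hmeas.aestronglyMeasurable K
      (ae_of_all _ fun μ => hK μ)
    have hlim0 : ∫ _, (1 : ℝ) ∂ν ≠ 0 := by
      simp [Measure.real, ENNReal.toReal_eq_zero_iff, hν0, hν1]
    -- The limit theorem is for nonnegative functions, so `h` is raised by `K`, which is subtracted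
    -- again. The constant function `1` gives the asymptotics of the conditioning event, and the
    -- tail of `m` cancels in the quotient.
    have l3 := (l2.sub (l1.const_mul K)).div l1 hlim0
    have hval : (∫ μ, (h μ + K) ∂ν - K * ∫ _, (1 : ℝ) ∂ν) / ∫ _, (1 : ℝ) ∂ν =
        ∫ μ, h μ ∂((ν Set.univ)⁻¹ • ν) := by
      rw [integral_add hint (integrable_const K), integral_smul_measure]
      simp only [integral_const, smul_eq_mul, mul_one, ENNReal.toReal_inv, Measure.real]
      field_simp
      ring
    rw [hval] at l3
    refine l3.congr fun u => ?_
    have hV := hreg.pos u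
    have hhu : Integrable (fun μ : MarkedConf d => h (scale 1 u μ.1))
        ((palmLaw w Φ m μT).restrict {μ | u < score μ.1 0}) :=
      Integrable.of_bound (hmeas.comp (measurable_scale.comp
        (measurable_const.prodMk measurable_subtype_coe))).aestronglyMeasurable K
        (ae_of_all _ fun μ => hK _)
    simp only [Pi.div_apply]
    rw [integral_add hhu (integrable_const K)]
    simp only [integral_const, smul_eq_mul, mul_one, measureReal_restrict_apply_univ]
    rw [mul_add, mul_comm _ K, mul_left_comm, add_sub_cancel_right,
      mul_div_mul_left _ _ (inv_ne_zero hV.ne')]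

end

/-! ### Shift invariant functionals of configurations -/

theorem mem_shift (z : Pos d) (μ : Conf d) (p : Pos d × ℝ) :
    p ∈ (shift z μ).atoms ↔ (p.1 + z, p.2) ∈ μ.atoms := Iff.rfl

theorem maxScore_shift (z : Pos d) (μ : Conf d) : maxScore (shift z μ) = maxScore μ := by
  rw [maxScore, maxScore]
  congr 1
  ext s
  constructor
  · rintro ⟨p, hp, rfl⟩
    exact ⟨_, hp, rfl⟩
  · rintro ⟨p, hp, rfl⟩
    exact ⟨(p.1 - z, p.2), by simpa [mem_shift] using hp, rfl⟩

open scoped Pointwise in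
theorem maxScore_scale {u : ℝ} (hu : 0 < u) (μ : Conf d) :
    maxScore (scale 1 u μ) = maxScore μ / u := by
  have : Prod.snd '' (scale 1 u μ).atoms = u⁻¹ • (Prod.snd '' μ.atoms) := by
    ext s
    rw [Set.mem_smul_set]
    constructor
    · rintro ⟨p, hp, rfl⟩
      exact ⟨u * p.2, ⟨_, (mem_scale hu _ _).1 hp, rfl⟩, by simp [hu.ne']⟩
    · rintro ⟨_, ⟨p, hp, rfl⟩, rfl⟩
      refine ⟨(p.1, u⁻¹ * p.2), (mem_scale hu _ _).2 ?_, rfl⟩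
      simpa [hu.ne'] using hp
  rw [maxScore, this, Real.sSup_smul_of_nonneg (inv_pos.2 hu).le, smul_eq_mul, div_eq_inv_mul]
  rfl

theorem scoreSum_eq_lintegral (α : ℝ) (μ : Conf d) :
    scoreSum α μ = ∫⁻ p, ENNReal.ofReal (p.2 ^ α) ∂confCount d μ :=
  (lintegral_confCount μ fun p => ENNReal.ofReal (p.2 ^ α)).symm

theorem scoreSum_shift (α : ℝ) (z : Pos d) (μ : Conf d) :
    scoreSum α (shift z μ) = scoreSum α μ := by
  rw [scoreSum_eq_lintegral, lintegral_confCount_shift, scoreSum_eq_lintegral]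

theorem ae_confCount_mem (μ : Conf d) : ∀ᵐ p ∂confCount d μ, p ∈ μ.atoms :=
  ae_restrict_mem μ.countable_atoms.measurableSet

theorem scoreSum_scale (α : ℝ) {u : ℝ} (hu : 0 < u) (μ : Conf d) :
    scoreSum α (scale 1 u μ) = ENNReal.ofReal (u⁻¹ ^ α) * scoreSum α μ := by
  rw [scoreSum_eq_lintegral, lintegral_confCount_scale hu, scoreSum_eq_lintegral,
    ← lintegral_const_mul' _ _ ENNReal.ofReal_ne_top]
  refine lintegral_congr_ae ?_
  filter_upwards [ae_confCount_mem μ] with p hp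
  rw [← ENNReal.ofReal_mul (Real.rpow_nonneg (inv_pos.2 hu).le _),
    ← Real.mul_rpow (inv_pos.2 hu).le (μ.pos p hp).le, div_eq_inv_mul]

theorem finite_of_scoreSum_ne_top {α : ℝ} (hα : 0 < α) {μ : Conf d} (h : scoreSum α μ ≠ ∞) (ε : ℝ)
    (hε : 0 < ε) : {p | p ∈ μ.atoms ∧ ε < p.2}.Finite := by
  have h1 := ENNReal.finite_const_le_of_tsum_ne_top h (ε := ENNReal.ofReal (ε ^ α))
    (ENNReal.ofReal_pos.2 (Real.rpow_pos_of_pos hε _)).ne'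
  refine (h1.image Subtype.val).subset ?_
  rintro p ⟨hp, hlt⟩
  exact ⟨⟨p, hp⟩, ENNReal.ofReal_le_ofReal (Real.rpow_le_rpow hε.le hlt.le hα.le), rfl⟩

/-- The lexicographic order is translation invariant, which makes the first maximum anchor
shift-equivariant. -/
theorem toLex_zero_le_sub_iff (t t' : Pos d) :
    toLex (fun i => (0 : Pos d) i) ≤ toLex (fun i => (t' - t) i) ↔
      toLex (fun i => t i) ≤ toLex (fun i => t' i) :=
  sub_nonneg (a := toLex fun i => t' i) (b := toLex fun i => t i)

theorem isFirstMaximum_shift (t : Pos d) (μ : Conf d) :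
    IsFirstMaximum (shift t μ) 0 ↔ IsFirstMaximum μ t := by
  rw [IsFirstMaximum, IsFirstMaximum, maxScore_shift, mem_shift, zero_add]
  refine and_congr_right fun _ => ⟨fun h t' ht' => ?_, fun h t' ht' => ?_⟩
  · exact (toLex_zero_le_sub_iff t t').1
      (h (t' - t) (by rw [mem_shift, sub_add_cancel]; exact ht'))
  · have h1 := (toLex_zero_le_sub_iff t (t' + t)).2 (h (t' + t) ht')
    rwa [add_sub_cancel_right] at h1

theorem isFirstMaximum_scale {u : ℝ} (hu : 0 < u) (μ : Conf d) (t : Pos d) :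
    IsFirstMaximum (scale 1 u μ) t ↔ IsFirstMaximum μ t := by
  have h : ∀ t', (t', maxScore μ / u) ∈ (scale 1 u μ).atoms ↔ (t', maxScore μ) ∈ μ.atoms :=
    fun t' => by
      rw [mem_scale hu]
      simp [mul_div_cancel₀ _ hu.ne']
  simp only [IsFirstMaximum, maxScore_scale hu, h]

theorem measurableSet_isFirstMaximum_zero :
    MeasurableSet {μ : Conf d | IsFirstMaximum μ 0} := by
  -- `D` marks the atoms that attain the maximum at a position lexicographically below the origin.
  -- The first maximum is at `0` iff the score there is positive and maximal and no atom is in `D`.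
  let D : Set (Conf d × (Pos d × ℝ)) :=
    {q | q.2.2 = maxScore q.1 ∧ ∃ i, (∀ j < i, q.2.1 j = 0) ∧ q.2.1 i < 0}
  have hcoord : ∀ i, Measurable fun q : Conf d × (Pos d × ℝ) => q.2.1 i := fun i =>
    (EuclideanSpace.proj (𝕜 := ℝ) i).continuous.measurable.comp
      (measurable_fst.comp measurable_snd)
  have hD : MeasurableSet D := by
    refine (measurableSet_eq_fun (measurable_snd.comp measurable_snd)
      (measurable_maxScore.comp measurable_fst)).inter ?_
    have : {q : Conf d × (Pos d × ℝ) | ∃ i, (∀ j < i, q.2.1 j = 0) ∧ q.2.1 i < 0} =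
        ⋃ i, (⋂ j, ⋂ _ : j < i, {q | q.2.1 j = 0}) ∩ {q | q.2.1 i < 0} := by
      ext q
      simp
    change MeasurableSet {q : Conf d × (Pos d × ℝ) | ∃ i, (∀ j < i, q.2.1 j = 0) ∧ q.2.1 i < 0}
    rw [this]
    exact MeasurableSet.iUnion fun i => (MeasurableSet.iInter fun j => MeasurableSet.iInter
      fun _ => hcoord j (measurableSet_singleton 0)).inter (hcoord i measurableSet_Iio)
  have hsc : Measurable fun μ : Conf d => score μ 0 :=
    measurable_score.comp (measurable_const.prodMk measurable_id)
  have e : {μ : Conf d | IsFirstMaximum μ 0} = ({μ | 0 < score μ 0} ∩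
      {μ | score μ 0 = maxScore μ}) ∩
      {μ | ∫⁻ p, D.indicator 1 (μ, p) ∂confCount d μ = 0} := by
    ext μ
    refine and_congr ?_ ?_
    · constructor
      · intro h
        have h1 := score_of_mem h
        exact ⟨(μ.pos _ h).trans_eq h1.symm, h1⟩
      · rintro ⟨h1, h2⟩
        have h3 : ∃ s, ((0 : Pos d), s) ∈ μ.atoms := by
          by_contra h
          push Not at h
          exact (score_of_notMem h).not_gt h1
        obtain ⟨s, hs⟩ := h3
        have h4 : maxScore μ = s := h2.symm.trans (score_of_mem hs)
        rwa [h4]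
    · rw [Set.mem_ofPred_eq, lintegral_confCount, ENNReal.tsum_eq_zero]
      constructor
      · rintro h ⟨p, hp⟩
        refine Set.indicator_of_notMem ?_ _
        rintro ⟨h1, i, h2, h3⟩
        refine (h p.1 (by rw [← (show p.2 = maxScore μ from h1)]; exact hp)).not_gt ?_
        exact ⟨i, fun j hj => h2 j hj, h3⟩
      · intro h t' ht'
        by_contra hlt
        obtain ⟨i, h2, h3⟩ := not_le.1 hlt
        have h4 := h ⟨_, ht'⟩
        rw [Set.indicator_of_mem (show (μ, (t', maxScore μ)) ∈ D from
          ⟨rfl, i, fun j hj => h2 j hj, h3⟩)] at h4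
        exact one_ne_zero h4
  rw [e]
  refine ((measurableSet_lt measurable_const hsc).inter
    (measurableSet_eq_fun hsc measurable_maxScore)).inter ?_
  exact measurable_lintegral_kernel_comp (confCount d) measurable_id
    (f := fun μ p => D.indicator 1 (μ, p)) (measurable_one.indicator hD)
    (measurableSet_singleton 0)

theorem measurableSet_tailConf : MeasurableSet
    {μ : Conf d | ∀ ε : ℝ, 0 < ε → {p | p ∈ μ.atoms ∧ ε < p.2}.Finite} := by
  have e : {μ : Conf d | ∀ ε : ℝ, 0 < ε → {p | p ∈ μ.atoms ∧ ε < p.2}.Finite} =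
      ⋂ n : ℕ, {μ | confCount d μ {p | 1 / ((n : ℝ) + 1) < p.2} < ∞} := by
    ext μ
    simp only [Set.mem_iInter, Set.mem_ofPred_eq]
    have hn : ∀ n : ℕ, confCount d μ {p | 1 / ((n : ℝ) + 1) < p.2} < ∞ ↔
        {p | p ∈ μ.atoms ∧ 1 / ((n : ℝ) + 1) < p.2}.Finite := fun n => by
      rw [confCount_apply' μ (measurableSet_lt measurable_const measurable_snd)]
      have : μ.atoms ∩ {p | 1 / ((n : ℝ) + 1) < p.2} =
        {p | p ∈ μ.atoms ∧ 1 / ((n : ℝ) + 1) < p.2} := rfl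
      rw [this, ← Set.encard_lt_top_iff]
      simp [lt_top_iff_ne_top]
    simp_rw [hn]
    constructor
    · exact fun h n => h _ (by positivity)
    · intro h ε hε
      obtain ⟨n, hn⟩ := exists_nat_one_div_lt hε
      exact (h n).subset fun p hp => ⟨hp.1, hn.trans hp.2⟩
  rw [e]
  exact MeasurableSet.iInter fun n => (confCount d).measurable_coe
    (measurableSet_lt measurable_const measurable_snd) measurableSet_Iio

/-! ### Events of shift classes and first maxima -/

theorem setOf_classMem (B : Set (ClusterClass d)) : {μ : Conf d | ClassMem μ B} =
    (Subtype.val : TailConf d → Conf d) '' (Quotient.mk (shiftSetoid d) ⁻¹' B) := by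
  ext μ
  constructor
  · rintro ⟨h, hB⟩
    exact ⟨⟨μ, h⟩, hB, rfl⟩
  · rintro ⟨⟨ν, h⟩, hB, rfl⟩
    exact ⟨h, hB⟩

theorem measurableSet_classMem {B : Set (ClusterClass d)} (hB : MeasurableSet B) :
    MeasurableSet {μ : Conf d | ClassMem μ B} := by
  rw [setOf_classMem]
  exact measurableSet_tailConf.subtype_image (measurable_quotient_mk' (s := shiftSetoid d) hB)

theorem classLaw_apply (L : Measure (Conf d)) {B : Set (ClusterClass d)} (hB : MeasurableSet B) :
    classLaw L B = L {μ | ClassMem μ B} := by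
  have hmk : Measurable (Quotient.mk (shiftSetoid d) : TailConf d → ClusterClass d) :=
    measurable_quotient_mk' (s := shiftSetoid d)
  rw [classLaw, Measure.map_apply hmk hB,
    (MeasurableEmbedding.subtype_coe measurableSet_tailConf).comap_apply, setOf_classMem]
  rfl

theorem classMem_shift (z : Pos d) (μ : Conf d) (B : Set (ClusterClass d)) :
    ClassMem (shift z μ) B ↔ ClassMem μ B := by
  have key : ∀ (z : Pos d) (μ : Conf d), ClassMem μ B → ClassMem (shift z μ) B := by
    rintro z μ ⟨h, hB⟩
    have hz : ∀ ε : ℝ, 0 < ε → {p | p ∈ (shift z μ).atoms ∧ ε < p.2}.Finite := fun ε hε => by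
      have hinj : Function.Injective (fun p : Pos d × ℝ => (p.1 + z, p.2)) := by
        rintro ⟨a, b⟩ ⟨a', b'⟩ h
        simpa using h
      exact (h ε hε).preimage hinj.injOn
    refine ⟨hz, ?_⟩
    have : (Quotient.mk (shiftSetoid d) ⟨shift z μ, hz⟩ : ClusterClass d) =
        Quotient.mk (shiftSetoid d) ⟨μ, h⟩ :=
      (Quotient.sound (s := shiftSetoid d) (a := ⟨μ, h⟩) (b := ⟨shift z μ, hz⟩) ⟨z, rfl⟩).symm
    rwa [this]
  refine ⟨fun h => ?_, key z μ⟩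
  have h1 := key (-z) _ h
  have h2 : shift (-z) (shift z μ) = μ := by
    ext p
    simp [mem_shift]
  rwa [h2] at h1

theorem scale_shift (u : ℝ) (z : Pos d) (μ : Conf d) :
    scale 1 u (shift z μ) = shift z (scale 1 u μ) := by
  ext p
  simp [scale, shift]

theorem exists_maxScore {μ : Conf d}
    (hμ : ∀ ε : ℝ, 0 < ε → {p | p ∈ μ.atoms ∧ ε < p.2}.Finite) (hne : μ.atoms.Nonempty) :
    (∀ p ∈ μ.atoms, p.2 ≤ maxScore μ) ∧ ∃! t, IsFirstMaximum μ t := by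
  refine ⟨fun p hp => le_csSup ?_ ⟨p, hp, rfl⟩, existsUnique_isFirstMaximum ⟨μ, hμ⟩ hne⟩
  obtain ⟨C, hC⟩ := ((hμ 1 one_pos).image Prod.snd).bddAbove
  refine ⟨max C 1, ?_⟩
  rintro _ ⟨q, hq, rfl⟩
  by_cases h : 1 < q.2
  · exact (hC ⟨q, ⟨hq, h⟩, rfl⟩).trans (le_max_left _ _)
  · exact (not_lt.1 h).trans (le_max_right _ _)

theorem iSup_ofReal_rpow {α : ℝ} (hα : 0 < α) {μ : Conf d}
    (hμ : ∀ ε : ℝ, 0 < ε → {p | p ∈ μ.atoms ∧ ε < p.2}.Finite) (hne : μ.atoms.Nonempty) :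
    ⨆ p ∈ μ.atoms, ENNReal.ofReal (p.2 ^ α) = ENNReal.ofReal (maxScore μ ^ α) := by
  obtain ⟨h1, t, ht, -⟩ := exists_maxScore hμ hne
  refine le_antisymm (iSup₂_le fun p hp => ENNReal.ofReal_le_ofReal
    (Real.rpow_le_rpow (μ.pos p hp).le (h1 p hp) hα.le)) ?_
  exact le_iSup₂ (f := fun (p : Pos d × ℝ) (_ : p ∈ μ.atoms) => ENNReal.ofReal (p.2 ^ α)) _ ht.1

-- Exactly one atom sits at the first maximum, so the sum has a single term.
open scoped Classical in
theorem lintegral_isFirstMaximum {μ : Conf d}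
    (hμ : ∀ ε : ℝ, 0 < ε → {p | p ∈ μ.atoms ∧ ε < p.2}.Finite) (hne : μ.atoms.Nonempty)
    (f : ℝ → ℝ≥0∞) :
    ∫⁻ p, (if IsFirstMaximum μ p.1 then f p.2 else 0) ∂confCount d μ = f (maxScore μ) := by
  obtain ⟨-, t, ht, htu⟩ := exists_maxScore hμ hne
  rw [lintegral_confCount, tsum_eq_single ⟨(t, maxScore μ), ht.1⟩]
  · rw [if_pos ht]
  · rintro ⟨p, hp⟩ hpne
    refine if_neg fun h => hpne (Subtype.ext ?_)
    exact μ.simple _ hp _ ht.1 (htu _ h)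

/-! ### The spectral tail configuration in terms of the cluster -/

section

variable {w : Pos d → ℝ} {Φ : Pos d → GroundConf d → GroundConf d}

theorem isTailIndex_jumpMeasure (hw : Measurable w) (hw_nonneg : ∀ x, 0 ≤ w x)
    (hΦ : IsNeighborhoodRule Φ) {α : ℝ} (hα : 0 < α) {Λ : Measure (GroundConf d)}
    {ν : Measure (Conf d)} (hν : IsJumpMeasure w Φ α Λ ν) (hν0 : ν Set.univ ≠ 0)
    (hν1 : ν Set.univ ≠ ∞) : IsTailIndex ((ν Set.univ)⁻¹ • ν) α := by
  refine ⟨hα, fun y hy => ?_⟩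
  have hy0 : 0 < y := one_pos.trans_le hy
  have hsc : Measurable fun μ : Conf d => score μ 0 :=
    measurable_score.comp (measurable_const.prodMk measurable_id)
  have hm : MeasurableSet {μ : Conf d | y < score μ 0} := measurableSet_lt measurable_const hsc
  have h1 := lintegral_score_jumpMeasure hw hw_nonneg hΦ hα hν
    (f := (Set.Ioi y).indicator 1) (measurable_one.indicator measurableSet_Ioi)
  have h2 : ∫⁻ μ, (Set.Ioi y).indicator (1 : ℝ → ℝ≥0∞) (score μ 0) ∂ν =
      ν {μ | y < score μ 0} := by
    rw [← lintegral_indicator_one hm]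
    rfl
  have h3 : ∫⁻ s in Set.Ioo (0 : ℝ) 1, (Set.Ioi y).indicator (1 : ℝ → ℝ≥0∞) ((s ^ α⁻¹)⁻¹) =
      ENNReal.ofReal (y ^ (-α)) := by
    have hyα : y ^ (-α) ≤ 1 := Real.rpow_le_one_of_one_le_of_nonpos hy (neg_nonpos.2 hα.le)
    have hcongr : ∫⁻ s in Set.Ioo (0 : ℝ) 1, (Set.Ioi y).indicator (1 : ℝ → ℝ≥0∞) ((s ^ α⁻¹)⁻¹) =
        ∫⁻ s in Set.Ioo (0 : ℝ) 1, (Set.Iio (y ^ (-α))).indicator (1 : ℝ → ℝ≥0∞) s := by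
      refine setLIntegral_congr_fun measurableSet_Ioo fun s hs => ?_
      have hs0 : 0 < s ^ α⁻¹ := Real.rpow_pos_of_pos hs.1 _
      have : (s ^ α⁻¹)⁻¹ ∈ Set.Ioi y ↔ s ∈ Set.Iio (y ^ (-α)) := by
        rw [Set.mem_Ioi, Set.mem_Iio, lt_inv_comm₀ hy0 hs0,
          Real.rpow_inv_lt_iff_of_pos hs.1.le (inv_pos.2 hy0).le hα, Real.inv_rpow hy0.le,
          Real.rpow_neg hy0.le]
      by_cases h : s ∈ Set.Iio (y ^ (-α))
      · rw [Set.indicator_of_mem h, Set.indicator_of_mem (this.2 h)]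
        rfl
      · rw [Set.indicator_of_notMem h, Set.indicator_of_notMem fun h' => h (this.1 h')]
    rw [hcongr, lintegral_indicator_one measurableSet_Iio,
      Measure.restrict_apply measurableSet_Iio, Set.inter_comm, Set.Ioo_inter_Iio,
      min_eq_right hyα, Real.volume_Ioo, sub_zero]
  rw [h2, h3] at h1
  rw [Measure.smul_apply, smul_eq_mul, h1, ← mul_assoc, ENNReal.inv_mul_cancel hν0 hν1, one_mul]

theorem lintegral_spectralLaw_jumpMeasure (hw_nonneg : ∀ x, 0 ≤ w x) (hΦ : IsNeighborhoodRule Φ)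
    {α : ℝ} (hα : 0 < α) {Λ : Measure (GroundConf d)} {ν : Measure (Conf d)}
    (hν : IsJumpMeasure w Φ α Λ ν) (c : ℝ≥0∞) {F : Conf d → ℝ≥0∞} (hF : Measurable F) :
    ∫⁻ μ, F μ ∂(spectralLaw (c • ν)) = c * ∫⁻ S, ∫⁻ x, ENNReal.ofReal (w x ^ α) *
      F (scale 1 (w x) (clusterAt w Φ x (addOrigin S))) ∂groundCount d (Φ 0 (addOrigin S)) ∂Λ := by
  have hsc : Measurable fun μ : Conf d => scale 1 (score μ 0) μ :=
    measurable_scale.comp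
      ((measurable_score.comp (measurable_const.prodMk measurable_id)).prodMk measurable_id)
  rw [spectralLaw, lintegral_map hF hsc, lintegral_smul_measure, smul_eq_mul]
  congr 1
  have h1 := lintegral_score_scale_jumpMeasure hw_nonneg hΦ hα hν (F := fun q => F q.2)
    (hF.comp measurable_snd)
  simp only [lintegral_const, Measure.restrict_apply_univ, Real.volume_Ioo, sub_zero,
    ENNReal.ofReal_one, mul_one] at h1
  exact h1

open scoped Classical in
theorem lintegral_groundCount_of_subset {S T : GroundConf d} (h : T.pts ⊆ S.pts)
    (f : Pos d → ℝ≥0∞) : ∫⁻ x, f x ∂groundCount d T =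
      ∫⁻ x, (if x ∈ T.pts then f x else 0) ∂groundCount d S := by
  have h1 : groundCount d T = (groundCount d S).restrict T.pts := by
    rw [groundCount_apply, groundCount_apply,
      Measure.restrict_restrict T.countable_pts.measurableSet, Set.inter_eq_left.2 h]
  rw [h1, ← lintegral_indicator T.countable_pts.measurableSet]
  rfl

-- Mass transport with the mass that the origin sends to its neighbors `x`. Seen from `x`, the
-- former origin is at `-x`; this is a neighbor of the new origin iff `0` is a neighbor of `x` in
-- the old frame, and its weight is `w (-x)`. So the received mass is a sum over the atoms `(x, w
-- (-x))` of `W`, and the cluster becomes `W` shifted by `x`.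
open scoped Classical in
theorem IsUnitPoisson.lintegral_clusterAt {Ω : Type*} [MeasurableSpace Ω] {Pr : Measure Ω}
    [IsProbabilityMeasure Pr] {S : Ω → GroundConf d} (hS : IsUnitPoisson Pr S) (hw : Measurable w)
    (hw_nonneg : ∀ x, 0 ≤ w x) (hΦ : IsNeighborhoodRule Φ) {α : ℝ} (hα : 0 < α)
    {F : Conf d → ℝ≥0∞} (hF : Measurable F) :
    ∫⁻ T, ∫⁻ x, ENNReal.ofReal (w x ^ α) * F (scale 1 (w x) (clusterAt w Φ x (addOrigin T)))
        ∂groundCount d (Φ 0 (addOrigin T)) ∂(Pr.map S) =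
      ∫⁻ T, ∫⁻ p, ENNReal.ofReal (p.2 ^ α) *
        F (shift p.1 (scale 1 p.2 (clusterW w Φ (addOrigin T))))
        ∂confCount d (clusterW w Φ (addOrigin T)) ∂(Pr.map S) := by
  let k : Pos d × GroundConf d → ℝ≥0∞ := fun q => if q.1 ∈ (Φ 0 q.2).pts then
    ENNReal.ofReal (w q.1 ^ α) * F (scale 1 (w q.1) (clusterAt w Φ q.1 q.2)) else 0
  have hk : Measurable k := by
    refine Measurable.ite ?_ (Measurable.mul (by fun_prop) (hF.comp (measurable_scale.comp
      ((hw.comp measurable_fst).prodMk (measurable_clusterAt hw hΦ))))) measurable_const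
    have h1 : Measurable fun q : Pos d × GroundConf d => (q.1, Φ 0 q.2) :=
      measurable_fst.prodMk (hΦ.measurable.comp (measurable_const.prodMk measurable_snd))
    exact h1 measurableSet_mem_pts
  have h1 := hS.mass_transport hk
  have h2 : ∀ T : GroundConf d, ∫⁻ x, ENNReal.ofReal (w x ^ α) *
      F (scale 1 (w x) (clusterAt w Φ x (addOrigin T))) ∂groundCount d (Φ 0 (addOrigin T)) =
      ∫⁻ x, k (x, addOrigin T) ∂groundCount d (addOrigin T) := fun T =>
    lintegral_groundCount_of_subset (hΦ.subset _ _ (zero_mem_addOrigin T)) _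
  simp_rw [h2]
  rw [h1]
  refine lintegral_congr fun T => ?_
  rw [lintegral_confCount_clusterW]
  refine lintegral_congr_ae ?_
  filter_upwards [ae_groundCount_mem (addOrigin T)] with x hx
  have e1 : Φ 0 (shiftGround x (addOrigin T)) = shiftGround x (Φ x (addOrigin T)) := by
    rw [← hΦ.equivariant _ x x hx, sub_self]
  have e2 : -x ∈ (Φ 0 (shiftGround x (addOrigin T))).pts ↔ 0 ∈ (Φ x (addOrigin T)).pts := by
    rw [e1]
    change -x + x ∈ (Φ x (addOrigin T)).pts ↔ _
    rw [neg_add_cancel]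
  have e3 : clusterAt w Φ (-x) (shiftGround x (addOrigin T)) =
      shift x (clusterW w Φ (addOrigin T)) := by
    rw [clusterAt, shiftGround_shiftGround, neg_add_cancel, shiftGround_zero, neg_neg]
  simp only [k, e2, e3, scale_shift]
  by_cases h0 : 0 ∈ (Φ x (addOrigin T)).pts
  · rcases (hw_nonneg (-x)).eq_or_lt with hwx | hwx
    · rw [← hwx, Real.zero_rpow hα.ne']
      simp
    · rw [if_pos h0, if_pos ⟨h0, hwx⟩]
  · rw [if_neg h0, if_neg fun h => h0 h.1]

end

/-! ### Size-biased mixtures of clusters -/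

/-- `θ` is the law of the configuration that is obtained from a random configuration with law `V`
by choosing an atom, with a size bias, and by shifting and scaling this atom to `(0, 1)`. -/
def IsClusterMixture (α : ℝ) (V θ : Measure (Conf d)) : Prop :=
  ∀ F : Conf d → ℝ≥0∞, Measurable F → ∫⁻ μ, F μ ∂θ = (∫⁻ μ, scoreSum α μ ∂V)⁻¹ *
    ∫⁻ μ, ∫⁻ p, ENNReal.ofReal (p.2 ^ α) * F (shift p.1 (scale 1 p.2 μ)) ∂confCount d μ ∂V

namespace IsClusterMixture

variable {α : ℝ} {V θ : Measure (Conf d)}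

theorem ae_scoreSum_lt_top (hc : ∫⁻ μ, scoreSum α μ ∂V ≠ ∞) :
    ∀ᵐ μ ∂V, scoreSum α μ < ∞ :=
  ae_lt_top (measurable_scoreSum α) hc

/-- Finiteness of `∑ s^α` survives shifts and scalings, and it leaves only finitely many scores
above each level. -/
theorem ae_tailConf (h : IsClusterMixture α V θ) (hα : 0 < α)
    (hc : ∫⁻ μ, scoreSum α μ ∂V ≠ ∞) :
    ∀ᵐ μ ∂θ, ∀ ε : ℝ, 0 < ε → {p | p ∈ μ.atoms ∧ ε < p.2}.Finite := by
  have hN : MeasurableSet {μ : Conf d | scoreSum α μ = ∞} :=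
    measurable_scoreSum α (measurableSet_singleton ∞)
  have h1 := h _ (measurable_one.indicator hN)
  rw [lintegral_indicator_one hN] at h1
  have h2 : ∫⁻ μ, ∫⁻ p, ENNReal.ofReal (p.2 ^ α) *
      {μ : Conf d | scoreSum α μ = ∞}.indicator 1 (shift p.1 (scale 1 p.2 μ)) ∂confCount d μ ∂V =
      0 := by
    refine (lintegral_congr_ae ?_).trans lintegral_zero
    filter_upwards [ae_scoreSum_lt_top hc] with μ hμ
    refine (lintegral_congr_ae ?_).trans lintegral_zero
    filter_upwards [ae_confCount_mem μ] with p hp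
    rw [Set.indicator_of_notMem, mul_zero]
    rw [Set.mem_ofPred_eq, scoreSum_shift, scoreSum_scale _ (μ.pos p hp)]
    exact ENNReal.mul_ne_top ENNReal.ofReal_ne_top hμ.ne
  rw [h2, mul_zero] at h1
  filter_upwards [measure_eq_zero_iff_ae_notMem.1 h1] with μ hμ
  exact finite_of_scoreSum_ne_top hα hμ

/-- After moving the chosen atom to `(0, 1)`, the first maximum is at the origin iff the chosen atom
was the first maximum. One term of the sum over atoms survives, and shift invariance of `G` removes
its position. -/
theorem setLIntegral_isFirstMaximum (h : IsClusterMixture α V θ) (hα : 0 < α)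
    (hc : ∫⁻ μ, scoreSum α μ ∂V ≠ ∞) (hne : ∀ᵐ μ ∂V, μ.atoms.Nonempty) {G : Conf d → ℝ≥0∞}
    (hG : Measurable G) (hGs : ∀ z μ, G (shift z μ) = G μ) :
    ∫⁻ μ in {μ | IsFirstMaximum μ 0}, G μ ∂θ = (∫⁻ μ, scoreSum α μ ∂V)⁻¹ *
      ∫⁻ μ, ENNReal.ofReal (maxScore μ ^ α) * G (scale 1 (maxScore μ) μ) ∂V := by
  classical
  rw [← lintegral_indicator measurableSet_isFirstMaximum_zero,
    h _ (hG.indicator measurableSet_isFirstMaximum_zero)]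
  congr 1
  refine lintegral_congr_ae ?_
  filter_upwards [ae_scoreSum_lt_top hc, hne] with μ hμ hμne
  rw [← lintegral_isFirstMaximum (finite_of_scoreSum_ne_top hα hμ.ne) hμne
    fun s => ENNReal.ofReal (s ^ α) * G (scale 1 s μ)]
  refine lintegral_congr_ae ?_
  filter_upwards [ae_confCount_mem μ] with p hp
  have h1 : shift p.1 (scale 1 p.2 μ) ∈ {μ : Conf d | IsFirstMaximum μ 0} ↔
      IsFirstMaximum μ p.1 := by
    rw [Set.mem_ofPred_eq, isFirstMaximum_shift, isFirstMaximum_scale (μ.pos p hp)]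
  by_cases hF : IsFirstMaximum μ p.1
  · rw [if_pos hF, Set.indicator_of_mem (h1.2 hF), hGs]
  · rw [if_neg hF, Set.indicator_of_notMem fun h' => hF (h1.1 h'), mul_zero]

theorem extremalIndex_eq (h : IsClusterMixture α V θ) (hα : 0 < α)
    (hc : ∫⁻ μ, scoreSum α μ ∂V ≠ ∞) (hne : ∀ᵐ μ ∂V, μ.atoms.Nonempty) :
    extremalIndex θ = (∫⁻ μ, scoreSum α μ ∂V)⁻¹ *
      ∫⁻ μ, ENNReal.ofReal (maxScore μ ^ α) ∂V := by
  have h1 := h.setLIntegral_isFirstMaximum hα hc hne (G := 1) measurable_one fun _ _ => rfl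
  simpa [extremalIndex] using h1

theorem ofReal_maxScore_le_scoreSum {μ : Conf d} (hα : 0 < α) (hμ : scoreSum α μ ≠ ∞)
    (hne : μ.atoms.Nonempty) : ENNReal.ofReal (maxScore μ ^ α) ≤ scoreSum α μ := by
  obtain ⟨-, t, ht, -⟩ := exists_maxScore (finite_of_scoreSum_ne_top hα hμ) hne
  exact ENNReal.le_tsum (f := fun p : μ.atoms => ENNReal.ofReal (p.1.2 ^ α)) ⟨_, ht.1⟩

theorem maxScore_pos {μ : Conf d} (hα : 0 < α) (hμ : scoreSum α μ ≠ ∞)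
    (hne : μ.atoms.Nonempty) : 0 < maxScore μ := by
  obtain ⟨-, t, ht, -⟩ := exists_maxScore (finite_of_scoreSum_ne_top hα hμ) hne
  exact μ.pos _ ht.1

/-- The density `M^α / ∑ s^α` and the configuration normalized to maximum one are, up to shifts,
unchanged by the choice of the atom. So they leave the sum over atoms, whose total weight `∑ s^α`
cancels the denominator. -/
theorem typicalCluster_apply (h : IsClusterMixture α V θ) (hα : 0 < α)
    (hc : ∫⁻ μ, scoreSum α μ ∂V ≠ ∞) (hne : ∀ᵐ μ ∂V, μ.atoms.Nonempty) {A : Set (Conf d)}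
    (hA : MeasurableSet A) (hAs : ∀ z μ, shift z μ ∈ A ↔ μ ∈ A) :
    typicalCluster α θ A = (extremalIndex θ)⁻¹ * ((∫⁻ μ, scoreSum α μ ∂V)⁻¹ *
      ∫⁻ μ in {μ | scale 1 (maxScore μ) μ ∈ A}, ENNReal.ofReal (maxScore μ ^ α) ∂V) := by
  have hsm : Measurable fun μ : Conf d => scale 1 (maxScore μ) μ :=
    measurable_scale.comp (measurable_maxScore.prodMk measurable_id)
  have hden : Measurable fun μ : Conf d => ENNReal.ofReal (maxScore μ ^ α) / scoreSum α μ :=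
    (measurable_maxScore.pow_const α).ennreal_ofReal.div (measurable_scoreSum α)
  have hA' : MeasurableSet {μ : Conf d | scale 1 (maxScore μ) μ ∈ A} := hsm hA
  rw [typicalCluster, Measure.smul_apply, smul_eq_mul, Measure.map_apply hsm hA,
    withDensity_apply _ (hsm hA), ← lintegral_indicator (hsm hA), h _ (hden.indicator (hsm hA)),
    ← lintegral_indicator hA']
  congr 2
  refine lintegral_congr_ae ?_
  filter_upwards [ae_scoreSum_lt_top hc, hne] with μ hμ hμne
  have hM := maxScore_pos hα hμ.ne hμne
  have hS0 : scoreSum α μ ≠ 0 := ((ENNReal.ofReal_pos.2 (Real.rpow_pos_of_pos hM α)).trans_le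
    (ofReal_maxScore_le_scoreSum hα hμ.ne hμne)).ne'
  have key : ∀ p ∈ μ.atoms, ((fun μ : Conf d => scale 1 (maxScore μ) μ) ⁻¹' A).indicator
      (fun μ => ENNReal.ofReal (maxScore μ ^ α) / scoreSum α μ) (shift p.1 (scale 1 p.2 μ)) =
      {μ : Conf d | scale 1 (maxScore μ) μ ∈ A}.indicator
        (fun μ => ENNReal.ofReal (maxScore μ ^ α) / scoreSum α μ) μ := fun p hp => by
    have hs := μ.pos p hp
    have e1 : maxScore (shift p.1 (scale 1 p.2 μ)) = maxScore μ / p.2 := by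
      rw [maxScore_shift, maxScore_scale hs]
    have e2 : shift p.1 (scale 1 p.2 μ) ∈ ((fun μ : Conf d => scale 1 (maxScore μ) μ) ⁻¹' A) ↔
        scale 1 (maxScore μ) μ ∈ A := by
      rw [Set.mem_preimage, e1, scale_shift, hAs, scale_scale (div_pos hM hs) hs,
        mul_div_cancel₀ _ hs.ne']
    have e3 : ENNReal.ofReal (maxScore (shift p.1 (scale 1 p.2 μ)) ^ α) /
        scoreSum α (shift p.1 (scale 1 p.2 μ)) =
        ENNReal.ofReal (maxScore μ ^ α) / scoreSum α μ := by
      have hsα : 0 < p.2⁻¹ ^ α := Real.rpow_pos_of_pos (inv_pos.2 hs) _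
      rw [e1, scoreSum_shift, scoreSum_scale α hs, div_eq_inv_mul (maxScore μ),
        Real.mul_rpow (inv_pos.2 hs).le hM.le, ENNReal.ofReal_mul hsα.le,
        ENNReal.mul_div_mul_left _ _ (ENNReal.ofReal_pos.2 hsα).ne' ENNReal.ofReal_ne_top]
    by_cases hmem : scale 1 (maxScore μ) μ ∈ A
    · rw [Set.indicator_of_mem (e2.2 hmem),
        Set.indicator_of_mem (s := {μ : Conf d | scale 1 (maxScore μ) μ ∈ A}) hmem, e3]
    · rw [Set.indicator_of_notMem fun h' => hmem (e2.1 h'),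
        Set.indicator_of_notMem (s := {μ : Conf d | scale 1 (maxScore μ) μ ∈ A}) hmem]
  have key2 : ∫⁻ p, ENNReal.ofReal (p.2 ^ α) *
      ((fun μ : Conf d => scale 1 (maxScore μ) μ) ⁻¹' A).indicator
      (fun μ => ENNReal.ofReal (maxScore μ ^ α) / scoreSum α μ) (shift p.1 (scale 1 p.2 μ))
      ∂confCount d μ = ∫⁻ p, ENNReal.ofReal (p.2 ^ α) *
      {μ : Conf d | scale 1 (maxScore μ) μ ∈ A}.indicator
        (fun μ => ENNReal.ofReal (maxScore μ ^ α) / scoreSum α μ) μ ∂confCount d μ := by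
    refine lintegral_congr_ae ?_
    filter_upwards [ae_confCount_mem μ] with p hp
    rw [key p hp]
  rw [key2, lintegral_mul_const _ (by fun_prop), ← scoreSum_eq_lintegral]
  by_cases hmem : scale 1 (maxScore μ) μ ∈ A
  · rw [Set.indicator_of_mem (s := {μ : Conf d | scale 1 (maxScore μ) μ ∈ A}) hmem,
      Set.indicator_of_mem (s := {μ : Conf d | scale 1 (maxScore μ) μ ∈ A}) hmem,
      ENNReal.mul_div_cancel hS0 hμ.ne]
  · rw [Set.indicator_of_notMem (s := {μ : Conf d | scale 1 (maxScore μ) μ ∈ A}) hmem,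
      Set.indicator_of_notMem (s := {μ : Conf d | scale 1 (maxScore μ) μ ∈ A}) hmem, mul_zero]

/-- The same value as for `typicalCluster`, now because conditioning selects the first maximum
instead of averaging over all atoms. -/
theorem typicalClusterCond_apply (h : IsClusterMixture α V θ) (hα : 0 < α)
    (hc : ∫⁻ μ, scoreSum α μ ∂V ≠ ∞) (hne : ∀ᵐ μ ∂V, μ.atoms.Nonempty) {A : Set (Conf d)}
    (hA : MeasurableSet A) (hAs : ∀ z μ, shift z μ ∈ A ↔ μ ∈ A) :
    typicalClusterCond θ A = (extremalIndex θ)⁻¹ * ((∫⁻ μ, scoreSum α μ ∂V)⁻¹ *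
      ∫⁻ μ in {μ | scale 1 (maxScore μ) μ ∈ A}, ENNReal.ofReal (maxScore μ ^ α) ∂V) := by
  have hsm : Measurable fun μ : Conf d => scale 1 (maxScore μ) μ :=
    measurable_scale.comp (measurable_maxScore.prodMk measurable_id)
  have hA' : MeasurableSet {μ : Conf d | scale 1 (maxScore μ) μ ∈ A} := hsm hA
  have h1 := h.setLIntegral_isFirstMaximum hα hc hne (G := A.indicator 1)
    (measurable_one.indicator hA) fun z μ => by
      by_cases hμ : μ ∈ A
      · rw [Set.indicator_of_mem ((hAs z μ).2 hμ), Set.indicator_of_mem hμ]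
        rfl
      · rw [Set.indicator_of_notMem fun h' => hμ ((hAs z μ).1 h'), Set.indicator_of_notMem hμ]
  rw [lintegral_indicator_one hA] at h1
  rw [typicalClusterCond, ProbabilityTheory.cond, Measure.smul_apply, smul_eq_mul, h1,
    ← lintegral_indicator hA']
  congr 2
  refine lintegral_congr fun μ => ?_
  by_cases hmem : scale 1 (maxScore μ) μ ∈ A
  · rw [Set.indicator_of_mem (s := {μ : Conf d | scale 1 (maxScore μ) μ ∈ A}) hmem,
      Set.indicator_of_mem hmem]
    simp
  · rw [Set.indicator_of_notMem (s := {μ : Conf d | scale 1 (maxScore μ) μ ∈ A}) hmem,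
      Set.indicator_of_notMem hmem, mul_zero]

end IsClusterMixture

/-! ### The moving maxima model -/

theorem infinitePi_ae_pos {m : Measure ℝ} [IsProbabilityMeasure m] (hm : m (Set.Iic 0) = 0) :
    ∀ᵐ a ∂(Measure.infinitePi fun _ : ℕ => m), ∀ i, 0 < a i := by
  refine ae_all_iff.2 fun i => ?_
  have h1 : ∀ᵐ x ∂m, 0 < x := by
    rw [ae_iff]
    simpa [Set.Iic] using hm
  exact (measurePreserving_eval_infinitePi (fun _ : ℕ => m) i).quasiMeasurePreserving.ae h1

section

variable {w : Pos d → ℝ} {Φ : Pos d → GroundConf d → GroundConf d}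

/-- The transported formula with `F = 1` identifies the normalizing constant `ν Set.univ` with the
mean of `∑ s^α` over `W`; general `F` then gives the mixture. -/
theorem IsUnitPoisson.isClusterMixture {Ω : Type*} [MeasurableSpace Ω] {Pr : Measure Ω}
    [IsProbabilityMeasure Pr] {S : Ω → GroundConf d} (hS : IsUnitPoisson Pr S) (hw : Measurable w)
    (hw_nonneg : ∀ x, 0 ≤ w x) (hΦ : IsNeighborhoodRule Φ) {α : ℝ} (hα : 0 < α)
    {ν : Measure (Conf d)} (hν : IsJumpMeasure w Φ α (Pr.map S) ν) :
    ∫⁻ μ, scoreSum α μ ∂(Pr.map fun ω => clusterW w Φ (addOrigin (S ω))) = ν Set.univ ∧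
    IsClusterMixture α (Pr.map fun ω => clusterW w Φ (addOrigin (S ω)))
      (spectralLaw ((ν Set.univ)⁻¹ • ν)) := by
  have hWm : Measurable fun T : GroundConf d => clusterW w Φ (addOrigin T) :=
    (measurable_clusterW hw hΦ).comp measurable_addOrigin
  have hV : (Pr.map fun ω => clusterW w Φ (addOrigin (S ω))) =
      (Pr.map S).map fun T => clusterW w Φ (addOrigin T) := by
    rw [Measure.map_map hWm hS.measurable]
    rfl
  have hc : ∫⁻ μ, scoreSum α μ ∂((Pr.map S).map fun T => clusterW w Φ (addOrigin T)) =
      ν Set.univ := by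
    have h1 := hS.lintegral_clusterAt hw hw_nonneg hΦ hα (F := 1) measurable_one
    simp only [Pi.one_apply, mul_one] at h1
    rw [lintegral_map (measurable_scoreSum α) hWm, jumpMeasure_univ hν, h1]
    simp_rw [scoreSum_eq_lintegral]
  rw [hV]
  refine ⟨hc, fun F hF => ?_⟩
  have hm : Measurable fun μ : Conf d => ∫⁻ p, ENNReal.ofReal (p.2 ^ α) *
      F (shift p.1 (scale 1 p.2 μ)) ∂confCount d μ := by
    refine measurable_lintegral_kernel_comp (confCount d) measurable_id
      (f := fun μ p => ENNReal.ofReal (p.2 ^ α) * F (shift p.1 (scale 1 p.2 μ))) ?_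
    refine Measurable.mul (by fun_prop) (hF.comp (measurable_shift.comp
      ((measurable_fst.comp measurable_snd).prodMk (measurable_scale.comp
        ((measurable_snd.comp measurable_snd).prodMk measurable_fst)))))
  rw [hc, lintegral_spectralLaw_jumpMeasure hw_nonneg hΦ hα hν _ hF,
    hS.lintegral_clusterAt hw hw_nonneg hΦ hα hF, lintegral_map hm hWm]

theorem IsMarkedPoisson.exists_tailConfiguration (hd : 0 < d) {Ω : Type*} [MeasurableSpace Ω]
    {Pr : Measure Ω} [IsProbabilityMeasure Pr] {m : Measure ℝ} [IsProbabilityMeasure m]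
    (hm : m (Set.Iic 0) = 0) {α : ℝ} (hα : 0 < α) (hreg : IsRegularlyVaryingTail m α)
    {P : Ω → MarkedConf d} (hP : IsMarkedPoisson Pr m P) (hΦ : IsNeighborhoodRule Φ)
    (hw : Measurable w) (hw_nonneg : ∀ x, 0 ≤ w x) (hw_zero : 0 < w 0)
    {C : ℝ} (hC : ∀ x, w x ≤ C)
    (hN : ∫⁻ S, (((Φ 0 (addOrigin S)).pts.encard : ℕ∞) : ℝ≥0∞)
      ∂(Pr.map fun ω => proj (P ω)) ≠ ∞) :
    ∃ ν : Measure (Conf d), IsJumpMeasure w Φ α (Pr.map fun ω => proj (P ω)) ν ∧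
      IsTailConfiguration (fun _ => 1) (Pr.map fun ω => scored w Φ (P ω))
        ((ν Set.univ)⁻¹ • ν) ∧
      intensity (Pr.map fun ω => scored w Φ (P ω)) = 1 := by
  obtain ⟨μT, hμT, hv, hlaw, hground⟩ := hP.exists_law
  have hmpos := infinitePi_ae_pos hm
  have hcamp : ∀ h : Pos d × GroundConf d → ℝ≥0∞, Measurable h →
      ∫⁻ T, ∫⁻ t, h (t, shiftGround t T) ∂groundCount d T ∂(μT.map seqGround) =
        ∫⁻ t : Pos d, ∫⁻ T, h (t, addOrigin T) ∂(μT.map seqGround) := fun h hh => by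
    rw [← hground]
    exact hP.poisson.campbell hh
  have h0 : ∀ᵐ τ ∂μT, ∀ i, τ i ≠ 0 := by
    have h1 := hP.poisson.ae_zero_notMem hd
    rw [hground] at h1
    filter_upwards [hv, ae_of_ae_map measurable_seqGround.aemeasurable h1] with τ hτ h2 i hi
    exact h2 ((mem_seqGround hτ).2 ⟨i, hi.symm⟩)
  have hX : (Pr.map fun ω => scored w Φ (P ω)) =
      (μT.prod (Measure.infinitePi fun _ : ℕ => m)).map
        fun q => scored w Φ (seqConf q.1 q.2) := by
    have hs := measurable_scored hw hw_nonneg hΦ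
    have h1 := Measure.map_map (μ := Pr) hs hP.measurable
    rw [hlaw, Measure.map_map hs measurable_seqConf] at h1
    exact h1.symm
  rw [hX, hground]
  rw [hground] at hN
  have hprob : IsProbabilityMeasure (μT.map seqGround) :=
    Measure.isProbabilityMeasure_map measurable_seqGround.aemeasurable
  obtain ⟨ν, hν⟩ := exists_jumpMeasure hw hΦ α (μT.map seqGround)
  exact ⟨ν, hν, isTailConfiguration_jumpMeasure hw hw_nonneg hw_zero hC hΦ hα hreg hmpos hv h0 hN
    hν (isPalmVersion_palmLaw hw hw_nonneg hw_zero hΦ hmpos hv h0 hcamp),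
    intensity_moving_maxima hw hw_nonneg hw_zero hΦ hmpos hcamp⟩

theorem zero_mem_clusterW (hw_zero : 0 < w 0) (hΦ : IsNeighborhoodRule Φ) (S : GroundConf d) :
    ((0 : Pos d), w 0) ∈ (clusterW w Φ (addOrigin S)).atoms :=
  ⟨zero_mem_addOrigin S, hΦ.self_mem _ _ (zero_mem_addOrigin S), by simp, hw_zero⟩

end

end MovingMaxima

end

/-! ### The proposition -/

open MovingMaxima
theorem mainTheorem8 {d : ℕ} (hd : 0 < d)
    {Ω : Type*} [MeasurableSpace Ω] (Pr : Measure Ω) [IsProbabilityMeasure Pr]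
    (m : Measure ℝ) [IsProbabilityMeasure m] (hm : m (Set.Iic 0) = 0)
    (α : ℝ) (hα : 0 < α) (hreg : IsRegularlyVaryingTail m α)
    (P : Ω → MarkedConf d) (hP : IsMarkedPoisson Pr m P)
    (Φ : Pos d → GroundConf d → GroundConf d) (hΦ : IsNeighborhoodRule Φ)
    (w : Pos d → ℝ) (hw : Measurable w) (hw_nonneg : ∀ x, 0 ≤ w x) (hw_zero : 0 < w 0)
    (hw_bdd : ∃ C : ℝ, ∀ x, w x ≤ C)
    (hN : ∫⁻ ω, (((Φ 0 (addOrigin (proj (P ω)))).pts.encard : ℕ∞) : ℝ≥0∞) ∂Pr < ∞) :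
    let X : Ω → MarkedConf d := fun ω => scored w Φ (P ω)
    let W : Ω → Conf d := fun ω => clusterW w Φ (addOrigin (proj (P ω)))
    (∃ ν : Measure (Conf d), IsTailConfiguration (fun _ => 1) (Pr.map X) ν) ∧
    ∀ ν : Measure (Conf d), IsTailConfiguration (fun _ => 1) (Pr.map X) ν →
      IsTailIndex ν α ∧
      (∀ᵐ μ ∂(spectralLaw ν), ∀ ε : ℝ, 0 < ε → {p | p ∈ μ.atoms ∧ ε < p.2}.Finite) ∧
      (∫⁻ ω, ENNReal.ofReal (maxScore (W ω) ^ α) ∂Pr ≠ 0 ∧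
        ∫⁻ ω, scoreSum α (W ω) ∂Pr ≠ ∞) ∧
      (∀ B : Set (ClusterClass d), MeasurableSet B →
        classLaw (typicalCluster α (spectralLaw ν)) B =
            (∫⁻ ω, ENNReal.ofReal (maxScore (W ω) ^ α) ∂Pr)⁻¹ *
              ∫⁻ ω in {ω | ClassMem (scale 1 (maxScore (W ω)) (W ω)) B},
                ENNReal.ofReal (maxScore (W ω) ^ α) ∂Pr ∧
        classLaw (typicalClusterCond (spectralLaw ν)) B =
          classLaw (typicalCluster α (spectralLaw ν)) B) ∧
      extremalIndex (spectralLaw ν) =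
        (∫⁻ ω, ⨆ p ∈ (W ω).atoms, ENNReal.ofReal (p.2 ^ α) ∂Pr) / ∫⁻ ω, scoreSum α (W ω) ∂Pr := by

  intro X W
  obtain ⟨C, hC⟩ := hw_bdd
  have hWm : Measurable W :=
    (measurable_clusterW hw hΦ).comp (measurable_addOrigin.comp hP.poisson.measurable)
  have hN' : ∫⁻ S, (((Φ 0 (addOrigin S)).pts.encard : ℕ∞) : ℝ≥0∞)
      ∂(Pr.map fun ω => proj (P ω)) ≠ ∞ := by
    have hm1 : Measurable fun S : GroundConf d =>
        groundCount d (Φ 0 (addOrigin S)) Set.univ :=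
      ((groundCount d).measurable_coe MeasurableSet.univ).comp (measurable_neighborhood_zero hΦ)
    simp_rw [groundCount_apply' _ MeasurableSet.univ, Set.inter_univ] at hm1
    rw [lintegral_map hm1 hP.poisson.measurable]
    exact hN.ne
  obtain ⟨ν₀, hjump, htail, hint⟩ := hP.exists_tailConfiguration hd hm hα hreg hΦ hw hw_nonneg
    hw_zero hC hN'
  have hprob : IsProbabilityMeasure (Pr.map fun ω => proj (P ω)) :=
    Measure.isProbabilityMeasure_map hP.poisson.measurable.aemeasurable
  have hν0 := jumpMeasure_univ_ne_zero hw_zero hΦ hjump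
  have hν1 := jumpMeasure_univ_ne_top hw_nonneg hC hα hN' hjump
  refine ⟨⟨_, htail⟩, fun ν hν => ?_⟩
  -- By uniqueness, the claims for an arbitrary tail configuration reduce to the explicit one.
  obtain rfl : ν = (ν₀ Set.univ)⁻¹ • ν₀ :=
    hν.unique htail (by rw [hint]; exact one_ne_zero) (by rw [hint]; exact ENNReal.one_ne_top)
  obtain ⟨hc, hmix⟩ := hP.poisson.isClusterMixture hw hw_nonneg hΦ hα hjump
  change ∫⁻ μ, scoreSum α μ ∂(Pr.map W) = _ at hc
  change IsClusterMixture α (Pr.map W) _ at hmix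
  have hne : ∀ᵐ μ ∂(Pr.map W), μ.atoms.Nonempty := by
    have hset : {μ : Conf d | μ.atoms.Nonempty} = {μ | μ.atoms ∩ Set.univ = ∅}ᶜ := by
      ext μ
      simp [Set.nonempty_iff_ne_empty]
    have hms : MeasurableSet {μ : Conf d | μ.atoms.Nonempty} := by
      rw [hset]
      exact (measurableSet_atoms_inter_eq_empty MeasurableSet.univ).compl
    exact (ae_map_iff hWm.aemeasurable hms).2
      (ae_of_all _ fun ω => ⟨_, zero_mem_clusterW hw_zero hΦ _⟩)
  have hctop : ∫⁻ μ, scoreSum α μ ∂(Pr.map W) ≠ ∞ := by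
    rw [hc]
    exact hν1
  have hc0 : ∫⁻ μ, scoreSum α μ ∂(Pr.map W) ≠ 0 := by
    rw [hc]
    exact hν0
  have hMm : Measurable fun μ : Conf d => ENNReal.ofReal (maxScore μ ^ α) :=
    (measurable_maxScore.pow_const α).ennreal_ofReal
  have eM : ∫⁻ μ, ENNReal.ofReal (maxScore μ ^ α) ∂(Pr.map W) =
      ∫⁻ ω, ENNReal.ofReal (maxScore (W ω) ^ α) ∂Pr := lintegral_map hMm hWm
  have eS : ∫⁻ μ, scoreSum α μ ∂(Pr.map W) = ∫⁻ ω, scoreSum α (W ω) ∂Pr :=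
    lintegral_map (measurable_scoreSum α) hWm
  have hϑ := hmix.extremalIndex_eq hα hctop hne
  have haeW : ∀ᵐ ω ∂Pr, scoreSum α (W ω) < ∞ :=
    ae_of_ae_map hWm.aemeasurable (IsClusterMixture.ae_scoreSum_lt_top hctop)
  have hneW : ∀ ω, (W ω).atoms.Nonempty := fun ω => ⟨_, zero_mem_clusterW hw_zero hΦ _⟩
  have hMWm : Measurable fun ω => ENNReal.ofReal (maxScore (W ω) ^ α) := hMm.comp hWm
  have hM0 : ∫⁻ ω, ENNReal.ofReal (maxScore (W ω) ^ α) ∂Pr ≠ 0 := by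
    intro h0
    rw [lintegral_eq_zero_iff hMWm] at h0
    obtain ⟨ω, h1, h2⟩ := (h0.and haeW).exists
    exact (ENNReal.ofReal_pos.2 (Real.rpow_pos_of_pos
      (IsClusterMixture.maxScore_pos hα h2.ne (hneW ω)) α)).ne' h1
  have hMtop : ∫⁻ ω, ENNReal.ofReal (maxScore (W ω) ^ α) ∂Pr ≠ ∞ := by
    refine ne_top_of_le_ne_top (eS ▸ hctop) (lintegral_mono_ae ?_)
    filter_upwards [haeW] with ω hω
    exact IsClusterMixture.ofReal_maxScore_le_scoreSum hα hω.ne (hneW ω)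
  refine ⟨isTailIndex_jumpMeasure hw hw_nonneg hΦ hα hjump hν0 hν1, hmix.ae_tailConf hα hctop,
    ⟨hM0, eS ▸ hctop⟩, fun B hB => ?_, ?_⟩
  · have hBm := measurableSet_classMem hB
    have hBs : ∀ z μ, shift z μ ∈ {μ : Conf d | ClassMem μ B} ↔ μ ∈ {μ | ClassMem μ B} :=
      fun z μ => classMem_shift z μ B
    have hsm : Measurable fun μ : Conf d => scale 1 (maxScore μ) μ :=
      measurable_scale.comp (measurable_maxScore.prodMk measurable_id)
    rw [classLaw_apply _ hB, classLaw_apply _ hB, hmix.typicalCluster_apply hα hctop hne hBm hBs,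
      hmix.typicalClusterCond_apply hα hctop hne hBm hBs]
    refine ⟨?_, rfl⟩
    have hAm : MeasurableSet {μ : Conf d | scale 1 (maxScore μ) μ ∈ {μ | ClassMem μ B}} := hsm hBm
    -- As `ϑ` is the mean of `M(W)^α` divided by the mean of `∑ s^α`, and the latter is positive and
    -- finite, the prefactor reduces to the inverse mean of `M(W)^α`.
    rw [setLIntegral_map hAm hMm hWm, hϑ, ← mul_assoc, eM,
      ENNReal.mul_inv (Or.inr hMtop) (Or.inr hM0), inv_inv, mul_right_comm,
      mul_assoc (∫⁻ μ, scoreSum α μ ∂(Pr.map W)), mul_right_comm,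
      ENNReal.mul_inv_cancel hc0 hctop, one_mul]
    rfl
  · rw [hϑ, eM, eS, ENNReal.div_eq_inv_mul]
    congr 1
    refine lintegral_congr_ae ?_
    filter_upwards [haeW] with ω hω
    exact (iSup_ofReal_rpow hα (finite_of_scoreSum_ne_top hα hω.ne) (hneW ω)).symm
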